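/- Let $n_1,n_2\ge 0$ be integers, $n=n_1+n_2+1$, and let $\mathbb S^{2m+1}\subset\mathbb C^{m+1}$ be the unit sphere with complex structure $J$ of $\mathbb C^{m+1}$. An immersion $\phi:M^m\to\mathbb S^{2m+1}$ of an $m$-manifold is Legendrian if $\langle d\phi(v),J\phi\rangle=0$ for all tangent vectors $v$; a Legendrian immersion with mean curvature vector $H=\frac1m\,\mathrm{trace}\,\sigma$ (as an immersion into the sphere) is minimal if $H=0$, and C-minimal (contact minimal) if $\operatorname{div}JH=0$, where $\operatorname{div}$ is the divergence of the induced metric. Let $\psi_i:N_i\to\mathbb S^{2n_i+1}$, $i=1,2$, be C-minimal Legendrian immersions of nonempty $n_i$-dimensional manifolds (with the induced metrics; orientability is not needed). Let $\gamma=(\gamma_1,\gamma_2):I\to\mathbb S^3\subset\mathbb C^2$ be a regular smooth Legendre curve on a nonempty open interval $I$, such that for each $i$ with $n_i\ge1$ the function $\gamma_i$ has no zeros. Then $$\phi:I\times N_1\times N_2\to\mathbb S^{2n+1}\subset\mathbb C^{n_1+1}\times\mathbb C^{n_2+1},\qquad \phi(t,p,q)=(\gamma_1(t)\psi_1(p),\gamma_2(t)\psi_2(q)),$$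 is a Legendrian immersion. Consider, for $\lambda,\mu\in\mathbb R$, the equations $$(\gamma_1'\overline{\gamma_1})(t)=-(\gamma_2'\overline{\gamma_2})(t)=-e^{i(\lambda+\mu t)}\,\overline{\gamma_1}(t)^{\,n_1+1}\,\overline{\gamma_2}(t)^{\,n_2+1}.\tag{$*$}$$ (1) $\phi$ is C-minimal if and only if, after a regular smooth change of the parameter of $\gamma$, the curve $\gamma$ is a solution of $(*)$ for some $\lambda,\mu\in\mathbb R$. (2) $\phi$ is minimal if and only if $\psi_1$ and $\psi_2$ are minimal and, after a regular smooth change of the parameter, $\gamma$ is a solution of $(*)$ for some $\lambda\in\mathbb R$ and $\mu=0$. (3) If $\gamma$ is already parametrized so that $|\gamma'|=|\gamma_1|^{n_1}|\gamma_2|^{n_2}$, then (1) and (2) hold without any change of parameter. -/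

import Mathlib

open scoped Manifold ContDiff ComplexConjugate

noncomputable section

/-! ### Submanifolds of the unit sphere of a complex inner product space, in coordinates

`F : E → V` is a local parametrization of a submanifold of the unit sphere of `V`, considered near
a point `x : E`. The complex structure of `V` is `J = (Complex.I • ·)`, and the Euclidean metric of
`V` is the real inner product (the real part of the hermitian one). -/

section Parametrized

attribute [local instance] InnerProductSpace.complexToReal

variable {E : Type*} [NormedAddCommGroup E] [NormedSpace ℝ E] [FiniteDimensional ℝ E]
variable {V : Type*} [NormedAddCommGroup V] [InnerProductSpace ℂ V]

/-- The induced metric (first fundamental form) of `F` at `x`. -/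
def inducedMetric (F : E → V) (x v w : E) : ℝ :=
  inner ℝ (fderiv ℝ F x v) (fderiv ℝ F x w)

/-- The trace `∑ gⁱʲ B(bᵢ, bⱼ)` of a bilinear map `B` on the tangent space `E` at `x`, with respect
to the induced metric `g` of `F`. It does not depend on the basis `b`. -/
def metricTrace (F : E → V) (x : E) {W : Type*} [AddCommGroup W] [Module ℝ W]
    (B : E → E → W) : W :=
  ∑ i, ∑ j,
    (Matrix.of fun k l =>
      inducedMetric F x (Module.finBasis ℝ E k) (Module.finBasis ℝ E l))⁻¹ i j •
        B (Module.finBasis ℝ E i) (Module.finBasis ℝ E j)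

/-- The span of the position vector `F x` and of the tangent space of `F` at `x`. Its orthogonal
complement is the normal space at `x` of `F` as a submanifold of the unit sphere. -/
def positionTangentSpan (F : E → V) (x : E) : Submodule ℝ V :=
  Submodule.span ℝ {F x} ⊔ LinearMap.range (fderiv ℝ F x : E →ₗ[ℝ] V)

instance (F : E → V) (x : E) : FiniteDimensional ℝ (positionTangentSpan F x) := by
  unfold positionTangentSpan; infer_instance

/-- The second fundamental form of `F` at `x`, as a submanifold of the unit sphere: the component
of the second derivative that is normal to the submanifold and tangent to the sphere. -/
def secondFundamentalForm (F : E → V) (x v w : E) : V :=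
  (positionTangentSpan F x)ᗮ.starProjection (fderiv ℝ (fderiv ℝ F) x v w)

/-- The mean curvature vector `H = (1/n) trace σ` of `F` at `x`, `n = dim E`. -/
def meanCurvatureIn (F : E → V) (x : E) : V :=
  (Module.finrank ℝ E : ℝ)⁻¹ • metricTrace F x (secondFundamentalForm F x)

/-- The divergence at `x`, with respect to the induced metric of `F`, of a vector field `X` along
`F` that is tangent to `F`. The Levi-Civita connection `∇ᵥ X` of the induced metric is the
tangential part of the derivative of `X` in the direction `v`, so `div X`, the trace of `∇ X`, is
the trace of `(v, w) ↦ ⟨∇ᵥ X, w⟩ = ⟨D X (v), D F (w)⟩`. -/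
def divergenceIn (F X : E → V) (x : E) : ℝ :=
  metricTrace F x fun v w => inner ℝ (fderiv ℝ X x v) (fderiv ℝ F x w)

/-- `div JH` of `F` at `x`; for a Legendrian `F` the field `JH` is tangent. -/
def divJHIn (F : E → V) (x : E) : ℝ :=
  divergenceIn F (fun y => Complex.I • meanCurvatureIn F y) x

end Parametrized

/-! ### Immersed manifolds (without boundary)

A point `p` of the manifold has the coordinates `extChartAt I p p` in the chart at `p`. -/

section Manifold

attribute [local instance] InnerProductSpace.complexToReal

variable {E : Type*} [NormedAddCommGroup E] [NormedSpace ℝ E]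
variable {H : Type*} [TopologicalSpace H] (I : ModelWithCorners ℝ E H)
variable {M : Type*} [TopologicalSpace M] [ChartedSpace H M]
variable {V : Type*} [NormedAddCommGroup V] [InnerProductSpace ℂ V]

/-- `φ` is a Legendrian immersion into the unit sphere of `V`: a smooth map with injective
differential that has values in the sphere and annihilates the contact form
`Λ_z(v) = ⟨v, J z⟩`. (The dimension of the sphere is `2 dim M + 1` wherever this is used.) -/
structure IsLegendrianImmersion (φ : M → V) : Prop where
  smooth : ContMDiff I 𝓘(ℝ, V) ∞ φ
  norm_eq_one : ∀ p, ‖φ p‖ = 1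
  injective : ∀ p, Function.Injective (mfderiv I 𝓘(ℝ, V) φ p)
  legendrian : ∀ p (v : TangentSpace I p),
    inner ℝ (show V from mfderiv I 𝓘(ℝ, V) φ p v) (Complex.I • φ p) = 0

variable [FiniteDimensional ℝ E]

/-- The mean curvature vector of `φ` at `p`, as an immersion into the unit sphere of `V`. -/
def meanCurvature (φ : M → V) (p : M) : V :=
  meanCurvatureIn (φ ∘ (extChartAt I p).symm) (extChartAt I p p)

/-- The divergence of `JH` at `p`, with respect to the metric induced by `φ`. -/
def divJH (φ : M → V) (p : M) : ℝ :=
  divJHIn (φ ∘ (extChartAt I p).symm) (extChartAt I p p)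

/-- `φ` is minimal: its mean curvature vector vanishes. -/
def IsMinimalImmersion (φ : M → V) : Prop := ∀ p, meanCurvature I φ p = 0

/-- A Legendrian immersion `φ` is contact minimal (C-minimal) if `div JH = 0`. -/
def IsCMinimal (φ : M → V) : Prop := ∀ p, divJH I φ p = 0

end Manifold

/-! ### Legendre curves in the unit sphere of `ℂ²` -/

/-- `γ = (γ₁, γ₂) : I → S³ ⊂ ℂ²` is a (smooth, regular) Legendre curve. -/
structure IsLegendreCurve (I : Set ℝ) (γ₁ γ₂ : ℝ → ℂ) : Prop where
  smooth₁ : ContDiffOn ℝ ∞ γ₁ I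
  smooth₂ : ContDiffOn ℝ ∞ γ₂ I
  sphere : ∀ t ∈ I, ‖γ₁ t‖ ^ 2 + ‖γ₂ t‖ ^ 2 = 1
  regular : ∀ t ∈ I, deriv γ₁ t ≠ 0 ∨ deriv γ₂ t ≠ 0
  legendre : ∀ t ∈ I, inner ℝ (deriv γ₁ t) (Complex.I * γ₁ t) +
    inner ℝ (deriv γ₂ t) (Complex.I * γ₂ t) = 0

/-- `(γ₁, γ₂)` solves on `I` the equation with parameters `l` and `m`
`γ₁' γ̄₁ = - γ₂' γ̄₂ = - exp(i (l + m t)) γ̄₁ ^ (n₁ + 1) γ̄₂ ^ (n₂ + 1)`. -/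
def SolvesODE (n₁ n₂ : ℕ) (l m : ℝ) (I : Set ℝ) (γ₁ γ₂ : ℝ → ℂ) : Prop :=
  ∀ t ∈ I,
    deriv γ₁ t * conj (γ₁ t) = -(deriv γ₂ t * conj (γ₂ t)) ∧
    deriv γ₁ t * conj (γ₁ t) =
      -(Complex.exp (Complex.I * (l + m * t)) * conj (γ₁ t) ^ (n₁ + 1) * conj (γ₂ t) ^ (n₂ + 1))

/-- `h` is a smooth change of parameter from the open interval `J` onto `I`. -/
structure IsReparametrization (h : ℝ → ℝ) (J I : Set ℝ) : Prop where
  isOpen : IsOpen J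
  ordConnected : J.OrdConnected
  smooth : ContDiffOn ℝ ∞ h J
  deriv_ne_zero : ∀ t ∈ J, deriv h t ≠ 0
  bijOn : Set.BijOn h J I

/-- The map `φ(t, p, q) = (γ₁(t) ψ₁(p), γ₂(t) ψ₂(q))` on `I × N₁ × N₂`, with values in
`V₁ ⊕ V₂`, where the sum carries the `ℓ²` (hermitian) norm. -/
def legendrianProduct {V₁ V₂ N₁ N₂ : Type*} [AddCommGroup V₁] [Module ℂ V₁]
    [AddCommGroup V₂] [Module ℂ V₂] (I : Set ℝ) (γ₁ γ₂ : ℝ → ℂ) (ψ₁ : N₁ → V₁) (ψ₂ : N₂ → V₂)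
    (x : I × N₁ × N₂) : WithLp 2 (V₁ × V₂) :=
  WithLp.toLp 2 (γ₁ x.1 • ψ₁ x.2.1, γ₂ x.1 • ψ₂ x.2.2)

end

/-! Hermitian orthogonality of a Legendrian immersion to its tangent vectors, together with total
reality of the tangent spaces, makes `φ` induce the warped metric |γ'|² dt² + |γ₁|² g₁ + |γ₂|² g₂.
Traces therefore split into three blocks (`ProductData.metricTrace_eq`), and the curve enters only
through g = γ₁^n₁ γ₂^n₂ (γ₁γ₂' - γ₂γ₁') (`legendreAngleFun`). Its modulus is the t-dependent factor
of the volume density, and its argument is the curve's part of the Legendrian angle.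

With ω = g'/g and a = Im ω / |γ'|², the normal part of the trace of the Hessian gives
(`finrank_smul_meanCurvatureIn_eq`) n H = (a i γ₁' ψ₁ + n₁|γ₁|⁻² γ₁ H₁, a i γ₂' ψ₂ + n₂|γ₂|⁻² γ₂
H₂), and a second differentiation gives (`finrank_mul_divJHIn_eq`) n div JH = -(a' + a Re ω) +
n₁|γ₁|⁻² div JH₁ + n₂|γ₂|⁻² div JH₂. So `φ` is minimal iff H₁ = 0, H₂ = 0 and Im ω = 0. When both
factors are C-minimal, `φ` is C-minimal iff a|g| is constant, because (a|g|)' = |g| (a' + a Re ω).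

A change of parameter alters a|g| only by a constant sign. If |γ'| = |γ₁|^n₁ |γ₂|^n₂, then |g| =
|γ'|² and a|g| = Im ω is the derivative of arg g. It equals a constant m iff g/|g| = exp(i(l + mt))
for some l, that is, iff γ₁γ₂' - γ₂γ₁' = exp(i(l + mt)) γ̄₁^n₁ γ̄₂^n₂. Since γ' = (γ₁γ₂' -
γ₂γ₁')(-γ̄₂, γ̄₁) for a Legendre curve, this is the equation (`solvesODE_iff`,
`exists_solvesODE_iff`). Conversely the equation forces this speed, so the statements up to
reparametrization reduce to the normalized parameter, which exists by integrating |γ'| / (|γ₁|^n₁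
|γ₂|^n₂). -/

noncomputable section

open Filter Topology Module

/-! ### Traces with respect to the induced metric: orthonormal bases, locality, smooth dependence on
the point. -/

section MetricTrace

attribute [local instance] InnerProductSpace.complexToReal

variable {E : Type*} [NormedAddCommGroup E] [NormedSpace ℝ E] [FiniteDimensional ℝ E]
variable {V : Type*} [NormedAddCommGroup V] [InnerProductSpace ℂ V]
variable {W : Type*} [AddCommGroup W] [Module ℝ W]

/-- The first fundamental form as a bilinear map. -/
def inducedMetricBilin (F : E → V) (x : E) : E →ₗ[ℝ] E →ₗ[ℝ] ℝ :=
  LinearMap.mk₂ ℝ (inducedMetric F x)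
    (fun _ _ _ => by simp [inducedMetric, inner_add_left])
    (fun _ _ _ => by simp [inducedMetric, inner_smul_left])
    (fun _ _ _ => by simp [inducedMetric, inner_add_right])
    (fun _ _ _ => by simp [inducedMetric, inner_smul_right])

omit [FiniteDimensional ℝ E] in
@[simp] lemma inducedMetricBilin_apply (F : E → V) (x v w : E) :
    inducedMetricBilin F x v w = inducedMetric F x v w := rfl

-- With P the coordinates of `e` in an orthonormal basis, the Gram matrix is PᵀP. This makes both
-- its inverse and its invertibility explicit.
omit [FiniteDimensional ℝ E] in
lemma gram_eq_transpose_mul {ι κ : Type*} [Fintype ι] [DecidableEq ι] (F : E → V) (x : E)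
    (b : Basis ι ℝ E)
    (hb : ∀ i j, inducedMetric F x (b i) (b j) = if i = j then 1 else 0) (e : κ → E) :
    (Matrix.of fun k l => inducedMetric F x (e k) (e l)) =
      (b.toMatrix e).transpose * b.toMatrix e := by
  ext k l
  have h : ∀ k, e k = ∑ i, b.toMatrix e i k • b i := fun k => (b.sum_toMatrix_smul_self e k).symm
  rw [Matrix.of_apply, ← inducedMetricBilin_apply, h k, h l]
  simp [-Basis.sum_toMatrix_smul_self, Matrix.mul_apply, hb, mul_comm]

/-- In a basis that is orthonormal for the induced metric, the trace is the sum of the diagonal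
values. -/
lemma metricTrace_eq_sum {ι : Type*} [Fintype ι] [DecidableEq ι] (F : E → V) (x : E)
    (b : Basis ι ℝ E)
    (hb : ∀ i j, inducedMetric F x (b i) (b j) = if i = j then 1 else 0)
    (B : E →ₗ[ℝ] E →ₗ[ℝ] W) :
    metricTrace F x (fun v w => B v w) = ∑ i, B (b i) (b i) := by
  set e := finBasis ℝ E
  set P := b.toMatrix e
  set R := e.toMatrix b
  have hG : (Matrix.of fun k l => inducedMetric F x (e k) (e l)) = P.transpose * P :=
    gram_eq_transpose_mul F x b hb e
  have hRP : R * P = 1 := e.toMatrix_mul_toMatrix_flip b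
  have hPR : P * R = 1 := b.toMatrix_mul_toMatrix_flip e
  have hinv : (P.transpose * P)⁻¹ = R * R.transpose := by
    apply Matrix.inv_eq_right_inv
    calc P.transpose * P * (R * R.transpose) = P.transpose * (P * R) * R.transpose := by
          simp only [Matrix.mul_assoc]
      _ = 1 := by rw [hPR, Matrix.mul_one, ← Matrix.transpose_mul, hRP, Matrix.transpose_one]
  -- The inverse Gram matrix R Rᵀ has as entries the products of coordinates of the `b i`, so
  -- expanding B(bᵢ, bᵢ) bilinearly reproduces the defining double sum.
  have hbe : ∀ i, b i = ∑ k, R k i • e k := fun i => (e.sum_toMatrix_smul_self b i).symm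
  have key : ∀ i, B (b i) (b i) = ∑ k, ∑ l, (R k i * R l i) • B (e k) (e l) := by
    intro i
    conv_lhs => rw [hbe i]
    simp only [map_sum, map_smul, LinearMap.sum_apply, LinearMap.smul_apply, Finset.smul_sum,
      smul_smul]
    rw [Finset.sum_comm]
    refine Finset.sum_congr rfl fun k _ => Finset.sum_congr rfl fun l _ => ?_
    rw [mul_comm]
  unfold metricTrace
  rw [hG, hinv]
  simp only [key, Matrix.mul_apply, Matrix.transpose_apply, Finset.sum_smul]
  rw [Finset.sum_comm (s := Finset.univ (α := ι))]
  refine Finset.sum_congr rfl fun k _ => ?_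
  rw [Finset.sum_comm]

/-- An immersion has, at each point, a basis that is orthonormal for the induced metric. -/
lemma exists_orthonormal_basis (F : E → V) (x : E) (h : Function.Injective (fderiv ℝ F x)) :
    ∃ b : Basis (Fin (finrank ℝ E)) ℝ E,
      ∀ i j, inducedMetric F x (b i) (b j) = if i = j then 1 else 0 := by
  let L := LinearEquiv.ofInjective (fderiv ℝ F x : E →ₗ[ℝ] V) h
  have hL : ∀ y, fderiv ℝ F x (L.symm y) = y := fun y => by
    exact congrArg Subtype.val (L.apply_symm_apply y)
  -- An orthonormal basis of the image of the differential, pulled back to `E`, is orthonormal for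
  -- the induced metric.
  let o := stdOrthonormalBasis ℝ (LinearMap.range (fderiv ℝ F x : E →ₗ[ℝ] V))
  refine ⟨(o.toBasis.map L.symm).reindex (finCongr L.finrank_eq.symm), fun i j => ?_⟩
  have := orthonormal_iff_ite.1 o.orthonormal (Fin.cast L.finrank_eq i) (Fin.cast L.finrank_eq j)
  simp only [Submodule.coe_inner] at this
  simpa [inducedMetric, hL] using this

lemma metricTrace_map {W' : Type*} [AddCommGroup W'] [Module ℝ W'] (F : E → V) (x : E)
    (L : W →ₗ[ℝ] W') (B : E → E → W) :
    metricTrace F x (fun v w => L (B v w)) = L (metricTrace F x B) := by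
  simp [metricTrace, map_sum]

lemma metricTrace_add (F : E → V) (x : E) (B C : E → E → W) :
    metricTrace F x (fun v w => B v w + C v w) = metricTrace F x B + metricTrace F x C := by
  simp [metricTrace, smul_add, Finset.sum_add_distrib]

lemma metricTrace_smul (F : E → V) (x : E) (c : ℝ) (B : E → E → W) :
    metricTrace F x (fun v w => c • B v w) = c • metricTrace F x B :=
  metricTrace_map F x (LinearMap.lsmul ℝ W c) B

lemma metricTrace_inducedMetric (F : E → V) (x : E) (h : Function.Injective (fderiv ℝ F x)) :
    metricTrace F x (inducedMetric F x) = finrank ℝ E := by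
  obtain ⟨b, hb⟩ := exists_orthonormal_basis F x h
  rw [show inducedMetric F x = fun v w => inducedMetricBilin F x v w from rfl,
    metricTrace_eq_sum F x b hb]
  simp [hb]

section Congr

variable {F G : E → V} {x : E}

lemma metricTrace_congr (h : F =ᶠ[𝓝 x] G) (B : E → E → W) :
    metricTrace F x B = metricTrace G x B := by
  simp only [metricTrace, inducedMetric, h.fderiv_eq]

lemma meanCurvatureIn_congr (h : F =ᶠ[𝓝 x] G) : meanCurvatureIn F x = meanCurvatureIn G x := by
  unfold meanCurvatureIn
  rw [metricTrace_congr h]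
  congr 2
  funext v w
  simp only [secondFundamentalForm, positionTangentSpan, h.fderiv_eq, h.eq_of_nhds,
    h.fderiv.fderiv_eq]

lemma divergenceIn_congr (h : F =ᶠ[𝓝 x] G) {X Y : E → V} (hXY : X =ᶠ[𝓝 x] Y) :
    divergenceIn F X x = divergenceIn G Y x := by
  unfold divergenceIn
  rw [metricTrace_congr h]
  simp only [h.fderiv_eq, hXY.fderiv_eq]

lemma divJHIn_congr (h : F =ᶠ[𝓝 x] G) : divJHIn F x = divJHIn G x := by
  refine divergenceIn_congr h ?_
  filter_upwards [h.eventually_nhds] with y hy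
  rw [meanCurvatureIn_congr hy]

end Congr

/-- The trace of a family of bilinear maps with differentiable coefficients is differentiable. -/
lemma differentiableAt_metricTrace {W : Type*} [NormedAddCommGroup W] [NormedSpace ℝ W]
    {F : E → V} {x : E} (hF : DifferentiableAt ℝ (fderiv ℝ F) x)
    (hinj : Function.Injective (fderiv ℝ F x)) {B : E → E → E → W}
    (hB : ∀ v w, DifferentiableAt ℝ (fun y => B y v w) x) :
    DifferentiableAt ℝ (fun y => metricTrace F y (B y)) x := by
  set e := finBasis ℝ E
  let G : E → Matrix (Fin (finrank ℝ E)) (Fin (finrank ℝ E)) ℝ :=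
    fun y => Matrix.of fun k l => inducedMetric F y (e k) (e l)
  have hG : ∀ k l, DifferentiableAt ℝ (fun y => G y k l) x := by
    intro k l
    simp only [G, Matrix.of_apply, inducedMetric]
    exact (hF.clm_apply (differentiableAt_const _)).inner ℝ
      (hF.clm_apply (differentiableAt_const _))
  have hdet : ∀ M : E → Matrix (Fin (finrank ℝ E)) (Fin (finrank ℝ E)) ℝ,
      (∀ k l, DifferentiableAt ℝ (fun y => M y k l) x) →
      DifferentiableAt ℝ (fun y => (M y).det) x := by
    intro M hM
    simp only [Matrix.det_apply]
    refine DifferentiableAt.fun_sum fun s _ => ?_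
    refine DifferentiableAt.const_smul ?_ _
    exact (HasFDerivAt.finsetProd fun i _ => (hM _ _).hasFDerivAt).differentiableAt
  have hne : (G x).det ≠ 0 := by
    obtain ⟨b, hb⟩ := exists_orthonormal_basis F x hinj
    have hG : G x = (b.toMatrix e).transpose * b.toMatrix e :=
      gram_eq_transpose_mul F x b hb e
    have hu : IsUnit (b.toMatrix e).det := by
      refine (Matrix.isUnit_iff_isUnit_det _).1 (IsUnit.of_mul_eq_one (e.toMatrix b) ?_)
      exact b.toMatrix_mul_toMatrix_flip e
    rw [hG, Matrix.det_mul, Matrix.det_transpose]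
    exact mul_ne_zero hu.ne_zero hu.ne_zero
  unfold metricTrace
  refine DifferentiableAt.fun_sum fun i _ => DifferentiableAt.fun_sum fun j _ => ?_
  refine DifferentiableAt.smul ?_ (hB _ _)
  change DifferentiableAt ℝ (fun y => (G y)⁻¹ i j) x
  -- By Cramer's rule the entries of the inverse are quotients of determinants, so differentiability
  -- of determinants suffices.
  simp only [Matrix.inv_def, Matrix.smul_apply, smul_eq_mul, Ring.inverse_eq_inv']
  refine ((hdet G hG).fun_inv hne).mul ?_
  simp only [Matrix.adjugate_apply]
  refine hdet _ fun k l => ?_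
  by_cases hk : k = j
  · subst hk
    simp
  · simpa [Matrix.updateRow_ne hk] using hG k l

end MetricTrace

/-! ### Projection to the normal space inside the sphere. -/

section NormalProjection

attribute [local instance] InnerProductSpace.complexToReal

variable {E : Type*} [NormedAddCommGroup E] [NormedSpace ℝ E] [FiniteDimensional ℝ E]
variable {V : Type*} [NormedAddCommGroup V] [InnerProductSpace ℂ V]
variable {F : E → V} {x : E}

omit [FiniteDimensional ℝ E] in
lemma inner_real_eq_re (y z : V) : (inner ℝ y z : ℝ) = (inner ℂ y z : ℂ).re := rfl

omit [FiniteDimensional ℝ E] in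
lemma mem_positionTangentSpan {y : V} :
    y ∈ positionTangentSpan F x ↔ ∃ (s : ℝ) (v : E), s • F x + fderiv ℝ F x v = y := by
  simp [positionTangentSpan, Submodule.mem_sup, Submodule.mem_span_singleton]

omit [FiniteDimensional ℝ E] in
lemma mem_positionTangentSpan_orthogonal {y : V} :
    y ∈ (positionTangentSpan F x)ᗮ ↔
      inner ℝ (F x) y = 0 ∧ ∀ v, inner ℝ (fderiv ℝ F x v) y = 0 := by
  rw [Submodule.mem_orthogonal]
  constructor
  · intro h
    exact ⟨h _ (mem_positionTangentSpan.2 ⟨1, 0, by simp⟩),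
      fun v => h _ (mem_positionTangentSpan.2 ⟨0, v, by simp⟩)⟩
  · rintro ⟨h1, h2⟩ u hu
    obtain ⟨s, v, rfl⟩ := mem_positionTangentSpan.1 hu
    simp [inner_add_left, inner_smul_left, h1, h2]

lemma starProjection_normal_eq {y z : V} (hz : z ∈ (positionTangentSpan F x)ᗮ)
    (hyz : y - z ∈ positionTangentSpan F x) :
    (positionTangentSpan F x)ᗮ.starProjection y = z := by
  refine Submodule.eq_starProjection_of_mem_orthogonal' hz
    (Submodule.le_orthogonal_orthogonal _ hyz) (by abel)

lemma finrank_smul_meanCurvatureIn (F : E → V) (x : E) :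
    (finrank ℝ E : ℝ) • meanCurvatureIn F x = metricTrace F x (secondFundamentalForm F x) := by
  unfold meanCurvatureIn
  -- In dimension 0 the factor (dim E)⁻¹ is the default value 0, but the trace is then an empty sum.
  rcases eq_or_ne (finrank ℝ E) 0 with h | h
  · have : IsEmpty (Fin (finrank ℝ E)) := by rw [h]; infer_instance
    simp [metricTrace]
  · rw [smul_inv_smul₀ (by exact_mod_cast h)]

/-- `n H` is the normal part of the trace of the second derivative. -/
lemma finrank_smul_meanCurvatureIn_eq_starProjection (F : E → V) (x : E) :
    (finrank ℝ E : ℝ) • meanCurvatureIn F x =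
      (positionTangentSpan F x)ᗮ.starProjection
        (metricTrace F x fun v w => fderiv ℝ (fderiv ℝ F) x v w) := by
  rw [finrank_smul_meanCurvatureIn]
  exact metricTrace_map F x
    ((positionTangentSpan F x)ᗮ.starProjection : V →ₗ[ℝ] V) _

end NormalProjection

/-! ### Hermitian identities for Legendrian immersions in coordinates. -/

section Legendrian

attribute [local instance] InnerProductSpace.complexToReal

variable {E : Type*} [NormedAddCommGroup E] [NormedSpace ℝ E]
variable {V : Type*} [NormedAddCommGroup V] [InnerProductSpace ℂ V]

/-- Near `x`, the map `f` is a smooth Legendrian immersion into the unit sphere. -/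
def LegendrianNear (f : E → V) (x : E) : Prop :=
  ∀ᶠ y in 𝓝 x, ContDiffAt ℝ ∞ f y ∧ ‖f y‖ = 1 ∧ Function.Injective (fderiv ℝ f y) ∧
    ∀ v, inner ℝ (fderiv ℝ f y v) (Complex.I • f y) = 0

namespace LegendrianNear

variable {f : E → V} {x : E}

lemma eventually (h : LegendrianNear f x) : ∀ᶠ y in 𝓝 x, LegendrianNear f y :=
  eventually_eventually_nhds.2 h

lemma contDiffAt (h : LegendrianNear f x) : ContDiffAt ℝ ∞ f x := h.self_of_nhds.1

lemma injective (h : LegendrianNear f x) : Function.Injective (fderiv ℝ f x) :=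
  h.self_of_nhds.2.2.1

lemma contDiffAt_fderiv (h : LegendrianNear f x) : ContDiffAt ℝ ∞ (fderiv ℝ f) x :=
  h.contDiffAt.fderiv_right le_rfl

lemma differentiableAt (h : LegendrianNear f x) : DifferentiableAt ℝ f x :=
  h.contDiffAt.differentiableAt (by simp)

lemma differentiableAt_fderiv (h : LegendrianNear f x) : DifferentiableAt ℝ (fderiv ℝ f) x :=
  h.contDiffAt_fderiv.differentiableAt (by simp)

lemma differentiableAt_fderiv_fderiv (h : LegendrianNear f x) :
    DifferentiableAt ℝ (fderiv ℝ (fderiv ℝ f)) x :=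
  (h.contDiffAt_fderiv.fderiv_right (m := ∞) le_rfl).differentiableAt (by simp)

lemma inner_self (h : LegendrianNear f x) : inner ℂ (f x) (f x) = (1 : ℂ) := by
  rw [inner_self_eq_norm_sq_to_K, h.self_of_nhds.2.1]
  simp

/-- The real part vanishes by differentiating |f|² = 1, the imaginary part by the Legendrian
condition. -/
lemma inner_fderiv (h : LegendrianNear f x) (v : E) :
    inner ℂ (f x) (fderiv ℝ f x v) = (0 : ℂ) := by
  apply Complex.ext
  · have h1 : (fun y => (inner ℝ (f y) (f y) : ℝ)) =ᶠ[𝓝 x] fun _ => 1 := by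
      filter_upwards [h] with y hy
      rw [real_inner_self_eq_norm_sq, hy.2.1, one_pow]
    have h2 := DFunLike.congr_fun (h1.fderiv_eq (𝕜 := ℝ)) v
    rw [fderiv_inner_apply ℝ h.differentiableAt h.differentiableAt,
      real_inner_comm (f x)] at h2
    simp only [fderiv_fun_const, Pi.zero_apply, zero_apply] at h2
    rw [← inner_real_eq_re]
    simp only [Complex.zero_re]
    linarith
  · have h1 := h.self_of_nhds.2.2.2 v
    rw [← inner_conj_symm, Complex.conj_im, Complex.zero_im]
    rw [inner_real_eq_re, inner_smul_right] at h1
    simpa using h1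

lemma inner_fderiv' (h : LegendrianNear f x) (v : E) :
    inner ℂ (fderiv ℝ f x v) (f x) = (0 : ℂ) := by
  rw [← inner_conj_symm, h.inner_fderiv, map_zero]

lemma fderiv_fderiv_apply (h : LegendrianNear f x) (v w : E) :
    fderiv ℝ (fun y => fderiv ℝ f y w) x v = fderiv ℝ (fderiv ℝ f) x v w := by
  rw [fderiv_clm_apply h.differentiableAt_fderiv (differentiableAt_const w)]
  simp

/-- This is the derivative of the relation ⟨f, df(w)⟩ = 0 in the direction v. -/
lemma inner_fderiv_fderiv_add (h : LegendrianNear f x) (v w : E) :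
    inner ℂ (f x) (fderiv ℝ (fderiv ℝ f) x v w) + inner ℂ (fderiv ℝ f x v) (fderiv ℝ f x w) =
      (0 : ℂ) := by
  have h1 : (fun y => (inner ℂ (f y) (fderiv ℝ f y w) : ℂ)) =ᶠ[𝓝 x] fun _ => 0 := by
    filter_upwards [h.eventually] with y hy
    exact hy.inner_fderiv w
  have h2 := DFunLike.congr_fun (h1.fderiv_eq (𝕜 := ℝ)) v
  rw [fderiv_inner_apply ℂ h.differentiableAt
    (h.differentiableAt_fderiv.clm_apply (differentiableAt_const w)),
    h.fderiv_fderiv_apply] at h2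
  simpa using h2

/-- The tangent spaces of a Legendrian immersion are totally real. -/
lemma inner_fderiv_fderiv (h : LegendrianNear f x) (v w : E) :
    inner ℂ (fderiv ℝ f x v) (fderiv ℝ f x w) = (inducedMetric f x v w : ℂ) := by
  have hs : fderiv ℝ (fderiv ℝ f) x v w = fderiv ℝ (fderiv ℝ f) x w v :=
    (h.contDiffAt.isSymmSndFDerivAt (by simpa using WithTop.coe_le_coe.2 (le_top : (2 : ℕ∞) ≤ ⊤))) v w
  have h1 := h.inner_fderiv_fderiv_add v w
  have h2 := h.inner_fderiv_fderiv_add w v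
  rw [hs] at h1
  -- The Hessian is symmetric, hence so is the hermitian product of tangent vectors; being also
  -- conjugate-symmetric, it is real.
  have h3 : inner ℂ (fderiv ℝ f x v) (fderiv ℝ f x w) =
      (inner ℂ (fderiv ℝ f x w) (fderiv ℝ f x v) : ℂ) := by linear_combination h1 - h2
  rw [← inner_conj_symm] at h3
  apply Complex.ext
  · simp [inducedMetric, inner_real_eq_re]
  · have h4 := congrArg Complex.im h3
    rw [Complex.conj_im] at h4
    rw [← inner_conj_symm, Complex.conj_im, Complex.ofReal_im]
    linarith

lemma inner_hessian (h : LegendrianNear f x) (v w : E) :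
    inner ℂ (f x) (fderiv ℝ (fderiv ℝ f) x v w) = (-inducedMetric f x v w : ℂ) := by
  linear_combination h.inner_fderiv_fderiv_add v w - h.inner_fderiv_fderiv v w

variable [FiniteDimensional ℝ E]

lemma inner_trace_hessian (h : LegendrianNear f x) :
    inner ℂ (f x) (metricTrace f x fun v w => fderiv ℝ (fderiv ℝ f) x v w) =
      (-finrank ℝ E : ℂ) := by
  let L : V →ₗ[ℝ] ℂ := ((innerSL ℂ (f x)).restrictScalars ℝ : V →L[ℝ] ℂ)
  have hL : ∀ z, L z = inner ℂ (f x) z := fun z => rfl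
  rw [← hL, ← metricTrace_map]
  simp only [hL, h.inner_hessian]
  have := metricTrace_map f x (-Complex.ofRealCLM : ℝ →L[ℝ] ℂ).toLinearMap (inducedMetric f x)
  simp only [metricTrace_inducedMetric f x h.injective] at this
  simpa using this

/-- The trace of the second derivative is `n H - n f` up to a tangent vector. -/
lemma exists_trace_hessian_eq (h : LegendrianNear f x) :
    inner ℂ (f x) ((finrank ℝ E : ℝ) • meanCurvatureIn f x) = (0 : ℂ) ∧
    (∀ v, inner ℝ (fderiv ℝ f x v) ((finrank ℝ E : ℝ) • meanCurvatureIn f x) = 0) ∧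
    ∃ v, (metricTrace f x fun v w => fderiv ℝ (fderiv ℝ f) x v w) =
      (finrank ℝ E : ℝ) • meanCurvatureIn f x - (finrank ℝ E : ℝ) • f x + fderiv ℝ f x v := by
  have hM := finrank_smul_meanCurvatureIn_eq_starProjection f x
  set M := (finrank ℝ E : ℝ) • meanCurvatureIn f x
  set T := metricTrace f x fun v w => fderiv ℝ (fderiv ℝ f) x v w with hT
  have h1 : M ∈ (positionTangentSpan f x)ᗮ := by
    rw [hM]; exact Submodule.starProjection_apply_mem _ _
  obtain ⟨h2, h3⟩ := mem_positionTangentSpan_orthogonal.1 h1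
  have h4 : T - M ∈ positionTangentSpan f x := by
    rw [hM, Submodule.starProjection_orthogonal_val, sub_sub_cancel]
    exact Submodule.starProjection_apply_mem _ _
  obtain ⟨s, v, h5⟩ := mem_positionTangentSpan.1 h4
  have h6 : T = M + s • f x + fderiv ℝ f x v := by rw [add_assoc, h5]; abel
  have h7 : inner ℂ (f x) M = (-finrank ℝ E - s : ℂ) := by
    have := h.inner_trace_hessian
    rw [← hT, h6, inner_add_right, inner_add_right, h.inner_fderiv,
      ← Complex.coe_smul s, inner_smul_right, h.inner_self] at this
    linear_combination this
  rw [inner_real_eq_re, h7] at h2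
  -- Normality of M makes the real part of ⟨f, M⟩ vanish, and this fixes the coefficient of the
  -- position vector.
  have h8 : s = -finrank ℝ E := by
    simp at h2
    linarith
  refine ⟨by rw [h7, h8]; simp, h3, v, ?_⟩
  rw [h6, h8, neg_smul, sub_eq_add_neg]

/-- Writing the tangential part as a metric trace avoids choosing an orthonormal basis at each
point, so smooth dependence on the point becomes visible. -/
lemma starProjection_normal (h : LegendrianNear f x) (z : V) :
    (positionTangentSpan f x)ᗮ.starProjection z =
      z - (inner ℝ (f x) z : ℝ) • f x -
        metricTrace f x fun v w => (inner ℝ (fderiv ℝ f x v) z : ℝ) • fderiv ℝ f x w := by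
  obtain ⟨b, hb⟩ := exists_orthonormal_basis f x h.injective
  let B : E →ₗ[ℝ] E →ₗ[ℝ] V := LinearMap.mk₂ ℝ
    (fun v w => (inner ℝ (fderiv ℝ f x v) z : ℝ) • fderiv ℝ f x w)
    (by simp [inner_add_left, add_smul]) (by simp [inner_smul_left, mul_smul])
    (by simp) (fun c v w => by rw [map_smul, smul_comm])
  have hB := metricTrace_eq_sum f x b hb B
  simp only [B, LinearMap.mk₂_apply] at hB
  rw [hB]
  have hr : ∀ v, (inner ℝ (f x) (fderiv ℝ f x v) : ℝ) = 0 := fun v => by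
    rw [inner_real_eq_re, h.inner_fderiv, Complex.zero_re]
  have hr' : ∀ v, (inner ℝ (fderiv ℝ f x v) (f x) : ℝ) = 0 := fun v => by
    rw [real_inner_comm, hr]
  have hf : ‖f x‖ = 1 := h.self_of_nhds.2.1
  apply starProjection_normal_eq
  · rw [mem_positionTangentSpan_orthogonal]
    refine ⟨?_, fun v => ?_⟩
    · simp [inner_sub_right, inner_smul_right, inner_sum, hr, hf]
    · rw [← b.sum_repr v]
      simp only [map_sum, map_smul, sum_inner, inner_smul_left]
      refine Finset.sum_eq_zero fun i _ => ?_
      have hbi : ∀ j, (inner ℝ (fderiv ℝ f x (b i)) (fderiv ℝ f x (b j)) : ℝ) =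
        if i = j then 1 else 0 := fun j => hb i j
      simp [inner_sub_right, inner_smul_right, inner_sum, hr', hbi]
  · rw [mem_positionTangentSpan]
    refine ⟨inner ℝ (f x) z, ∑ i, (inner ℝ (fderiv ℝ f x (b i)) z : ℝ) • b i, ?_⟩
    simp only [map_sum, map_smul]
    abel

/-- Needed because div JH differentiates H: without differentiability `fderiv` would take its
default value and the product rule would fail. -/
lemma differentiableAt_meanCurvatureIn (h : LegendrianNear f x) :
    DifferentiableAt ℝ (meanCurvatureIn f) x := by
  have hσ : ∀ v w, DifferentiableAt ℝ (fun y => secondFundamentalForm f y v w) x := by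
    intro v w
    have h1 : (fun y => secondFundamentalForm f y v w) =ᶠ[𝓝 x] fun y =>
        fderiv ℝ (fderiv ℝ f) y v w -
          (inner ℝ (f y) (fderiv ℝ (fderiv ℝ f) y v w) : ℝ) • f y -
          metricTrace f y fun v' w' =>
            (inner ℝ (fderiv ℝ f y v') (fderiv ℝ (fderiv ℝ f) y v w) : ℝ) • fderiv ℝ f y w' := by
      filter_upwards [h.eventually] with y hy
      exact hy.starProjection_normal _
    refine DifferentiableAt.congr_of_eventuallyEq ?_ h1
    have h2 : DifferentiableAt ℝ (fun y => fderiv ℝ (fderiv ℝ f) y v w) x :=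
      (h.differentiableAt_fderiv_fderiv.clm_apply (differentiableAt_const v)).clm_apply
        (differentiableAt_const w)
    refine (h2.sub ((h.differentiableAt.inner ℝ h2).smul h.differentiableAt)).sub ?_
    refine differentiableAt_metricTrace h.differentiableAt_fderiv h.injective fun v' w' => ?_
    exact ((h.differentiableAt_fderiv.clm_apply (differentiableAt_const v')).inner ℝ h2).smul
      (h.differentiableAt_fderiv.clm_apply (differentiableAt_const w'))
  exact (differentiableAt_metricTrace h.differentiableAt_fderiv h.injective hσ).const_smul _

lemma inner_meanCurvatureIn (h : LegendrianNear f x) :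
    inner ℂ (f x) (meanCurvatureIn f x) = (0 : ℂ) := by
  rcases eq_or_ne (finrank ℝ E) 0 with h0 | h0
  · simp [meanCurvatureIn, h0]
  · have h1 := h.exists_trace_hessian_eq.1
    rw [← Complex.coe_smul, inner_smul_right] at h1
    exact (mul_eq_zero.1 h1).resolve_left (by exact_mod_cast h0)

lemma inner_meanCurvatureIn' (h : LegendrianNear f x) :
    inner ℂ (meanCurvatureIn f x) (f x) = (0 : ℂ) := by
  rw [← inner_conj_symm, h.inner_meanCurvatureIn, map_zero]

lemma re_inner_fderiv_meanCurvatureIn (h : LegendrianNear f x) (v : E) :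
    (inner ℂ (fderiv ℝ f x v) (meanCurvatureIn f x) : ℂ).re = 0 := by
  rcases eq_or_ne (finrank ℝ E) 0 with h0 | h0
  · simp [meanCurvatureIn, h0]
  · have h1 := h.exists_trace_hessian_eq.2.1 v
    rw [inner_smul_right] at h1
    exact (mul_eq_zero.1 h1).resolve_left (by exact_mod_cast h0)

end LegendrianNear

end Legendrian

/-! ### Legendre curves and the coefficients they contribute to the curvature. -/

section Curve

/-- Near `t`, `(γ₁, γ₂)` is a regular smooth Legendre curve in the unit sphere of `ℂ²`. -/
def LegendreNear (γ₁ γ₂ : ℝ → ℂ) (t : ℝ) : Prop :=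
  ∀ᶠ s in 𝓝 t, ContDiffAt ℝ ∞ γ₁ s ∧ ContDiffAt ℝ ∞ γ₂ s ∧
    conj (γ₁ s) * γ₁ s + conj (γ₂ s) * γ₂ s = 1 ∧
    conj (γ₁ s) * deriv γ₁ s + conj (γ₂ s) * deriv γ₂ s = 0 ∧
    (deriv γ₁ s ≠ 0 ∨ deriv γ₂ s ≠ 0)

/-- The square of the speed of the curve `(γ₁, γ₂)`. -/
def speedSq (γ₁ γ₂ : ℝ → ℂ) (t : ℝ) : ℝ :=
  Complex.normSq (deriv γ₁ t) + Complex.normSq (deriv γ₂ t)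

/-- The coefficient `n / |γ|²`. -/
def normSqCoeff (n : ℕ) (γ : ℝ → ℂ) (t : ℝ) : ℝ := n * (Complex.normSq (γ t))⁻¹

/-- The logarithmic derivative of `γ₁ ^ n₁ * γ₂ ^ n₂ * (γ₁ γ₂' - γ₂ γ₁')`, for a Legendre curve
`(γ₁, γ₂)`. -/
def legendreLogDeriv (n₁ n₂ : ℕ) (γ₁ γ₂ : ℝ → ℂ) (t : ℝ) : ℂ :=
  (speedSq γ₁ γ₂ t : ℂ)⁻¹ *
      (conj (deriv γ₁ t) * deriv (deriv γ₁) t + conj (deriv γ₂ t) * deriv (deriv γ₂) t) +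
    normSqCoeff n₁ γ₁ t * (conj (γ₁ t) * deriv γ₁ t) +
    normSqCoeff n₂ γ₂ t * (conj (γ₂ t) * deriv γ₂ t)

/-- The component of `n H` along `i γ'`. -/
def curvatureCoeff (n₁ n₂ : ℕ) (γ₁ γ₂ : ℝ → ℂ) (t : ℝ) : ℝ :=
  (legendreLogDeriv n₁ n₂ γ₁ γ₂ t).im * (speedSq γ₁ γ₂ t)⁻¹

lemma HasDerivAt.normSq {p : ℝ → ℂ} {p' : ℂ} {t : ℝ} (h : HasDerivAt p p' t) :
    HasDerivAt (fun s => Complex.normSq (p s)) (2 * (conj (p t) * p').re) t := by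
  have h1 : HasDerivAt (fun s => (p s).re) p'.re t :=
    Complex.reCLM.hasFDerivAt.comp_hasDerivAt t h
  have h2 : HasDerivAt (fun s => (p s).im) p'.im t :=
    Complex.imCLM.hasFDerivAt.comp_hasDerivAt t h
  have h3 := (h1.mul h1).add (h2.mul h2)
  simp only [Complex.normSq_apply]
  convert! h3 using 1
  simp
  ring

lemma DifferentiableAt.normSq {p : ℝ → ℂ} {t : ℝ} (h : DifferentiableAt ℝ p t) :
    DifferentiableAt ℝ (fun s => Complex.normSq (p s)) t :=
  h.hasDerivAt.normSq.differentiableAt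

/-- For n = 0 the coefficient is identically 0 even at zeros of γ, so the curve component of a
zero-dimensional factor may vanish. -/
lemma differentiableAt_normSqCoeff {n : ℕ} {γ : ℝ → ℂ} {t : ℝ} (h : DifferentiableAt ℝ γ t)
    (hn : n ≠ 0 → γ t ≠ 0) : DifferentiableAt ℝ (normSqCoeff n γ) t := by
  unfold normSqCoeff
  rcases eq_or_ne n 0 with rfl | h0
  · simp
  · exact (h.normSq.fun_inv (by simpa using hn h0)).const_mul _

lemma normSqCoeff_mul_normSq {n : ℕ} {γ : ℝ → ℂ} {t : ℝ} (hn : n ≠ 0 → γ t ≠ 0) :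
    normSqCoeff n γ t * Complex.normSq (γ t) = n := by
  unfold normSqCoeff
  rcases eq_or_ne n 0 with rfl | h0
  · simp
  · rw [mul_assoc, inv_mul_cancel₀ (by simpa using hn h0), mul_one]

lemma ContDiffAt.deriv_real {p : ℝ → ℂ} {t : ℝ} (h : ContDiffAt ℝ ∞ p t) :
    ContDiffAt ℝ ∞ (deriv p) t :=
  (h.fderiv_right (m := ∞) le_rfl).clm_apply contDiffAt_const

namespace LegendreNear

variable {γ₁ γ₂ : ℝ → ℂ} {t : ℝ}

lemma eventually (h : LegendreNear γ₁ γ₂ t) : ∀ᶠ s in 𝓝 t, LegendreNear γ₁ γ₂ s :=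
  eventually_eventually_nhds.2 h

lemma contDiffAt₁ (h : LegendreNear γ₁ γ₂ t) : ContDiffAt ℝ ∞ γ₁ t := h.self_of_nhds.1

lemma contDiffAt₂ (h : LegendreNear γ₁ γ₂ t) : ContDiffAt ℝ ∞ γ₂ t := h.self_of_nhds.2.1

lemma differentiableAt₁ (h : LegendreNear γ₁ γ₂ t) : DifferentiableAt ℝ γ₁ t :=
  h.contDiffAt₁.differentiableAt (by simp)

lemma differentiableAt₂ (h : LegendreNear γ₁ γ₂ t) : DifferentiableAt ℝ γ₂ t :=
  h.contDiffAt₂.differentiableAt (by simp)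

lemma differentiableAt_deriv₁ (h : LegendreNear γ₁ γ₂ t) : DifferentiableAt ℝ (deriv γ₁) t :=
  h.contDiffAt₁.deriv_real.differentiableAt (by simp)

lemma differentiableAt_deriv₂ (h : LegendreNear γ₁ γ₂ t) : DifferentiableAt ℝ (deriv γ₂) t :=
  h.contDiffAt₂.deriv_real.differentiableAt (by simp)

lemma sphere (h : LegendreNear γ₁ γ₂ t) :
    conj (γ₁ t) * γ₁ t + conj (γ₂ t) * γ₂ t = 1 := h.self_of_nhds.2.2.1

lemma legendre (h : LegendreNear γ₁ γ₂ t) :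
    conj (γ₁ t) * deriv γ₁ t + conj (γ₂ t) * deriv γ₂ t = 0 := h.self_of_nhds.2.2.2.1

lemma legendre' (h : LegendreNear γ₁ γ₂ t) :
    γ₁ t * conj (deriv γ₁ t) + γ₂ t * conj (deriv γ₂ t) = 0 := by
  simpa using congrArg conj h.legendre

lemma speedSq_pos (h : LegendreNear γ₁ γ₂ t) : 0 < speedSq γ₁ γ₂ t := by
  have h1 := Complex.normSq_nonneg (deriv γ₁ t)
  have h2 := Complex.normSq_nonneg (deriv γ₂ t)
  unfold speedSq
  rcases h.self_of_nhds.2.2.2.2 with h3 | h3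
  · have := Complex.normSq_pos.2 h3; linarith
  · have := Complex.normSq_pos.2 h3; linarith

lemma differentiableAt_speedSq (h : LegendreNear γ₁ γ₂ t) :
    DifferentiableAt ℝ (speedSq γ₁ γ₂) t :=
  h.differentiableAt_deriv₁.normSq.add h.differentiableAt_deriv₂.normSq

/-- Obtained by differentiating the Legendre relation ⟨γ, γ'⟩ = 0. It makes the γ-component of γ''
real. -/
lemma conj_mul_deriv_deriv (h : LegendreNear γ₁ γ₂ t) :
    conj (γ₁ t) * deriv (deriv γ₁) t + conj (γ₂ t) * deriv (deriv γ₂) t =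
      (-speedSq γ₁ γ₂ t : ℂ) := by
  have h1 : (fun s => conj (γ₁ s) * deriv γ₁ s + conj (γ₂ s) * deriv γ₂ s) =ᶠ[𝓝 t]
      fun _ => 0 := by
    filter_upwards [h.eventually] with s hs using hs.legendre
  have hc : ∀ {γ : ℝ → ℂ}, DifferentiableAt ℝ γ t →
      HasDerivAt (fun s => conj (γ s)) (conj (deriv γ t)) t :=
    fun hd => Complex.conjCLE.hasFDerivAt.comp_hasDerivAt t hd.hasDerivAt
  have h2 := (((hc h.differentiableAt₁).mul h.differentiableAt_deriv₁.hasDerivAt).add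
    ((hc h.differentiableAt₂).mul h.differentiableAt_deriv₂.hasDerivAt)).deriv
  have h3 := h1.deriv_eq
  rw [deriv_const] at h3
  have h4 := h2.symm.trans h3
  simp only [speedSq, Complex.ofReal_add, Complex.normSq_eq_conj_mul_self]
  linear_combination h4

lemma differentiableAt_curvatureCoeff {n₁ n₂ : ℕ} (h : LegendreNear γ₁ γ₂ t)
    (hn₁ : n₁ ≠ 0 → γ₁ t ≠ 0) (hn₂ : n₂ ≠ 0 → γ₂ t ≠ 0) :
    DifferentiableAt ℝ (curvatureCoeff n₁ n₂ γ₁ γ₂) t := by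
  have hc : ∀ {γ : ℝ → ℂ}, DifferentiableAt ℝ γ t → DifferentiableAt ℝ (fun s => conj (γ s)) t :=
    fun hd => (Complex.conjCLE.hasFDerivAt.comp_hasDerivAt t hd.hasDerivAt).differentiableAt
  have hr : ∀ {γ : ℝ → ℝ}, DifferentiableAt ℝ γ t →
      DifferentiableAt ℝ (fun s => (γ s : ℂ)) t :=
    fun hd => hd.hasDerivAt.ofReal_comp.differentiableAt
  have d₁ := h.differentiableAt_deriv₁
  have d₂ := h.differentiableAt_deriv₂
  have dd₁ : DifferentiableAt ℝ (deriv (deriv γ₁)) t :=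
    h.contDiffAt₁.deriv_real.deriv_real.differentiableAt (by simp)
  have dd₂ : DifferentiableAt ℝ (deriv (deriv γ₂)) t :=
    h.contDiffAt₂.deriv_real.deriv_real.differentiableAt (by simp)
  have hv := h.differentiableAt_speedSq.fun_inv h.speedSq_pos.ne'
  have hω : DifferentiableAt ℝ (legendreLogDeriv n₁ n₂ γ₁ γ₂) t := by
    unfold legendreLogDeriv
    simp only [← Complex.ofReal_inv]
    exact (((hr hv).mul (((hc d₁).mul dd₁).add ((hc d₂).mul dd₂))).add
      ((hr (differentiableAt_normSqCoeff h.differentiableAt₁ hn₁)).mul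
        ((hc h.differentiableAt₁).mul d₁))).add
      ((hr (differentiableAt_normSqCoeff h.differentiableAt₂ hn₂)).mul
        ((hc h.differentiableAt₂).mul d₂))
  exact (Complex.imCLM.hasFDerivAt.comp_hasDerivAt t hω.hasDerivAt).differentiableAt.mul hv

/-- Over `ℂ`, the vectors `γ` and `γ'` form an orthogonal basis of `ℂ²`. -/
lemma expansion (h : LegendreNear γ₁ γ₂ t) (a₁ a₂ : ℂ) :
    a₁ = (conj (γ₁ t) * a₁ + conj (γ₂ t) * a₂) * γ₁ t +
      (speedSq γ₁ γ₂ t : ℂ)⁻¹ * (conj (deriv γ₁ t) * a₁ + conj (deriv γ₂ t) * a₂) * deriv γ₁ t ∧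
    a₂ = (conj (γ₁ t) * a₁ + conj (γ₂ t) * a₂) * γ₂ t +
      (speedSq γ₁ γ₂ t : ℂ)⁻¹ * (conj (deriv γ₁ t) * a₁ + conj (deriv γ₂ t) * a₂) * deriv γ₂ t := by
  have hv : (speedSq γ₁ γ₂ t : ℂ) ≠ 0 := by exact_mod_cast h.speedSq_pos.ne'
  have hs := h.sphere
  have hl := h.legendre
  have hl' := h.legendre'
  have hvd : (speedSq γ₁ γ₂ t : ℂ) = conj (deriv γ₁ t) * deriv γ₁ t +
      conj (deriv γ₂ t) * deriv γ₂ t := by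
    simp only [speedSq, Complex.ofReal_add, Complex.normSq_eq_conj_mul_self]
  set x := γ₁ t
  set y := γ₂ t
  -- The unit vector (-γ̄₂, γ̄₁) spans the hermitian complement of γ, and γ' is `f` times it; the
  -- expansion is then the one in a unitary basis.
  set f := x * deriv γ₂ t - y * deriv γ₁ t with hf
  have h1 : deriv γ₁ t = -f * conj y := by
    rw [hf]; linear_combination (-deriv γ₁ t) * hs + x * hl
  have h2 : deriv γ₂ t = f * conj x := by
    rw [hf]; linear_combination (-deriv γ₂ t) * hs + y * hl
  have hvf : (speedSq γ₁ γ₂ t : ℂ) = conj f * f := by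
    rw [hvd, h1, h2]
    simp only [map_mul, map_neg, Complex.conj_conj]
    linear_combination conj f * f * hs
  rw [hvf] at hv ⊢
  have hf0 : f ≠ 0 := right_ne_zero_of_mul hv
  have hf1 : conj f ≠ 0 := left_ne_zero_of_mul hv
  rw [h1, h2]
  simp only [map_mul, map_neg, Complex.conj_conj]
  constructor
  · field_simp
    linear_combination (-a₁) * hs
  · field_simp
    linear_combination (-a₂) * hs

end LegendreNear

end Curve

/-! ### The product map: differential, warped metric, splitting of traces. -/

section Product

attribute [local instance] InnerProductSpace.complexToReal

variable {E₁ E₂ : Type*} [NormedAddCommGroup E₁] [NormedSpace ℝ E₁]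
  [NormedAddCommGroup E₂] [NormedSpace ℝ E₂]
variable {V₁ V₂ V : Type*} [NormedAddCommGroup V₁] [InnerProductSpace ℂ V₁]
  [NormedAddCommGroup V₂] [InnerProductSpace ℂ V₂] [NormedAddCommGroup V] [InnerProductSpace ℂ V]

/-- The map `(t, u, v) ↦ j₁ (p₁ t • g₁ u) + j₂ (p₂ t • g₂ v)`. -/
def twistedSum (j₁ : V₁ →ₗᵢ[ℂ] V) (j₂ : V₂ →ₗᵢ[ℂ] V) (p₁ p₂ : ℝ → ℂ) (g₁ : E₁ → V₁)
    (g₂ : E₂ → V₂) (z : ℝ × E₁ × E₂) : V :=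
  j₁ (p₁ z.1 • g₁ z.2.1) + j₂ (p₂ z.1 • g₂ z.2.2)

/-- `j`, as a real continuous linear map. -/
def LinearIsometry.toRealCLM {U : Type*} [NormedAddCommGroup U] [InnerProductSpace ℂ U]
    (j : U →ₗᵢ[ℂ] V) : U →L[ℝ] V :=
  j.toContinuousLinearMap.restrictScalars ℝ

@[simp] lemma LinearIsometry.toRealCLM_apply {U : Type*} [NormedAddCommGroup U]
    [InnerProductSpace ℂ U] (j : U →ₗᵢ[ℂ] V) (x : U) : j.toRealCLM x = j x := rfl

variable {j₁ : V₁ →ₗᵢ[ℂ] V} {j₂ : V₂ →ₗᵢ[ℂ] V} {p₁ p₂ : ℝ → ℂ} {g₁ : E₁ → V₁} {g₂ : E₂ → V₂}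

lemma contDiffAt_twistedSum {z : ℝ × E₁ × E₂} (hp₁ : ContDiffAt ℝ ∞ p₁ z.1)
    (hp₂ : ContDiffAt ℝ ∞ p₂ z.1) (hg₁ : ContDiffAt ℝ ∞ g₁ z.2.1)
    (hg₂ : ContDiffAt ℝ ∞ g₂ z.2.2) : ContDiffAt ℝ ∞ (twistedSum j₁ j₂ p₁ p₂ g₁ g₂) z := by
  have h1 : ContDiffAt ℝ ∞ (fun z : ℝ × E₁ × E₂ => p₁ z.1) z := hp₁.comp z contDiffAt_fst
  have h2 : ContDiffAt ℝ ∞ (fun z : ℝ × E₁ × E₂ => p₂ z.1) z := hp₂.comp z contDiffAt_fst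
  have h3 : ContDiffAt ℝ ∞ (fun z : ℝ × E₁ × E₂ => g₁ z.2.1) z :=
    hg₁.comp z (contDiffAt_fst.comp z contDiffAt_snd)
  have h4 : ContDiffAt ℝ ∞ (fun z : ℝ × E₁ × E₂ => g₂ z.2.2) z :=
    hg₂.comp z (contDiffAt_snd.comp z contDiffAt_snd)
  exact (j₁.toRealCLM.contDiff.contDiffAt.comp z (h1.smul h3)).add
    (j₂.toRealCLM.contDiff.contDiffAt.comp z (h2.smul h4))

/-- Here `L` stands for the projection to either manifold factor, so one product rule serves both
summands of the twisted sum. -/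
lemma hasFDerivAt_smul_comp {E U : Type*} [NormedAddCommGroup E] [NormedSpace ℝ E]
    [NormedAddCommGroup U] [InnerProductSpace ℂ U] {F : Type*} [NormedAddCommGroup F]
    [NormedSpace ℝ F] {p : ℝ → ℂ} {g : E → U} (j : U →ₗᵢ[ℂ] V) (L : ℝ × F →L[ℝ] E) {z : ℝ × F}
    (hp : DifferentiableAt ℝ p z.1) (hg : DifferentiableAt ℝ g (L z)) :
    ∃ D : ℝ × F →L[ℝ] V, HasFDerivAt (fun z => j (p z.1 • g (L z))) D z ∧
      ∀ w, D w = j (((w.1 : ℂ) * deriv p z.1) • g (L z) + p z.1 • fderiv ℝ g (L z) (L w)) := by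
  have h1 : HasFDerivAt (fun z : ℝ × F => p z.1) _ z :=
    hp.hasFDerivAt.comp z hasFDerivAt_fst
  have h2 : HasFDerivAt (fun z : ℝ × F => g (L z)) _ z := hg.hasFDerivAt.comp z L.hasFDerivAt
  refine ⟨_, j.toRealCLM.hasFDerivAt.comp z (h1.smul h2), fun w => ?_⟩
  have h3 : fderiv ℝ p z.1 w.1 = (w.1 : ℂ) * deriv p z.1 := by
    rw [fderiv_eq_smul_deriv, Complex.real_smul]
  simp [h3, add_comm]

lemma differentiableAt_twistedSum {z : ℝ × E₁ × E₂} (hp₁ : DifferentiableAt ℝ p₁ z.1)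
    (hp₂ : DifferentiableAt ℝ p₂ z.1) (hg₁ : DifferentiableAt ℝ g₁ z.2.1)
    (hg₂ : DifferentiableAt ℝ g₂ z.2.2) :
    DifferentiableAt ℝ (twistedSum j₁ j₂ p₁ p₂ g₁ g₂) z := by
  obtain ⟨D₁, h1, -⟩ := hasFDerivAt_smul_comp j₁
    ((ContinuousLinearMap.fst ℝ E₁ E₂).comp (ContinuousLinearMap.snd ℝ ℝ (E₁ × E₂))) hp₁ hg₁
  obtain ⟨D₂, h2, -⟩ := hasFDerivAt_smul_comp j₂
    ((ContinuousLinearMap.snd ℝ E₁ E₂).comp (ContinuousLinearMap.snd ℝ ℝ (E₁ × E₂))) hp₂ hg₂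
  exact (h1.add h2).differentiableAt

lemma fderiv_twistedSum {z : ℝ × E₁ × E₂} (hp₁ : DifferentiableAt ℝ p₁ z.1)
    (hp₂ : DifferentiableAt ℝ p₂ z.1) (hg₁ : DifferentiableAt ℝ g₁ z.2.1)
    (hg₂ : DifferentiableAt ℝ g₂ z.2.2) (w : ℝ × E₁ × E₂) :
    fderiv ℝ (twistedSum j₁ j₂ p₁ p₂ g₁ g₂) z w =
      j₁ (((w.1 : ℂ) * deriv p₁ z.1) • g₁ z.2.1 + p₁ z.1 • fderiv ℝ g₁ z.2.1 w.2.1) +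
      j₂ (((w.1 : ℂ) * deriv p₂ z.1) • g₂ z.2.2 + p₂ z.1 • fderiv ℝ g₂ z.2.2 w.2.2) := by
  obtain ⟨D₁, h1, h1'⟩ := hasFDerivAt_smul_comp j₁
    ((ContinuousLinearMap.fst ℝ E₁ E₂).comp (ContinuousLinearMap.snd ℝ ℝ (E₁ × E₂))) hp₁ hg₁
  obtain ⟨D₂, h2, h2'⟩ := hasFDerivAt_smul_comp j₂
    ((ContinuousLinearMap.snd ℝ E₁ E₂).comp (ContinuousLinearMap.snd ℝ ℝ (E₁ × E₂))) hp₂ hg₂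
  have h3 : fderiv ℝ (twistedSum j₁ j₂ p₁ p₂ g₁ g₂) z = D₁ + D₂ := (h1.add h2).fderiv
  rw [h3, add_apply, h1', h2']
  rfl

lemma inner_isometry_add (hj : ∀ x y, inner ℂ (j₁ x) (j₂ y) = (0 : ℂ)) (a c : V₁) (b d : V₂) :
    inner ℂ (j₁ a + j₂ b) (j₁ c + j₂ d) = (inner ℂ a c + inner ℂ b d : ℂ) := by
  have hj' : ∀ x y, inner ℂ (j₂ y) (j₁ x) = (0 : ℂ) := fun x y => by
    rw [← inner_conj_symm, hj, map_zero]
  rw [inner_add_left, inner_add_right, inner_add_right, hj, hj']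
  simp

/-- The data of the construction near the point `z`: a Legendre curve and two Legendrian
immersions, with values in orthogonal spaces. -/
structure ProductData (j₁ : V₁ →ₗᵢ[ℂ] V) (j₂ : V₂ →ₗᵢ[ℂ] V) (γ₁ γ₂ : ℝ → ℂ) (f₁ : E₁ → V₁)
    (f₂ : E₂ → V₂) (z : ℝ × E₁ × E₂) : Prop where
  orthogonal : ∀ x y, inner ℂ (j₁ x) (j₂ y) = (0 : ℂ)
  curve : LegendreNear γ₁ γ₂ z.1
  ne_zero₁ : finrank ℝ E₁ ≠ 0 → ∀ᶠ s in 𝓝 z.1, γ₁ s ≠ 0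
  ne_zero₂ : finrank ℝ E₂ ≠ 0 → ∀ᶠ s in 𝓝 z.1, γ₂ s ≠ 0
  legendrian₁ : LegendrianNear f₁ z.2.1
  legendrian₂ : LegendrianNear f₂ z.2.2

namespace ProductData

variable {γ₁ γ₂ : ℝ → ℂ} {f₁ : E₁ → V₁} {f₂ : E₂ → V₂} {z : ℝ × E₁ × E₂}

lemma eventually (h : ProductData j₁ j₂ γ₁ γ₂ f₁ f₂ z) :
    ∀ᶠ w in 𝓝 z, ProductData j₁ j₂ γ₁ γ₂ f₁ f₂ w := by
  have h1 : Tendsto (fun w : ℝ × E₁ × E₂ => w.1) (𝓝 z) (𝓝 z.1) := continuous_fst.continuousAt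
  have h2 : Tendsto (fun w : ℝ × E₁ × E₂ => w.2.1) (𝓝 z) (𝓝 z.2.1) :=
    (continuous_fst.comp continuous_snd).continuousAt
  have h3 : Tendsto (fun w : ℝ × E₁ × E₂ => w.2.2) (𝓝 z) (𝓝 z.2.2) :=
    (continuous_snd.comp continuous_snd).continuousAt
  have h4 : ∀ᶠ s in 𝓝 z.1, finrank ℝ E₁ ≠ 0 → ∀ᶠ r in 𝓝 s, γ₁ r ≠ 0 :=
    eventually_imp_distrib_left.2 fun h0 => eventually_eventually_nhds.2 (h.ne_zero₁ h0)
  have h5 : ∀ᶠ s in 𝓝 z.1, finrank ℝ E₂ ≠ 0 → ∀ᶠ r in 𝓝 s, γ₂ r ≠ 0 :=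
    eventually_imp_distrib_left.2 fun h0 => eventually_eventually_nhds.2 (h.ne_zero₂ h0)
  filter_upwards [h1.eventually h.curve.eventually, h1.eventually h4, h1.eventually h5,
    h2.eventually h.legendrian₁.eventually, h3.eventually h.legendrian₂.eventually]
    with w w1 w2 w3 w4 w5
  exact ⟨h.orthogonal, w1, w2, w3, w4, w5⟩

lemma fderiv_eq (h : ProductData j₁ j₂ γ₁ γ₂ f₁ f₂ z) (w : ℝ × E₁ × E₂) :
    fderiv ℝ (twistedSum j₁ j₂ γ₁ γ₂ f₁ f₂) z w =
      j₁ (((w.1 : ℂ) * deriv γ₁ z.1) • f₁ z.2.1 + γ₁ z.1 • fderiv ℝ f₁ z.2.1 w.2.1) +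
      j₂ (((w.1 : ℂ) * deriv γ₂ z.1) • f₂ z.2.2 + γ₂ z.1 • fderiv ℝ f₂ z.2.2 w.2.2) :=
  fderiv_twistedSum h.curve.differentiableAt₁ h.curve.differentiableAt₂
    h.legendrian₁.differentiableAt h.legendrian₂.differentiableAt w

/-- The mixed terms carry complex factors such as γ̄ᵢ'γᵢ, so their vanishing uses the hermitian
orthogonality of fᵢ and dfᵢ, not just the real one. The identity holds already before real parts are
taken. -/
lemma inducedMetric_eq (h : ProductData j₁ j₂ γ₁ γ₂ f₁ f₂ z) (w w' : ℝ × E₁ × E₂) :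
    inducedMetric (twistedSum j₁ j₂ γ₁ γ₂ f₁ f₂) z w w' =
      w.1 * w'.1 * speedSq γ₁ γ₂ z.1 +
        Complex.normSq (γ₁ z.1) * inducedMetric f₁ z.2.1 w.2.1 w'.2.1 +
        Complex.normSq (γ₂ z.1) * inducedMetric f₂ z.2.2 w.2.2 w'.2.2 := by
  rw [inducedMetric, inner_real_eq_re, h.fderiv_eq, h.fderiv_eq, inner_isometry_add h.orthogonal,
    ← Complex.ofReal_re (_ + _ + _)]
  congr 1
  simp only [inner_add_left, inner_add_right, inner_smul_left, inner_smul_right,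
    h.legendrian₁.inner_self, h.legendrian₂.inner_self, h.legendrian₁.inner_fderiv,
    h.legendrian₂.inner_fderiv, h.legendrian₁.inner_fderiv', h.legendrian₂.inner_fderiv',
    h.legendrian₁.inner_fderiv_fderiv, h.legendrian₂.inner_fderiv_fderiv, speedSq,
    Complex.ofReal_add, Complex.ofReal_mul, Complex.normSq_eq_conj_mul_self, map_mul,
    Complex.conj_ofReal]
  ring

/-- The product map is a Legendrian immersion. -/
lemma legendrianNear [FiniteDimensional ℝ E₁] [FiniteDimensional ℝ E₂]
    (h : ProductData j₁ j₂ γ₁ γ₂ f₁ f₂ z) :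
    LegendrianNear (twistedSum j₁ j₂ γ₁ γ₂ f₁ f₂) z := by
  filter_upwards [h.eventually] with z h
  refine ⟨contDiffAt_twistedSum h.curve.contDiffAt₁ h.curve.contDiffAt₂ h.legendrian₁.contDiffAt
    h.legendrian₂.contDiffAt, ?_, ?_, fun v => ?_⟩
  · have h1 : (inner ℂ (twistedSum j₁ j₂ γ₁ γ₂ f₁ f₂ z) (twistedSum j₁ j₂ γ₁ γ₂ f₁ f₂ z) : ℂ) =
        1 := by
      rw [twistedSum, inner_isometry_add h.orthogonal]
      simp only [inner_smul_left, inner_smul_right, h.legendrian₁.inner_self,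
        h.legendrian₂.inner_self]
      linear_combination h.curve.sphere
    have h2 : ‖twistedSum j₁ j₂ γ₁ γ₂ f₁ f₂ z‖ ^ 2 = 1 := by
      rw [norm_sq_eq_re_inner (𝕜 := ℂ), h1]
      simp
    exact (pow_eq_one_iff_of_nonneg (norm_nonneg _) two_ne_zero).1 h2
  · rw [injective_iff_map_eq_zero]
    intro w hw
    have h1 := h.inducedMetric_eq w w
    rw [inducedMetric, hw, inner_zero_left] at h1
    have hg₁ : 0 ≤ inducedMetric f₁ z.2.1 w.2.1 w.2.1 := real_inner_self_nonneg
    have hg₂ : 0 ≤ inducedMetric f₂ z.2.2 w.2.2 w.2.2 := real_inner_self_nonneg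
    have hv := h.curve.speedSq_pos
    have a1 : 0 ≤ w.1 * w.1 * speedSq γ₁ γ₂ z.1 := by positivity [mul_self_nonneg w.1]
    have a2 := mul_nonneg (Complex.normSq_nonneg (γ₁ z.1)) hg₁
    have a3 := mul_nonneg (Complex.normSq_nonneg (γ₂ z.1)) hg₂
    -- A null vector of the warped metric annihilates each of its three nonnegative summands.
    have b1 : w.1 * w.1 * speedSq γ₁ γ₂ z.1 = 0 := by linarith
    have b2 : Complex.normSq (γ₁ z.1) * inducedMetric f₁ z.2.1 w.2.1 w.2.1 = 0 := by linarith
    have b3 : Complex.normSq (γ₂ z.1) * inducedMetric f₂ z.2.2 w.2.2 w.2.2 = 0 := by linarith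
    refine Prod.ext ?_ (Prod.ext ?_ ?_)
    · simpa [hv.ne'] using b1
    -- If the factor has dimension 0, γ₁ may vanish, but then there is no nonzero tangent vector to
    -- detect.
    · rcases eq_or_ne (finrank ℝ E₁) 0 with h0 | h0
      · have := finrank_zero_iff.1 h0
        exact Subsingleton.elim _ _
      · have hne := (h.ne_zero₁ h0).self_of_nhds
        have : inducedMetric f₁ z.2.1 w.2.1 w.2.1 = 0 := by simpa [hne] using b2
        rw [inducedMetric, inner_self_eq_zero] at this
        exact h.legendrian₁.injective (by rw [this]; simp)
    · rcases eq_or_ne (finrank ℝ E₂) 0 with h0 | h0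
      · have := finrank_zero_iff.1 h0
        exact Subsingleton.elim _ _
      · have hne := (h.ne_zero₂ h0).self_of_nhds
        have : inducedMetric f₂ z.2.2 w.2.2 w.2.2 = 0 := by simpa [hne] using b3
        rw [inducedMetric, inner_self_eq_zero] at this
        exact h.legendrian₂.injective (by rw [this]; simp)
  · have h1 : (inner ℂ (fderiv ℝ (twistedSum j₁ j₂ γ₁ γ₂ f₁ f₂) z v)
        (twistedSum j₁ j₂ γ₁ γ₂ f₁ f₂ z) : ℂ) = 0 := by
      rw [h.fderiv_eq, twistedSum, inner_isometry_add h.orthogonal]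
      simp only [inner_add_left, inner_smul_left, inner_smul_right, h.legendrian₁.inner_self,
        h.legendrian₂.inner_self, h.legendrian₁.inner_fderiv', h.legendrian₂.inner_fderiv',
        map_mul, Complex.conj_ofReal]
      linear_combination (v.1 : ℂ) * h.curve.legendre'
    rw [inner_real_eq_re, inner_smul_right, h1, mul_zero, Complex.zero_re]

variable [FiniteDimensional ℝ E₁] [FiniteDimensional ℝ E₂]

/-- The trace with respect to the metric of the product. -/
lemma metricTrace_eq {W : Type*} [AddCommGroup W] [Module ℝ W]
    (h : ProductData j₁ j₂ γ₁ γ₂ f₁ f₂ z)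
    (B : (ℝ × E₁ × E₂) →ₗ[ℝ] (ℝ × E₁ × E₂) →ₗ[ℝ] W) :
    metricTrace (twistedSum j₁ j₂ γ₁ γ₂ f₁ f₂) z (fun v w => B v w) =
      (speedSq γ₁ γ₂ z.1)⁻¹ • B (1, 0, 0) (1, 0, 0) +
      (Complex.normSq (γ₁ z.1))⁻¹ •
        metricTrace f₁ z.2.1 (fun x y => B (0, x, 0) (0, y, 0)) +
      (Complex.normSq (γ₂ z.1))⁻¹ •
        metricTrace f₂ z.2.2 (fun x y => B (0, 0, x) (0, 0, y)) := by
  obtain ⟨b₁, hb₁⟩ := exists_orthonormal_basis f₁ z.2.1 h.legendrian₁.injective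
  obtain ⟨b₂, hb₂⟩ := exists_orthonormal_basis f₂ z.2.2 h.legendrian₂.injective
  have hv := h.curve.speedSq_pos
  -- The existence of an index shows that the dimension is positive, which is what allows division
  -- by |γ₁|.
  have hne₁ : ∀ i : Fin (finrank ℝ E₁), γ₁ z.1 ≠ 0 := fun i =>
    (h.ne_zero₁ (by have := i.pos; omega)).self_of_nhds
  have hne₂ : ∀ i : Fin (finrank ℝ E₂), γ₂ z.1 ≠ 0 := fun i =>
    (h.ne_zero₂ (by have := i.pos; omega)).self_of_nhds
  -- Dividing the orthonormal bases of the three factors by |γ'|, |γ₁| and |γ₂| makes their union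
  -- orthonormal for the warped metric.
  let c₀ := Basis.isUnitSMul (v := Basis.singleton Unit ℝ)
    (w := fun _ => (√(speedSq γ₁ γ₂ z.1))⁻¹) (fun _ => by
      rw [isUnit_iff_ne_zero]; exact inv_ne_zero (Real.sqrt_pos.2 hv).ne')
  let c₁ := Basis.isUnitSMul (v := b₁) (w := fun _ => ‖γ₁ z.1‖⁻¹) (fun i => by
      rw [isUnit_iff_ne_zero]; exact inv_ne_zero (norm_ne_zero_iff.2 (hne₁ i)))
  let c₂ := Basis.isUnitSMul (v := b₂) (w := fun _ => ‖γ₂ z.1‖⁻¹) (fun i => by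
      rw [isUnit_iff_ne_zero]; exact inv_ne_zero (norm_ne_zero_iff.2 (hne₂ i)))
  have hc₀ : ∀ i, c₀ i = (√(speedSq γ₁ γ₂ z.1))⁻¹ := fun i => by
    simp [c₀, Basis.isUnitSMul_apply]
  have hc₁ : ∀ i, c₁ i = ‖γ₁ z.1‖⁻¹ • b₁ i := fun i => Basis.isUnitSMul_apply _ _
  have hc₂ : ∀ i, c₂ i = ‖γ₂ z.1‖⁻¹ • b₂ i := fun i => Basis.isUnitSMul_apply _ _
  have hm₁ : ∀ i j, Complex.normSq (γ₁ z.1) * inducedMetric f₁ z.2.1 (c₁ i) (c₁ j) =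
      if i = j then 1 else 0 := fun i j => by
    rw [← inducedMetricBilin_apply, hc₁, hc₁]
    simp only [map_smul, LinearMap.smul_apply, inducedMetricBilin_apply, hb₁, smul_eq_mul,
      Complex.normSq_eq_norm_sq]
    have := norm_ne_zero_iff.2 (hne₁ i)
    split_ifs
    · field_simp
    · simp
  have hm₂ : ∀ i j, Complex.normSq (γ₂ z.1) * inducedMetric f₂ z.2.2 (c₂ i) (c₂ j) =
      if i = j then 1 else 0 := fun i j => by
    rw [← inducedMetricBilin_apply, hc₂, hc₂]
    simp only [map_smul, LinearMap.smul_apply, inducedMetricBilin_apply, hb₂, smul_eq_mul,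
      Complex.normSq_eq_norm_sq]
    have := norm_ne_zero_iff.2 (hne₂ i)
    split_ifs
    · field_simp
    · simp
  have hm₀ : (√(speedSq γ₁ γ₂ z.1))⁻¹ * (√(speedSq γ₁ γ₂ z.1))⁻¹ = (speedSq γ₁ γ₂ z.1)⁻¹ := by
    rw [← mul_inv, Real.mul_self_sqrt hv.le]
  have hz₁ : ∀ x, inducedMetric f₁ z.2.1 0 x = 0 := fun x => by simp [inducedMetric]
  have hz₁' : ∀ x, inducedMetric f₁ z.2.1 x 0 = 0 := fun x => by simp [inducedMetric]
  have hz₂ : ∀ x, inducedMetric f₂ z.2.2 0 x = 0 := fun x => by simp [inducedMetric]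
  have hz₂' : ∀ x, inducedMetric f₂ z.2.2 x 0 = 0 := fun x => by simp [inducedMetric]
  have h0 : ∀ i, c₀.prod (c₁.prod c₂) (Sum.inl i) = (√(speedSq γ₁ γ₂ z.1))⁻¹ • (1, 0, 0) :=
    fun i => by simp [Basis.prod_apply, hc₀, Prod.ext_iff]
  have h1 : ∀ i, c₀.prod (c₁.prod c₂) (Sum.inr (Sum.inl i)) = (0, c₁ i, 0) := fun i => by
    simp [Basis.prod_apply]
  have h2 : ∀ i, c₀.prod (c₁.prod c₂) (Sum.inr (Sum.inr i)) = (0, 0, c₂ i) := fun i => by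
    simp [Basis.prod_apply]
  rw [metricTrace_eq_sum _ _ (c₀.prod (c₁.prod c₂)) ?_ B]
  · have e₁ := metricTrace_eq_sum f₁ z.2.1 b₁ hb₁
      (B.compl₁₂ (LinearMap.inr ℝ ℝ (E₁ × E₂) ∘ₗ LinearMap.inl ℝ E₁ E₂)
        (LinearMap.inr ℝ ℝ (E₁ × E₂) ∘ₗ LinearMap.inl ℝ E₁ E₂))
    have e₂ := metricTrace_eq_sum f₂ z.2.2 b₂ hb₂
      (B.compl₁₂ (LinearMap.inr ℝ ℝ (E₁ × E₂) ∘ₗ LinearMap.inr ℝ E₁ E₂)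
        (LinearMap.inr ℝ ℝ (E₁ × E₂) ∘ₗ LinearMap.inr ℝ E₁ E₂))
    simp only [LinearMap.compl₁₂_apply, LinearMap.comp_apply, LinearMap.inl_apply,
      LinearMap.inr_apply] at e₁ e₂
    have s₁ : ∀ i, ((0, c₁ i, 0) : ℝ × E₁ × E₂) = ‖γ₁ z.1‖⁻¹ • (0, b₁ i, 0) := fun i => by
      simp [hc₁]
    have s₂ : ∀ i, ((0, 0, c₂ i) : ℝ × E₁ × E₂) = ‖γ₂ z.1‖⁻¹ • (0, 0, b₂ i) := fun i => by
      simp [hc₂]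
    rw [e₁, e₂]
    simp only [Fintype.sum_sum_type, h0, h1, h2, s₁, s₂, map_smul, LinearMap.smul_apply,
      Finset.smul_sum, smul_smul, hm₀, Complex.normSq_eq_norm_sq]
    simp [add_assoc, sq]
  · rintro (i | i | i) (k | k | k) <;> rw [h.inducedMetric_eq] <;>
      simp only [h0, h1, h2, hz₁, hz₁', hz₂, hz₂', hm₁, hm₂, Prod.smul_fst, Prod.smul_snd,
        smul_zero, smul_eq_mul, mul_one, mul_zero, zero_mul, add_zero, zero_add, hm₀,
        inv_mul_cancel₀ hv.ne', Sum.inl.injEq, Sum.inr.injEq, reduceCtorEq, if_false,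
        if_true]

end ProductData

end Product

/-! ### The mean curvature vector of the product. -/

section ProductCurvature

attribute [local instance] InnerProductSpace.complexToReal

variable {E₁ E₂ : Type*} [NormedAddCommGroup E₁] [NormedSpace ℝ E₁]
  [NormedAddCommGroup E₂] [NormedSpace ℝ E₂] [FiniteDimensional ℝ E₁] [FiniteDimensional ℝ E₂]
variable {V₁ V₂ V : Type*} [NormedAddCommGroup V₁] [InnerProductSpace ℂ V₁]
  [NormedAddCommGroup V₂] [InnerProductSpace ℂ V₂] [NormedAddCommGroup V] [InnerProductSpace ℂ V]
variable {j₁ : V₁ →ₗᵢ[ℂ] V} {j₂ : V₂ →ₗᵢ[ℂ] V}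

namespace ProductData

variable {γ₁ γ₂ : ℝ → ℂ} {f₁ : E₁ → V₁} {f₂ : E₂ → V₂} {z : ℝ × E₁ × E₂}

lemma fderiv_fderiv_eq (h : ProductData j₁ j₂ γ₁ γ₂ f₁ f₂ z) (w w' : ℝ × E₁ × E₂) :
    fderiv ℝ (fderiv ℝ (twistedSum j₁ j₂ γ₁ γ₂ f₁ f₂)) z w w' =
      j₁ (((w.1 : ℂ) * ((w'.1 : ℂ) * deriv (deriv γ₁) z.1)) • f₁ z.2.1 +
        ((w'.1 : ℂ) * deriv γ₁ z.1) • fderiv ℝ f₁ z.2.1 w.2.1) +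
      j₂ (((w.1 : ℂ) * ((w'.1 : ℂ) * deriv (deriv γ₂) z.1)) • f₂ z.2.2 +
        ((w'.1 : ℂ) * deriv γ₂ z.1) • fderiv ℝ f₂ z.2.2 w.2.2) +
      (j₁ (((w.1 : ℂ) * deriv γ₁ z.1) • fderiv ℝ f₁ z.2.1 w'.2.1 +
        γ₁ z.1 • fderiv ℝ (fderiv ℝ f₁) z.2.1 w.2.1 w'.2.1) +
      j₂ (((w.1 : ℂ) * deriv γ₂ z.1) • fderiv ℝ f₂ z.2.2 w'.2.2 +
        γ₂ z.1 • fderiv ℝ (fderiv ℝ f₂) z.2.2 w.2.2 w'.2.2)) := by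
  rw [← h.legendrianNear.fderiv_fderiv_apply]
  -- The derivative in a fixed direction is a sum of two twisted sums, so the formula for the
  -- differential applies again.
  have h1 : (fun y => fderiv ℝ (twistedSum j₁ j₂ γ₁ γ₂ f₁ f₂) y w') =ᶠ[𝓝 z]
      twistedSum j₁ j₂ (fun s => (w'.1 : ℂ) * deriv γ₁ s) (fun s => (w'.1 : ℂ) * deriv γ₂ s)
        f₁ f₂ +
      twistedSum j₁ j₂ γ₁ γ₂ (fun u => fderiv ℝ f₁ u w'.2.1) (fun u => fderiv ℝ f₂ u w'.2.2) := by
    filter_upwards [h.eventually] with y hy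
    rw [hy.fderiv_eq, Pi.add_apply, twistedSum, twistedSum, map_add, map_add]
    abel
  have d₁ := h.curve.differentiableAt_deriv₁
  have d₂ := h.curve.differentiableAt_deriv₂
  have e₁ : DifferentiableAt ℝ (fun u => fderiv ℝ f₁ u w'.2.1) z.2.1 :=
    h.legendrian₁.differentiableAt_fderiv.clm_apply (differentiableAt_const _)
  have e₂ : DifferentiableAt ℝ (fun u => fderiv ℝ f₂ u w'.2.2) z.2.2 :=
    h.legendrian₂.differentiableAt_fderiv.clm_apply (differentiableAt_const _)
  rw [h1.fderiv_eq, fderiv_add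
    (differentiableAt_twistedSum (d₁.const_mul _) (d₂.const_mul _) h.legendrian₁.differentiableAt
      h.legendrian₂.differentiableAt)
    (differentiableAt_twistedSum h.curve.differentiableAt₁ h.curve.differentiableAt₂ e₁ e₂),
    add_apply, fderiv_twistedSum (d₁.const_mul _) (d₂.const_mul _)
      h.legendrian₁.differentiableAt h.legendrian₂.differentiableAt,
    fderiv_twistedSum h.curve.differentiableAt₁ h.curve.differentiableAt₂ e₁ e₂,
    deriv_const_mul _ d₁, deriv_const_mul _ d₂, h.legendrian₁.fderiv_fderiv_apply,
    h.legendrian₂.fderiv_fderiv_apply]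

/-- Only the diagonal blocks of the Hessian enter the trace; there every term mixing γ' with dfᵢ has
a vanishing coefficient. -/
lemma trace_hessian_eq (h : ProductData j₁ j₂ γ₁ γ₂ f₁ f₂ z) :
    (metricTrace (twistedSum j₁ j₂ γ₁ γ₂ f₁ f₂) z fun v w =>
      fderiv ℝ (fderiv ℝ (twistedSum j₁ j₂ γ₁ γ₂ f₁ f₂)) z v w) =
      (speedSq γ₁ γ₂ z.1)⁻¹ •
        (j₁ (deriv (deriv γ₁) z.1 • f₁ z.2.1) + j₂ (deriv (deriv γ₂) z.1 • f₂ z.2.2)) +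
      (Complex.normSq (γ₁ z.1))⁻¹ • j₁ (γ₁ z.1 •
        metricTrace f₁ z.2.1 fun v w => fderiv ℝ (fderiv ℝ f₁) z.2.1 v w) +
      (Complex.normSq (γ₂ z.1))⁻¹ • j₂ (γ₂ z.1 •
        metricTrace f₂ z.2.2 fun v w => fderiv ℝ (fderiv ℝ f₂) z.2.2 v w) := by
  have h0 := h.metricTrace_eq (LinearMap.mk₂ ℝ
    (fun v w => fderiv ℝ (fderiv ℝ (twistedSum j₁ j₂ γ₁ γ₂ f₁ f₂)) z v w)
    (by simp) (by simp) (by simp) (by simp))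
  simp only [LinearMap.mk₂_apply] at h0
  have l₁ := metricTrace_map f₁ z.2.1
    (j₁.toRealCLM.toLinearMap ∘ₗ (LinearMap.lsmul ℂ V₁ (γ₁ z.1)).restrictScalars ℝ)
    (fun v w => fderiv ℝ (fderiv ℝ f₁) z.2.1 v w)
  have l₂ := metricTrace_map f₂ z.2.2
    (j₂.toRealCLM.toLinearMap ∘ₗ (LinearMap.lsmul ℂ V₂ (γ₂ z.1)).restrictScalars ℝ)
    (fun v w => fderiv ℝ (fderiv ℝ f₂) z.2.2 v w)
  simp only [LinearMap.comp_apply, LinearMap.restrictScalars_apply, LinearMap.lsmul_apply,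
    ContinuousLinearMap.coe_coe, LinearIsometry.toRealCLM_apply] at l₁ l₂
  rw [h0, ← l₁, ← l₂]
  simp [h.fderiv_fderiv_eq]

/-- The mean curvature vector of the product. -/
lemma finrank_smul_meanCurvatureIn_eq (h : ProductData j₁ j₂ γ₁ γ₂ f₁ f₂ z) :
    (finrank ℝ (ℝ × E₁ × E₂) : ℝ) • meanCurvatureIn (twistedSum j₁ j₂ γ₁ γ₂ f₁ f₂) z =
      j₁ ((curvatureCoeff (finrank ℝ E₁) (finrank ℝ E₂) γ₁ γ₂ z.1 * Complex.I * deriv γ₁ z.1) •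
          f₁ z.2.1 +
        (normSqCoeff (finrank ℝ E₁) γ₁ z.1 * γ₁ z.1) • meanCurvatureIn f₁ z.2.1) +
      j₂ ((curvatureCoeff (finrank ℝ E₁) (finrank ℝ E₂) γ₁ γ₂ z.1 * Complex.I * deriv γ₂ z.1) •
          f₂ z.2.2 +
        (normSqCoeff (finrank ℝ E₂) γ₂ z.1 * γ₂ z.1) • meanCurvatureIn f₂ z.2.2) := by
  rw [finrank_smul_meanCurvatureIn_eq_starProjection]
  have hvp : (speedSq γ₁ γ₂ z.1 : ℂ) ≠ 0 := by exact_mod_cast h.curve.speedSq_pos.ne'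
  have hcc : (curvatureCoeff (finrank ℝ E₁) (finrank ℝ E₂) γ₁ γ₂ z.1 : ℝ) =
    (legendreLogDeriv (finrank ℝ E₁) (finrank ℝ E₂) γ₁ γ₂ z.1).im * (speedSq γ₁ γ₂ z.1)⁻¹ := rfl
  have hnn₁ : (normSqCoeff (finrank ℝ E₁) γ₁ z.1 : ℂ) =
    finrank ℝ E₁ * (Complex.normSq (γ₁ z.1) : ℂ)⁻¹ := by simp [normSqCoeff]
  have hnn₂ : (normSqCoeff (finrank ℝ E₂) γ₂ z.1 : ℂ) =
    finrank ℝ E₂ * (Complex.normSq (γ₂ z.1) : ℂ)⁻¹ := by simp [normSqCoeff]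
  have hcd : legendreLogDeriv (finrank ℝ E₁) (finrank ℝ E₂) γ₁ γ₂ z.1 =
    (speedSq γ₁ γ₂ z.1 : ℂ)⁻¹ *
      (conj (deriv γ₁ z.1) * deriv (deriv γ₁) z.1 + conj (deriv γ₂ z.1) * deriv (deriv γ₂) z.1) +
    normSqCoeff (finrank ℝ E₁) γ₁ z.1 * (conj (γ₁ z.1) * deriv γ₁ z.1) +
    normSqCoeff (finrank ℝ E₂) γ₂ z.1 * (conj (γ₂ z.1) * deriv γ₂ z.1) := rfl
  have hvd : (speedSq γ₁ γ₂ z.1 : ℂ) = conj (deriv γ₁ z.1) * deriv γ₁ z.1 +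
      conj (deriv γ₂ z.1) * deriv γ₂ z.1 := by
    simp only [speedSq, Complex.ofReal_add, Complex.normSq_eq_conj_mul_self]
  obtain ⟨-, -, x₁, hx₁⟩ := h.legendrian₁.exists_trace_hessian_eq
  obtain ⟨-, -, x₂, hx₂⟩ := h.legendrian₂.exists_trace_hessian_eq
  have hT := h.trace_hessian_eq
  rw [hx₁, hx₂] at hT
  have hl := h.curve.legendre
  have hdd := h.curve.conj_mul_deriv_deriv
  set v := speedSq γ₁ γ₂ z.1
  set c₁ := normSqCoeff (finrank ℝ E₁) γ₁ z.1
  set c₂ := normSqCoeff (finrank ℝ E₂) γ₂ z.1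
  set a := curvatureCoeff (finrank ℝ E₁) (finrank ℝ E₂) γ₁ γ₂ z.1
  -- The projection is characterized by two checks: the candidate is normal, and the trace minus the
  -- candidate is a position plus a tangent vector.
  refine starProjection_normal_eq ?_ ?_
  · rw [mem_positionTangentSpan_orthogonal]
    refine ⟨?_, fun w => ?_⟩
    · rw [inner_real_eq_re, twistedSum, inner_isometry_add h.orthogonal]
      simp only [inner_add_right, inner_smul_left, inner_smul_right, h.legendrian₁.inner_self,
        h.legendrian₂.inner_self, h.legendrian₁.inner_meanCurvatureIn,
        h.legendrian₂.inner_meanCurvatureIn]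
      rw [← Complex.zero_re]
      congr 1
      linear_combination (a * Complex.I) * hl
    · rw [inner_real_eq_re, h.fderiv_eq, inner_isometry_add h.orthogonal]
      simp only [inner_add_left, inner_add_right, inner_smul_left, inner_smul_right,
        h.legendrian₁.inner_self, h.legendrian₂.inner_self, h.legendrian₁.inner_fderiv',
        h.legendrian₂.inner_fderiv', h.legendrian₁.inner_meanCurvatureIn,
        h.legendrian₂.inner_meanCurvatureIn, map_mul, Complex.conj_ofReal]
      have e₁ := h.legendrian₁.re_inner_fderiv_meanCurvatureIn w.2.1
      have e₂ := h.legendrian₂.re_inner_fderiv_meanCurvatureIn w.2.2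
      have n₁ := Complex.normSq_eq_conj_mul_self (z := γ₁ z.1)
      have n₂ := Complex.normSq_eq_conj_mul_self (z := γ₂ z.1)
      set q₁ := inner ℂ (fderiv ℝ f₁ z.2.1 w.2.1) (meanCurvatureIn f₁ z.2.1)
      set q₂ := inner ℂ (fderiv ℝ f₂ z.2.2 w.2.2) (meanCurvatureIn f₂ z.2.2)
      -- Each term is purely imaginary: a real multiple of i, or a real multiple of ⟨dfᵢ, Hᵢ⟩.
      trans (((a * w.1 * v : ℝ) : ℂ) * Complex.I +
        ((c₁ * Complex.normSq (γ₁ z.1) : ℝ) : ℂ) * q₁ +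
        ((c₂ * Complex.normSq (γ₂ z.1) : ℝ) : ℂ) * q₂).re
      · congr 1
        push_cast
        rw [n₁, n₂, hvd]
        ring
      · simp only [Complex.add_re, Complex.re_ofReal_mul, Complex.I_re, e₁, e₂, mul_zero, add_zero]
  · rw [mem_positionTangentSpan]
    -- The αᵢ are the coefficients of fᵢ in the trace once the Hᵢ and tangential terms are set
    -- aside; (α₁, α₂) is decomposed along γ and γ'.
    set α₁ := (v : ℂ)⁻¹ * deriv (deriv γ₁) z.1 - c₁ * γ₁ z.1 with hα₁
    set α₂ := (v : ℂ)⁻¹ * deriv (deriv γ₂) z.1 - c₂ * γ₂ z.1 with hα₂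
    obtain ⟨k₁, k₂⟩ := h.curve.expansion α₁ α₂
    -- The γ-component is real, so it is absorbed by the position vector.
    have hA : conj (γ₁ z.1) * α₁ + conj (γ₂ z.1) * α₂ =
        ((-1 - c₁ * Complex.normSq (γ₁ z.1) - c₂ * Complex.normSq (γ₂ z.1) : ℝ) : ℂ) := by
      push_cast
      rw [Complex.normSq_eq_conj_mul_self, Complex.normSq_eq_conj_mul_self, hα₁, hα₂]
      have := inv_mul_cancel₀ hvp
      linear_combination (v : ℂ)⁻¹ * hdd - this
    have hβ : ((v : ℂ)⁻¹ * (conj (deriv γ₁ z.1) * α₁ + conj (deriv γ₂ z.1) * α₂)) =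
        (v : ℂ)⁻¹ * ((v : ℂ)⁻¹ * (conj (deriv γ₁ z.1) * deriv (deriv γ₁) z.1 +
          conj (deriv γ₂ z.1) * deriv (deriv γ₂) z.1) - c₁ * conj (conj (γ₁ z.1) * deriv γ₁ z.1)
          - c₂ * conj (conj (γ₂ z.1) * deriv γ₂ z.1)) := by
      rw [hα₁, hα₂]
      simp only [map_mul, Complex.conj_conj]
      ring
    -- Of the γ'-component the real part is tangent and the imaginary part is normal. The conjugates
    -- in `hβ` turn the minus signs into the plus signs of the logarithmic derivative.
    have hβi : ((v : ℂ)⁻¹ * (conj (deriv γ₁ z.1) * α₁ + conj (deriv γ₂ z.1) * α₂)).im = a := by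
      rw [hβ, hcc, hcd, ← Complex.ofReal_inv, Complex.im_ofReal_mul]
      simp only [Complex.sub_im, Complex.add_im, Complex.im_ofReal_mul, Complex.conj_im]
      ring
    rw [hA] at k₁ k₂
    set β := (v : ℂ)⁻¹ * (conj (deriv γ₁ z.1) * α₁ + conj (deriv γ₂ z.1) * α₂)
    set A : ℝ := -1 - c₁ * Complex.normSq (γ₁ z.1) - c₂ * Complex.normSq (γ₂ z.1)
    have hβ' : β = β.re + a * Complex.I := by rw [← hβi, Complex.re_add_im]
    refine ⟨A, (β.re, (Complex.normSq (γ₁ z.1))⁻¹ • x₁, (Complex.normSq (γ₂ z.1))⁻¹ • x₂), ?_⟩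
    have r₁ : (A : ℂ) * γ₁ z.1 + β.re * deriv γ₁ z.1 =
        (v : ℂ)⁻¹ * deriv (deriv γ₁) z.1 - c₁ * γ₁ z.1 - a * Complex.I * deriv γ₁ z.1 := by
      rw [← hα₁, k₁]
      linear_combination (-deriv γ₁ z.1) * hβ'
    have r₂ : (A : ℂ) * γ₂ z.1 + β.re * deriv γ₂ z.1 =
        (v : ℂ)⁻¹ * deriv (deriv γ₂) z.1 - c₂ * γ₂ z.1 - a * Complex.I * deriv γ₂ z.1 := by
      rw [← hα₂, k₂]
      linear_combination (-deriv γ₂ z.1) * hβ'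
    rw [hT, h.fderiv_eq, twistedSum]
    simp only [← Complex.coe_smul, map_add, map_sub, map_smul, smul_add, smul_sub, smul_smul,
      Complex.ofReal_inv, Complex.ofReal_natCast, hnn₁, hnn₂]
    rw [hnn₁] at r₁
    rw [hnn₂] at r₂
    match_scalars
    · linear_combination r₁
    · linear_combination r₂
    all_goals ring

end ProductData

end ProductCurvature

/-! ### Minimality and the divergence of JH for the product. -/

section ProductDivergence

attribute [local instance] InnerProductSpace.complexToReal

variable {E₁ E₂ : Type*} [NormedAddCommGroup E₁] [NormedSpace ℝ E₁]
  [NormedAddCommGroup E₂] [NormedSpace ℝ E₂] [FiniteDimensional ℝ E₁] [FiniteDimensional ℝ E₂]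
variable {V₁ V₂ V : Type*} [NormedAddCommGroup V₁] [InnerProductSpace ℂ V₁]
  [NormedAddCommGroup V₂] [InnerProductSpace ℂ V₂] [NormedAddCommGroup V] [InnerProductSpace ℂ V]
variable {j₁ : V₁ →ₗᵢ[ℂ] V} {j₂ : V₂ →ₗᵢ[ℂ] V}

lemma meanCurvatureIn_eq_zero_of_finrank {E : Type*} [NormedAddCommGroup E] [NormedSpace ℝ E]
    [FiniteDimensional ℝ E] (f : E → V) (x : E) (h : finrank ℝ E = 0) :
    meanCurvatureIn f x = 0 := by
  simp [meanCurvatureIn, h]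

omit [FiniteDimensional ℝ E₁] [FiniteDimensional ℝ E₂] in
lemma isometry_add_eq_zero (hj : ∀ x y, inner ℂ (j₁ x) (j₂ y) = (0 : ℂ)) {x : V₁} {y : V₂}
    (h : j₁ x + j₂ y = 0) : x = 0 ∧ y = 0 := by
  have hx := inner_isometry_add hj x x 0 y
  have hy := inner_isometry_add hj 0 x y y
  rw [h, inner_zero_right, inner_zero_left, add_zero] at hx
  rw [h, inner_zero_right, inner_zero_left, zero_add] at hy
  exact ⟨inner_self_eq_zero.1 hx.symm, inner_self_eq_zero.1 hy.symm⟩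

lemma finrank_product_ne_zero : (finrank ℝ (ℝ × E₁ × E₂) : ℝ) ≠ 0 := by
  rw [finrank_prod, finrank_self]
  exact_mod_cast (by omega : 1 + finrank ℝ (E₁ × E₂) ≠ 0)

namespace ProductData

variable {γ₁ γ₂ : ℝ → ℂ} {f₁ : E₁ → V₁} {f₂ : E₂ → V₂} {z : ℝ × E₁ × E₂}

omit [FiniteDimensional ℝ E₁] [FiniteDimensional ℝ E₂] in
lemma curvatureCoeff_eq_zero_iff (h : ProductData j₁ j₂ γ₁ γ₂ f₁ f₂ z) (n₁ n₂ : ℕ) :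
    curvatureCoeff n₁ n₂ γ₁ γ₂ z.1 = 0 ↔ (legendreLogDeriv n₁ n₂ γ₁ γ₂ z.1).im = 0 := by
  simp [curvatureCoeff, h.curve.speedSq_pos.ne']

/-- The product is minimal at a point if and only if its factors are and the curve has vanishing
curvature coefficient. -/
lemma meanCurvatureIn_eq_zero_iff (h : ProductData j₁ j₂ γ₁ γ₂ f₁ f₂ z) :
    meanCurvatureIn (twistedSum j₁ j₂ γ₁ γ₂ f₁ f₂) z = 0 ↔
      meanCurvatureIn f₁ z.2.1 = 0 ∧ meanCurvatureIn f₂ z.2.2 = 0 ∧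
        (legendreLogDeriv (finrank ℝ E₁) (finrank ℝ E₂) γ₁ γ₂ z.1).im = 0 := by
  rw [← h.curvatureCoeff_eq_zero_iff, ← smul_eq_zero_iff_right (finrank_product_ne_zero (E₁ := E₁) (E₂ := E₂)),
    h.finrank_smul_meanCurvatureIn_eq]
  set a := curvatureCoeff (finrank ℝ E₁) (finrank ℝ E₂) γ₁ γ₂ z.1
  constructor
  · intro h0
    obtain ⟨h4, h5⟩ := isometry_add_eq_zero h.orthogonal h0
    -- Pairing with fᵢ removes Hᵢ and leaves a i γᵢ' = 0; regularity of the curve then gives a = 0.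
    have h6 := congrArg (fun y => (inner ℂ (f₁ z.2.1) y : ℂ)) h4
    have h7 := congrArg (fun y => (inner ℂ (f₂ z.2.2) y : ℂ)) h5
    simp only [inner_add_right, inner_smul_right, h.legendrian₁.inner_self,
      h.legendrian₂.inner_self, h.legendrian₁.inner_meanCurvatureIn,
      h.legendrian₂.inner_meanCurvatureIn, mul_one, mul_zero, add_zero, inner_zero_right,
      mul_eq_zero, Complex.ofReal_eq_zero, Complex.I_ne_zero, or_false] at h6 h7
    have ha : a = 0 := by
      rcases h.curve.self_of_nhds.2.2.2.2 with h8 | h8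
      · exact h6.resolve_right h8
      · exact h7.resolve_right h8
    rw [ha] at h4 h5
    simp only [Complex.ofReal_zero, zero_mul, zero_smul, zero_add, smul_eq_zero, normSqCoeff] at h4 h5
    refine ⟨?_, ?_, ha⟩
    · rcases eq_or_ne (finrank ℝ E₁) 0 with h0 | h0
      · exact meanCurvatureIn_eq_zero_of_finrank _ _ h0
      · have := (h.ne_zero₁ h0).self_of_nhds
        refine h4.resolve_left ?_
        simp [h0, this]
    · rcases eq_or_ne (finrank ℝ E₂) 0 with h0 | h0
      · exact meanCurvatureIn_eq_zero_of_finrank _ _ h0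
      · have := (h.ne_zero₂ h0).self_of_nhds
        refine h5.resolve_left ?_
        simp [h0, this]
  · rintro ⟨h1, h2, h3⟩
    simp [h1, h2, h3]

/-- The divergence of `JH` for the product. -/
lemma finrank_mul_divJHIn_eq (h : ProductData j₁ j₂ γ₁ γ₂ f₁ f₂ z) :
    (finrank ℝ (ℝ × E₁ × E₂) : ℝ) * divJHIn (twistedSum j₁ j₂ γ₁ γ₂ f₁ f₂) z =
      -(deriv (curvatureCoeff (finrank ℝ E₁) (finrank ℝ E₂) γ₁ γ₂) z.1 +
        curvatureCoeff (finrank ℝ E₁) (finrank ℝ E₂) γ₁ γ₂ z.1 *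
          (legendreLogDeriv (finrank ℝ E₁) (finrank ℝ E₂) γ₁ γ₂ z.1).re) +
      normSqCoeff (finrank ℝ E₁) γ₁ z.1 * divJHIn f₁ z.2.1 +
      normSqCoeff (finrank ℝ E₂) γ₂ z.1 * divJHIn f₂ z.2.2 := by
  have hne₁ : finrank ℝ E₁ ≠ 0 → γ₁ z.1 ≠ 0 := fun h0 => (h.ne_zero₁ h0).self_of_nhds
  have hne₂ : finrank ℝ E₂ ≠ 0 → γ₂ z.1 ≠ 0 := fun h0 => (h.ne_zero₂ h0).self_of_nhds
  have hda := h.curve.differentiableAt_curvatureCoeff hne₁ hne₂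
  have hdc₁ := differentiableAt_normSqCoeff h.curve.differentiableAt₁ hne₁
  have hdc₂ := differentiableAt_normSqCoeff h.curve.differentiableAt₂ hne₂
  have hcn₁ := normSqCoeff_mul_normSq hne₁
  have hcn₂ := normSqCoeff_mul_normSq hne₂
  have hcd : legendreLogDeriv (finrank ℝ E₁) (finrank ℝ E₂) γ₁ γ₂ z.1 =
    (speedSq γ₁ γ₂ z.1 : ℂ)⁻¹ *
      (conj (deriv γ₁ z.1) * deriv (deriv γ₁) z.1 + conj (deriv γ₂ z.1) * deriv (deriv γ₂) z.1) +
    normSqCoeff (finrank ℝ E₁) γ₁ z.1 * (conj (γ₁ z.1) * deriv γ₁ z.1) +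
    normSqCoeff (finrank ℝ E₂) γ₂ z.1 * (conj (γ₂ z.1) * deriv γ₂ z.1) := rfl
  have hv := h.curve.speedSq_pos
  have hvd : (speedSq γ₁ γ₂ z.1 : ℂ) = conj (deriv γ₁ z.1) * deriv γ₁ z.1 +
      conj (deriv γ₂ z.1) * deriv γ₂ z.1 := by
    simp only [speedSq, Complex.ofReal_add, Complex.normSq_eq_conj_mul_self]
  have hi₁ : (Complex.normSq (γ₁ z.1))⁻¹ * (finrank ℝ E₁ : ℝ) =
      normSqCoeff (finrank ℝ E₁) γ₁ z.1 := mul_comm _ _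
  have hi₂ : (Complex.normSq (γ₂ z.1))⁻¹ * (finrank ℝ E₂ : ℝ) =
      normSqCoeff (finrank ℝ E₂) γ₂ z.1 := mul_comm _ _
  -- Multiplication by i turns a i γ' into -a γ', so n JH is again a sum of two twisted sums.
  have hX : (fun y => (finrank ℝ (ℝ × E₁ × E₂) : ℝ) •
        (Complex.I • meanCurvatureIn (twistedSum j₁ j₂ γ₁ γ₂ f₁ f₂) y)) =ᶠ[𝓝 z]
      twistedSum j₁ j₂
        (fun s => -(curvatureCoeff (finrank ℝ E₁) (finrank ℝ E₂) γ₁ γ₂ s * deriv γ₁ s))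
        (fun s => -(curvatureCoeff (finrank ℝ E₁) (finrank ℝ E₂) γ₁ γ₂ s * deriv γ₂ s)) f₁ f₂ +
      twistedSum j₁ j₂ (fun s => normSqCoeff (finrank ℝ E₁) γ₁ s * γ₁ s)
        (fun s => normSqCoeff (finrank ℝ E₂) γ₂ s * γ₂ s)
        (fun u => Complex.I • meanCurvatureIn f₁ u)
        (fun u => Complex.I • meanCurvatureIn f₂ u) := by
    filter_upwards [h.eventually] with y hy
    rw [smul_comm, hy.finrank_smul_meanCurvatureIn_eq, Pi.add_apply, twistedSum, twistedSum]
    simp only [map_add, map_smul]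
    have hI := Complex.I_mul_I
    match_scalars
    · linear_combination
        (curvatureCoeff (finrank ℝ E₁) (finrank ℝ E₂) γ₁ γ₂ y.1 * deriv γ₁ y.1) * hI
    · ring
    · linear_combination
        (curvatureCoeff (finrank ℝ E₁) (finrank ℝ E₂) γ₁ γ₂ y.1 * deriv γ₂ y.1) * hI
    · ring
  set a := curvatureCoeff (finrank ℝ E₁) (finrank ℝ E₂) γ₁ γ₂
  set c₁ := normSqCoeff (finrank ℝ E₁) γ₁
  set c₂ := normSqCoeff (finrank ℝ E₂) γ₂
  have dγ₁ := h.curve.differentiableAt_deriv₁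
  have dγ₂ := h.curve.differentiableAt_deriv₂
  have hp : ∀ {p : ℝ → ℂ}, DifferentiableAt ℝ p z.1 →
      HasDerivAt (fun s => -(a s * p s)) (-(deriv a z.1 * p z.1 + a z.1 * deriv p z.1)) z.1 :=
    fun hd => (hda.hasDerivAt.ofReal_comp.mul hd.hasDerivAt).neg
  have dq₁ : DifferentiableAt ℝ (fun s => (c₁ s : ℂ) * γ₁ s) z.1 :=
    hdc₁.hasDerivAt.ofReal_comp.differentiableAt.mul h.curve.differentiableAt₁
  have dq₂ : DifferentiableAt ℝ (fun s => (c₂ s : ℂ) * γ₂ s) z.1 :=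
    hdc₂.hasDerivAt.ofReal_comp.differentiableAt.mul h.curve.differentiableAt₂
  have dK₁ : DifferentiableAt ℝ (fun u => Complex.I • meanCurvatureIn f₁ u) z.2.1 :=
    h.legendrian₁.differentiableAt_meanCurvatureIn.const_smul Complex.I
  have dK₂ : DifferentiableAt ℝ (fun u => Complex.I • meanCurvatureIn f₂ u) z.2.2 :=
    h.legendrian₂.differentiableAt_meanCurvatureIn.const_smul Complex.I
  have hdX : ∀ w, (finrank ℝ (ℝ × E₁ × E₂) : ℝ) • fderiv ℝ
      (fun y => Complex.I • meanCurvatureIn (twistedSum j₁ j₂ γ₁ γ₂ f₁ f₂) y) z w =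
      j₁ (((w.1 : ℂ) * -(deriv a z.1 * deriv γ₁ z.1 + a z.1 * deriv (deriv γ₁) z.1)) • f₁ z.2.1 +
        (-(a z.1 * deriv γ₁ z.1)) • fderiv ℝ f₁ z.2.1 w.2.1) +
      j₂ (((w.1 : ℂ) * -(deriv a z.1 * deriv γ₂ z.1 + a z.1 * deriv (deriv γ₂) z.1)) • f₂ z.2.2 +
        (-(a z.1 * deriv γ₂ z.1)) • fderiv ℝ f₂ z.2.2 w.2.2) +
      (j₁ (((w.1 : ℂ) * deriv (fun s => (c₁ s : ℂ) * γ₁ s) z.1) •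
          (Complex.I • meanCurvatureIn f₁ z.2.1) + (c₁ z.1 * γ₁ z.1) •
          fderiv ℝ (fun u => Complex.I • meanCurvatureIn f₁ u) z.2.1 w.2.1) +
      j₂ (((w.1 : ℂ) * deriv (fun s => (c₂ s : ℂ) * γ₂ s) z.1) •
          (Complex.I • meanCurvatureIn f₂ z.2.2) + (c₂ z.1 * γ₂ z.1) •
          fderiv ℝ (fun u => Complex.I • meanCurvatureIn f₂ u) z.2.2 w.2.2)) := by
    intro w
    have dX : DifferentiableAt ℝ
        (fun y => Complex.I • meanCurvatureIn (twistedSum j₁ j₂ γ₁ γ₂ f₁ f₂) y) z :=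
      h.legendrianNear.differentiableAt_meanCurvatureIn.const_smul Complex.I
    rw [← smul_apply, ← fderiv_fun_const_smul dX, hX.fderiv_eq,
      fderiv_add
        (differentiableAt_twistedSum (hp dγ₁).differentiableAt (hp dγ₂).differentiableAt
          h.legendrian₁.differentiableAt h.legendrian₂.differentiableAt)
        (differentiableAt_twistedSum dq₁ dq₂ dK₁ dK₂), add_apply,
      fderiv_twistedSum (hp dγ₁).differentiableAt (hp dγ₂).differentiableAt
          h.legendrian₁.differentiableAt h.legendrian₂.differentiableAt,
      fderiv_twistedSum dq₁ dq₂ dK₁ dK₂, (hp dγ₁).deriv, (hp dγ₂).deriv]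
  set D := fderiv ℝ (fun y => Complex.I • meanCurvatureIn (twistedSum j₁ j₂ γ₁ γ₂ f₁ f₂) y) z
  -- In the curve direction the JHᵢ terms drop out, since Hᵢ is hermitian-orthogonal to fᵢ.
  have hB₀ : (inner ℝ ((finrank ℝ (ℝ × E₁ × E₂) : ℝ) • D (1, 0, 0))
      (fderiv ℝ (twistedSum j₁ j₂ γ₁ γ₂ f₁ f₂) z (1, 0, 0)) : ℝ) =
      -(deriv a z.1 * speedSq γ₁ γ₂ z.1) - a z.1 * (conj (deriv γ₁ z.1) * deriv (deriv γ₁) z.1 +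
        conj (deriv γ₂ z.1) * deriv (deriv γ₂) z.1).re := by
    rw [hdX, h.fderiv_eq, add_add_add_comm, ← map_add, ← map_add, inner_real_eq_re,
      inner_isometry_add h.orthogonal]
    simp only [inner_add_left, inner_smul_left, inner_smul_right, map_zero, smul_zero, add_zero,
      h.legendrian₁.inner_self, h.legendrian₂.inner_self, h.legendrian₁.inner_meanCurvatureIn',
      h.legendrian₂.inner_meanCurvatureIn']
    trans (-(((deriv a z.1 * speedSq γ₁ γ₂ z.1 : ℝ) : ℂ)) - (a z.1 : ℂ) *
      conj (conj (deriv γ₁ z.1) * deriv (deriv γ₁) z.1 +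
        conj (deriv γ₂ z.1) * deriv (deriv γ₂) z.1)).re
    · congr 1
      simp only [map_mul, map_add, map_neg, Complex.conj_conj, Complex.conj_ofReal,
        Complex.ofReal_mul, hvd, Complex.ofReal_one, map_one]
      ring
    · rw [Complex.sub_re, Complex.neg_re, Complex.ofReal_re, Complex.re_ofReal_mul, Complex.conj_re]
  -- Along a factor, -a γ' contributes a multiple of gᵢ, whose trace is nᵢ times that multiple, and
  -- the other term is the integrand of div JHᵢ.
  have hB₁ : ∀ x y, (inner ℝ ((finrank ℝ (ℝ × E₁ × E₂) : ℝ) • D (0, x, 0))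
      (fderiv ℝ (twistedSum j₁ j₂ γ₁ γ₂ f₁ f₂) z (0, y, 0)) : ℝ) =
      (-(a z.1 * (conj (γ₁ z.1) * deriv γ₁ z.1).re)) • inducedMetric f₁ z.2.1 x y +
      (c₁ z.1 * Complex.normSq (γ₁ z.1)) •
        inner ℝ (fderiv ℝ (fun u => Complex.I • meanCurvatureIn f₁ u) z.2.1 x)
          (fderiv ℝ f₁ z.2.1 y) := by
    intro x y
    rw [hdX, h.fderiv_eq, add_add_add_comm, ← map_add, ← map_add, inner_real_eq_re,
      inner_isometry_add h.orthogonal, inner_real_eq_re (V := V₁)]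
    simp only [inner_add_left, inner_smul_left, inner_smul_right, map_zero, smul_zero, add_zero,
      Complex.ofReal_zero, zero_mul, zero_smul, zero_add,
      h.legendrian₁.inner_fderiv_fderiv, inner_zero_right, smul_eq_mul]
    trans (((-(a z.1 * inducedMetric f₁ z.2.1 x y) : ℝ) : ℂ) *
      conj (conj (γ₁ z.1) * deriv γ₁ z.1) + ((c₁ z.1 * Complex.normSq (γ₁ z.1) : ℝ) : ℂ) *
        inner ℂ (fderiv ℝ (fun u => Complex.I • meanCurvatureIn f₁ u) z.2.1 x)
          (fderiv ℝ f₁ z.2.1 y)).re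
    · congr 1
      simp only [map_mul, map_neg, Complex.conj_conj, Complex.conj_ofReal,
        Complex.ofReal_mul, Complex.ofReal_neg, Complex.normSq_eq_conj_mul_self]
      ring
    · rw [Complex.add_re, Complex.re_ofReal_mul, Complex.re_ofReal_mul, Complex.conj_re]
      ring
  have hB₂ : ∀ x y, (inner ℝ ((finrank ℝ (ℝ × E₁ × E₂) : ℝ) • D (0, 0, x))
      (fderiv ℝ (twistedSum j₁ j₂ γ₁ γ₂ f₁ f₂) z (0, 0, y)) : ℝ) =
      (-(a z.1 * (conj (γ₂ z.1) * deriv γ₂ z.1).re)) • inducedMetric f₂ z.2.2 x y +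
      (c₂ z.1 * Complex.normSq (γ₂ z.1)) •
        inner ℝ (fderiv ℝ (fun u => Complex.I • meanCurvatureIn f₂ u) z.2.2 x)
          (fderiv ℝ f₂ z.2.2 y) := by
    intro x y
    rw [hdX, h.fderiv_eq, add_add_add_comm, ← map_add, ← map_add, inner_real_eq_re,
      inner_isometry_add h.orthogonal, inner_real_eq_re (V := V₂)]
    simp only [inner_add_left, inner_smul_left, inner_smul_right, map_zero, smul_zero, add_zero,
      Complex.ofReal_zero, zero_mul, zero_smul, zero_add,
      h.legendrian₂.inner_fderiv_fderiv, inner_zero_right, smul_eq_mul]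
    trans (((-(a z.1 * inducedMetric f₂ z.2.2 x y) : ℝ) : ℂ) *
      conj (conj (γ₂ z.1) * deriv γ₂ z.1) + ((c₂ z.1 * Complex.normSq (γ₂ z.1) : ℝ) : ℂ) *
        inner ℂ (fderiv ℝ (fun u => Complex.I • meanCurvatureIn f₂ u) z.2.2 x)
          (fderiv ℝ f₂ z.2.2 y)).re
    · congr 1
      simp only [map_mul, map_neg, Complex.conj_conj, Complex.conj_ofReal,
        Complex.ofReal_mul, Complex.ofReal_neg, Complex.normSq_eq_conj_mul_self]
      ring
    · rw [Complex.add_re, Complex.re_ofReal_mul, Complex.re_ofReal_mul, Complex.conj_re]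
      ring
  have ht := h.metricTrace_eq (LinearMap.mk₂ ℝ
    (fun w w' => (inner ℝ ((finrank ℝ (ℝ × E₁ × E₂) : ℝ) • D w)
      (fderiv ℝ (twistedSum j₁ j₂ γ₁ γ₂ f₁ f₂) z w') : ℝ))
    (by simp [inner_add_left]) (by simp [inner_smul_left, mul_left_comm])
    (by simp [inner_add_right]) (by simp [inner_smul_right]))
  simp only [LinearMap.mk₂_apply, hB₀, hB₁, hB₂, metricTrace_add, metricTrace_smul,
    metricTrace_inducedMetric _ _ h.legendrian₁.injective,
    metricTrace_inducedMetric _ _ h.legendrian₂.injective] at ht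
  have hl : (finrank ℝ (ℝ × E₁ × E₂) : ℝ) * divJHIn (twistedSum j₁ j₂ γ₁ γ₂ f₁ f₂) z =
      metricTrace (twistedSum j₁ j₂ γ₁ γ₂ f₁ f₂) z (fun w w' =>
        inner ℝ ((finrank ℝ (ℝ × E₁ × E₂) : ℝ) • D w)
          (fderiv ℝ (twistedSum j₁ j₂ γ₁ γ₂ f₁ f₂) z w')) := by
    simp only [real_inner_smul_left]
    exact (metricTrace_smul (twistedSum j₁ j₂ γ₁ γ₂ f₁ f₂) z (finrank ℝ (ℝ × E₁ × E₂) : ℝ)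
      (fun w w' => (inner ℝ (D w) (fderiv ℝ (twistedSum j₁ j₂ γ₁ γ₂ f₁ f₂) z w') : ℝ))).symm
  rw [hl, ht]
  change _ • _ + _ • (_ • _ + _ • divJHIn f₁ z.2.1) + _ • (_ • _ + _ • divJHIn f₂ z.2.2) = _
  rw [hcn₁, hcn₂, hcd]
  simp only [smul_eq_mul, ← Complex.ofReal_inv, Complex.add_re, Complex.re_ofReal_mul]
  have hvv := inv_mul_cancel₀ hv.ne'
  -- The three contributions proportional to a assemble to -a Re ω.
  linear_combination (-deriv a z.1) * hvv +
    (divJHIn f₁ z.2.1 - a z.1 * (conj (γ₁ z.1) * deriv γ₁ z.1).re) * hi₁ +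
    (divJHIn f₂ z.2.2 - a z.1 * (conj (γ₂ z.1) * deriv γ₂ z.1).re) * hi₂

end ProductData

end ProductDivergence

/-! ### The angle of a Legendre curve and the differential equation. -/

section LegendreCurve

/-- The determinant `γ₁ γ₂' - γ₂ γ₁'`. -/
def legendreDet (γ₁ γ₂ : ℝ → ℂ) (t : ℝ) : ℂ := γ₁ t * deriv γ₂ t - γ₂ t * deriv γ₁ t

/-- The function `γ₁ ^ n₁ * γ₂ ^ n₂ * (γ₁ γ₂' - γ₂ γ₁')`, whose argument is the contribution of
the curve to the Legendrian angle of the product. -/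
def legendreAngleFun (n₁ n₂ : ℕ) (γ₁ γ₂ : ℝ → ℂ) (t : ℝ) : ℂ :=
  γ₁ t ^ n₁ * γ₂ t ^ n₂ * legendreDet γ₁ γ₂ t

/-- The function that is constant if and only if the product is C-minimal. -/
def angleSpeed (n₁ n₂ : ℕ) (γ₁ γ₂ : ℝ → ℂ) (t : ℝ) : ℝ :=
  curvatureCoeff n₁ n₂ γ₁ γ₂ t * ‖legendreAngleFun n₁ n₂ γ₁ γ₂ t‖

lemma HasDerivAt.norm_of_logDeriv {g : ℝ → ℂ} {w : ℂ} {t : ℝ} (h : HasDerivAt g (w * g t) t)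
    (h0 : g t ≠ 0) : HasDerivAt (fun s => ‖g s‖) (w.re * ‖g t‖) t := by
  have h1 := (h.normSq).sqrt (by simpa using h0)
  simp only [← Complex.norm_def] at h1
  convert! h1 using 1
  have h2 : (conj (g t) * (w * g t)).re = w.re * ‖g t‖ ^ 2 := by
    rw [mul_left_comm, ← Complex.normSq_eq_conj_mul_self, mul_comm, Complex.re_ofReal_mul,
      Complex.normSq_eq_norm_sq, mul_comm]
  have h3 := norm_ne_zero_iff.2 h0
  rw [h2]
  field_simp

namespace LegendreNear

variable {γ₁ γ₂ : ℝ → ℂ} {t : ℝ} {n₁ n₂ : ℕ}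

/-- The Legendre condition makes γ' hermitian-orthogonal to γ, hence a multiple of (-γ̄₂, γ̄₁); the
factor is the determinant of γ and γ'. -/
lemma deriv₁_eq (h : LegendreNear γ₁ γ₂ t) :
    deriv γ₁ t = -(legendreDet γ₁ γ₂ t * conj (γ₂ t)) := by
  rw [legendreDet]
  linear_combination (-deriv γ₁ t) * h.sphere + γ₁ t * h.legendre

lemma deriv₂_eq (h : LegendreNear γ₁ γ₂ t) : deriv γ₂ t = legendreDet γ₁ γ₂ t * conj (γ₁ t) := by
  rw [legendreDet]
  linear_combination (-deriv γ₂ t) * h.sphere + γ₂ t * h.legendre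

lemma speedSq_eq_conj_mul (h : LegendreNear γ₁ γ₂ t) :
    (speedSq γ₁ γ₂ t : ℂ) = conj (legendreDet γ₁ γ₂ t) * legendreDet γ₁ γ₂ t := by
  simp only [speedSq, Complex.ofReal_add, Complex.normSq_eq_conj_mul_self]
  rw [h.deriv₁_eq, h.deriv₂_eq]
  simp only [map_mul, map_neg, Complex.conj_conj]
  linear_combination conj (legendreDet γ₁ γ₂ t) * legendreDet γ₁ γ₂ t * h.sphere

lemma speedSq_eq (h : LegendreNear γ₁ γ₂ t) :
    speedSq γ₁ γ₂ t = ‖legendreDet γ₁ γ₂ t‖ ^ 2 := by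
  rw [← Complex.normSq_eq_norm_sq]
  exact_mod_cast (h.speedSq_eq_conj_mul.trans Complex.normSq_eq_conj_mul_self.symm)

lemma legendreDet_ne_zero (h : LegendreNear γ₁ γ₂ t) : legendreDet γ₁ γ₂ t ≠ 0 := by
  intro h0
  have := h.speedSq_pos
  rw [h.speedSq_eq, h0] at this
  simp at this

lemma legendreAngleFun_ne_zero (h : LegendreNear γ₁ γ₂ t) (hn₁ : n₁ ≠ 0 → γ₁ t ≠ 0)
    (hn₂ : n₂ ≠ 0 → γ₂ t ≠ 0) : legendreAngleFun n₁ n₂ γ₁ γ₂ t ≠ 0 := by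
  refine mul_ne_zero (mul_ne_zero ?_ ?_) h.legendreDet_ne_zero
  · rcases eq_or_ne n₁ 0 with rfl | h0
    · simp
    · exact pow_ne_zero _ (hn₁ h0)
  · rcases eq_or_ne n₂ 0 with rfl | h0
    · simp
    · exact pow_ne_zero _ (hn₂ h0)

/-- The logarithmic derivative nγ'/γ is written as n γ̄γ'/|γ|², a form that also covers n = 0 at a
zero of γ. -/
lemma hasDerivAt_pow_normSqCoeff {n : ℕ} {γ : ℝ → ℂ} (hd : DifferentiableAt ℝ γ t)
    (hn : n ≠ 0 → γ t ≠ 0) :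
    HasDerivAt (fun s => γ s ^ n) (normSqCoeff n γ t * (conj (γ t) * deriv γ t) * γ t ^ n) t := by
  have h1 := hd.hasDerivAt.fun_pow n
  convert! h1 using 1
  rcases eq_or_ne n 0 with rfl | h0
  · simp [normSqCoeff]
  · have h2 := hn h0
    have h3 : conj (γ t) ≠ 0 := by simpa using h2
    obtain ⟨k, rfl⟩ := Nat.exists_eq_succ_of_ne_zero h0
    simp only [normSqCoeff, Complex.ofReal_mul, Complex.ofReal_inv,
      Complex.normSq_eq_conj_mul_self, Complex.ofReal_natCast, Nat.succ_eq_add_one,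
      Nat.add_sub_cancel]
    field_simp
    ring

lemma hasDerivAt_legendreAngleFun (h : LegendreNear γ₁ γ₂ t) (hn₁ : n₁ ≠ 0 → γ₁ t ≠ 0)
    (hn₂ : n₂ ≠ 0 → γ₂ t ≠ 0) :
    HasDerivAt (legendreAngleFun n₁ n₂ γ₁ γ₂)
      (legendreLogDeriv n₁ n₂ γ₁ γ₂ t * legendreAngleFun n₁ n₂ γ₁ γ₂ t) t := by
  have h1 := (hasDerivAt_pow_normSqCoeff h.differentiableAt₁ hn₁).mul
    (hasDerivAt_pow_normSqCoeff h.differentiableAt₂ hn₂)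
  have h2 := (h.differentiableAt₁.hasDerivAt.mul h.differentiableAt_deriv₂.hasDerivAt).sub
    (h.differentiableAt₂.hasDerivAt.mul h.differentiableAt_deriv₁.hasDerivAt)
  refine (h1.mul h2).congr_deriv ?_
  have hv := h.speedSq_eq_conj_mul
  have h3 : legendreDet γ₁ γ₂ t ≠ 0 := h.legendreDet_ne_zero
  have h4 : conj (legendreDet γ₁ γ₂ t) ≠ 0 := by simpa using h3
  -- The derivative of the determinant is γ₁γ₂'' - γ₂γ₁''; substituting γ' = det · (-γ̄₂, γ̄₁) in
  -- ⟨γ', γ''⟩ identifies it.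
  have h5 : (speedSq γ₁ γ₂ t : ℂ)⁻¹ * (conj (deriv γ₁ t) * deriv (deriv γ₁) t +
      conj (deriv γ₂ t) * deriv (deriv γ₂) t) * legendreDet γ₁ γ₂ t =
      γ₁ t * deriv (deriv γ₂) t - γ₂ t * deriv (deriv γ₁) t := by
    rw [hv]
    nth_rewrite 1 [h.deriv₁_eq]
    nth_rewrite 1 [h.deriv₂_eq]
    simp only [map_mul, map_neg, Complex.conj_conj]
    field_simp
    ring
  simp only [legendreLogDeriv, legendreAngleFun, Pi.mul_apply, Pi.sub_apply]
  rw [show γ₁ t * deriv γ₂ t - γ₂ t * deriv γ₁ t = legendreDet γ₁ γ₂ t from rfl]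
  linear_combination (-γ₁ t ^ n₁ * γ₂ t ^ n₂) * h5

/-- Since |g|' = |g| Re ω, the modulus |g| is an integrating factor for the expression that appears
in div JH. -/
lemma hasDerivAt_angleSpeed (h : LegendreNear γ₁ γ₂ t) (hn₁ : n₁ ≠ 0 → γ₁ t ≠ 0)
    (hn₂ : n₂ ≠ 0 → γ₂ t ≠ 0) :
    HasDerivAt (angleSpeed n₁ n₂ γ₁ γ₂) (‖legendreAngleFun n₁ n₂ γ₁ γ₂ t‖ *
      (deriv (curvatureCoeff n₁ n₂ γ₁ γ₂) t +
        curvatureCoeff n₁ n₂ γ₁ γ₂ t * (legendreLogDeriv n₁ n₂ γ₁ γ₂ t).re)) t := by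
  refine ((h.differentiableAt_curvatureCoeff hn₁ hn₂).hasDerivAt.mul
    ((h.hasDerivAt_legendreAngleFun hn₁ hn₂).norm_of_logDeriv
      (h.legendreAngleFun_ne_zero hn₁ hn₂))).congr_deriv ?_
  ring

/-- If the speed is `|γ₁| ^ n₁ |γ₂| ^ n₂`, then `angleSpeed` is the derivative of the angle. -/
lemma angleSpeed_eq (h : LegendreNear γ₁ γ₂ t)
    (hs : ‖legendreDet γ₁ γ₂ t‖ = ‖γ₁ t‖ ^ n₁ * ‖γ₂ t‖ ^ n₂) :
    angleSpeed n₁ n₂ γ₁ γ₂ t = (legendreLogDeriv n₁ n₂ γ₁ γ₂ t).im := by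
  have h0 := norm_ne_zero_iff.2 h.legendreDet_ne_zero
  rw [angleSpeed, curvatureCoeff, legendreAngleFun, norm_mul, norm_mul, norm_pow, norm_pow, ← hs,
    h.speedSq_eq]
  field_simp

end LegendreNear

namespace IsLegendreCurve

variable {I : Set ℝ} {γ₁ γ₂ : ℝ → ℂ} {n₁ n₂ : ℕ}

lemma legendreNear (h : IsLegendreCurve I γ₁ γ₂) (hI : IsOpen I) {t : ℝ} (ht : t ∈ I) :
    LegendreNear γ₁ γ₂ t := by
  filter_upwards [hI.eventually_mem ht, eventually_eventually_nhds.2 (hI.eventually_mem ht)]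
    with s hs hs'
  have c₁ := (h.smooth₁ s hs).contDiffAt (hI.mem_nhds hs)
  have c₂ := (h.smooth₂ s hs).contDiffAt (hI.mem_nhds hs)
  refine ⟨c₁, c₂, ?_, ?_, h.regular s hs⟩
  · rw [← Complex.normSq_eq_conj_mul_self, ← Complex.normSq_eq_conj_mul_self,
      Complex.normSq_eq_norm_sq, Complex.normSq_eq_norm_sq]
    exact_mod_cast h.sphere s hs
  -- The real part is the derivative of |γ|² = 1, the imaginary part the Legendre condition.
  · apply Complex.ext
    · have d₁ := (c₁.differentiableAt (by simp)).hasDerivAt.normSq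
      have d₂ := (c₂.differentiableAt (by simp)).hasDerivAt.normSq
      have e : (fun s => Complex.normSq (γ₁ s) + Complex.normSq (γ₂ s)) =ᶠ[𝓝 s] fun _ => 1 := by
        filter_upwards [hs'] with r hr
        rw [Complex.normSq_eq_norm_sq, Complex.normSq_eq_norm_sq, h.sphere r hr]
      have h2 := e.deriv_eq
      rw [deriv_const] at h2
      have h3 := (d₁.add d₂).deriv.symm.trans h2
      rw [Complex.add_re, Complex.zero_re]
      linarith
    · have h1 := h.legendre s hs
      rw [Complex.inner, Complex.inner] at h1
      simp only [Complex.mul_re, Complex.mul_im, Complex.conj_re, Complex.conj_im, Complex.I_re,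
        Complex.I_im, Complex.add_im, Complex.zero_im] at h1 ⊢
      linarith

/-- For a Legendre curve, the equation is an equation for the determinant. -/
lemma solvesODE_iff (h : IsLegendreCurve I γ₁ γ₂) (hI : IsOpen I) {l m : ℝ} :
    SolvesODE n₁ n₂ l m I γ₁ γ₂ ↔ ∀ t ∈ I, legendreDet γ₁ γ₂ t =
      Complex.exp (Complex.I * (l + m * t)) * conj (γ₁ t) ^ n₁ * conj (γ₂ t) ^ n₂ := by
  constructor
  · intro hs t ht
    have hL := h.legendreNear hI ht
    have hcont : ∀ {γ : ℝ → ℂ}, ContDiffAt ℝ ∞ γ t → ContinuousAt (fun s => conj (γ s)) t :=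
      fun hc => Complex.continuous_conj.continuousAt.comp hc.continuousAt
    have e1 : ContinuousAt (legendreDet γ₁ γ₂) t :=
      (hL.contDiffAt₁.continuousAt.mul hL.contDiffAt₂.deriv_real.continuousAt).sub
        (hL.contDiffAt₂.continuousAt.mul hL.contDiffAt₁.deriv_real.continuousAt)
    have e2 : ContinuousAt (fun s : ℝ => Complex.exp (Complex.I * (l + m * s)) *
        conj (γ₁ s) ^ n₁ * conj (γ₂ s) ^ n₂) t :=
      (ContinuousAt.mul (by fun_prop) ((hcont hL.contDiffAt₁).pow _)).mul
        ((hcont hL.contDiffAt₂).pow _)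
    -- Dividing the equation by γ̄₁γ̄₂ requires nonzero components. Where one component vanishes the
    -- other has modulus 1, so the vanishing one has nonzero derivative and its zeros are isolated;
    -- continuity then extends the identity to them.
    have hne : ∀ᶠ s in 𝓝[≠] t, γ₁ s ≠ 0 ∧ γ₂ s ≠ 0 := by
      have aux : ∀ {γ : ℝ → ℂ}, DifferentiableAt ℝ γ t → (γ t = 0 → deriv γ t ≠ 0) →
          ∀ᶠ s in 𝓝[≠] t, γ s ≠ 0 := by
        intro γ hd h0
        rcases eq_or_ne (γ t) 0 with h1 | h1
        · simpa [h1] using hd.hasDerivAt.eventually_ne (c := 0) (h0 h1)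
        · exact (hd.continuousAt.eventually_ne h1).filter_mono nhdsWithin_le_nhds
      refine (aux hL.differentiableAt₁ fun h0 => ?_).and (aux hL.differentiableAt₂ fun h0 => ?_)
      · have := hL.sphere
        rw [h0] at this
        rw [hL.deriv₁_eq]
        refine neg_ne_zero.2 (mul_ne_zero hL.legendreDet_ne_zero fun h2 => ?_)
        simp [h2] at this
      · have := hL.sphere
        rw [h0] at this
        rw [hL.deriv₂_eq]
        refine mul_ne_zero hL.legendreDet_ne_zero fun h2 => ?_
        simp [h2] at this
    refine tendsto_nhds_unique_of_eventuallyEq (e1.tendsto.mono_left nhdsWithin_le_nhds)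
      (e2.tendsto.mono_left (nhdsWithin_le_nhds (s := {t}ᶜ))) ?_
    filter_upwards [hne, (hI.eventually_mem ht).filter_mono nhdsWithin_le_nhds] with s h1 h2
    have h3 := (hs s h2).2
    rw [(h.legendreNear hI h2).deriv₁_eq] at h3
    have h4 : conj (γ₁ s) ≠ 0 := by simpa using h1.1
    have h5 : conj (γ₂ s) ≠ 0 := by simpa using h1.2
    apply mul_right_cancel₀ (mul_ne_zero h4 h5)
    linear_combination -h3
  · intro hs t ht
    have hL := h.legendreNear hI ht
    refine ⟨by linear_combination hL.legendre, ?_⟩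
    rw [hL.deriv₁_eq, hs t ht]
    ring

/-- The exponential has modulus 1, so a parameter in which the equation holds is already the
normalized one. -/
lemma norm_legendreDet_of_solvesODE (h : IsLegendreCurve I γ₁ γ₂) (hI : IsOpen I) {l m : ℝ}
    (hs : SolvesODE n₁ n₂ l m I γ₁ γ₂) {t : ℝ} (ht : t ∈ I) :
    ‖legendreDet γ₁ γ₂ t‖ = ‖γ₁ t‖ ^ n₁ * ‖γ₂ t‖ ^ n₂ := by
  rw [(h.solvesODE_iff hI).1 hs t ht]
  have : Complex.I * (l + m * t) = ((l + m * t : ℝ) : ℂ) * Complex.I := by push_cast; ring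
  rw [this, norm_mul, norm_mul, Complex.norm_exp_ofReal_mul_I, norm_pow, norm_pow, one_mul,
    Complex.norm_conj, Complex.norm_conj]

/-- A Legendre curve with speed `|γ₁| ^ n₁ |γ₂| ^ n₂` solves the equation with parameter `m` if
and only if its angle has derivative `m`. -/
lemma exists_solvesODE_iff (h : IsLegendreCurve I γ₁ γ₂) (hI : IsOpen I) (hI' : I.OrdConnected)
    (hne : I.Nonempty) (hn₁ : n₁ ≠ 0 → ∀ t ∈ I, γ₁ t ≠ 0) (hn₂ : n₂ ≠ 0 → ∀ t ∈ I, γ₂ t ≠ 0)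
    (hs : ∀ t ∈ I, ‖legendreDet γ₁ γ₂ t‖ = ‖γ₁ t‖ ^ n₁ * ‖γ₂ t‖ ^ n₂) (m : ℝ) :
    (∃ l : ℝ, SolvesODE n₁ n₂ l m I γ₁ γ₂) ↔
      ∀ t ∈ I, (legendreLogDeriv n₁ n₂ γ₁ γ₂ t).im = m := by
  set g := legendreAngleFun n₁ n₂ γ₁ γ₂ with hg
  have hg0 : ∀ t ∈ I, g t ≠ 0 := fun t ht => (h.legendreNear hI ht).legendreAngleFun_ne_zero
    (fun h0 => hn₁ h0 t ht) (fun h0 => hn₂ h0 t ht)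
  have hgd : ∀ t ∈ I, HasDerivAt g (legendreLogDeriv n₁ n₂ γ₁ γ₂ t * g t) t := fun t ht =>
    (h.legendreNear hI ht).hasDerivAt_legendreAngleFun
    (fun h0 => hn₁ h0 t ht) (fun h0 => hn₂ h0 t ht)
  have hp₁ : ∀ t ∈ I, γ₁ t ^ n₁ ≠ 0 := fun t ht =>
    left_ne_zero_of_mul (left_ne_zero_of_mul (hg0 t ht))
  have hp₂ : ∀ t ∈ I, γ₂ t ^ n₂ ≠ 0 := fun t ht =>
    right_ne_zero_of_mul (left_ne_zero_of_mul (hg0 t ht))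
  -- The phase of g with the rotation exp(imt) removed. Its logarithmic derivative is i(Im ω - m),
  -- so it is constant exactly when Im ω = m.
  let U : ℝ → ℂ := fun t => g t * Complex.exp (-(Complex.I * (m * t))) * (‖g t‖ : ℂ)⁻¹
  have hgn : ∀ t ∈ I, (‖g t‖ : ℂ) ≠ 0 := fun t ht => by simpa using hg0 t ht
  have hgr : ∀ t ∈ I, (‖g t‖ : ℂ) = γ₁ t ^ n₁ * γ₂ t ^ n₂ * conj (γ₁ t) ^ n₁ * conj (γ₂ t) ^ n₂ := by
    intro t ht
    rw [hg, legendreAngleFun, norm_mul, hs t ht, norm_mul, norm_pow, norm_pow]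
    have e : ∀ w : ℂ, (‖w‖ : ℂ) * ‖w‖ = conj w * w := fun w => by
      rw [← Complex.normSq_eq_conj_mul_self, Complex.normSq_eq_norm_sq]; push_cast; ring
    push_cast
    calc (‖γ₁ t‖ : ℂ) ^ n₁ * ‖γ₂ t‖ ^ n₂ * (‖γ₁ t‖ ^ n₁ * ‖γ₂ t‖ ^ n₂) =
        (‖γ₁ t‖ * ‖γ₁ t‖) ^ n₁ * (‖γ₂ t‖ * ‖γ₂ t‖) ^ n₂ := by ring
      _ = _ := by rw [e, e]; ring
  have hUd : ∀ t ∈ I, HasDerivAt U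
      (U t * (Complex.I * ((legendreLogDeriv n₁ n₂ γ₁ γ₂ t).im - m : ℝ))) t := by
    intro t ht
    have h1 := (hgd t ht).norm_of_logDeriv (hg0 t ht)
    have h2 : HasDerivAt (fun s : ℝ => Complex.exp (-(Complex.I * (m * s))))
        (Complex.exp (-(Complex.I * (m * t))) * (-(Complex.I * (m * 1)))) t :=
      (((((hasDerivAt_id t).ofReal_comp).const_mul (m : ℂ)).const_mul Complex.I).neg).cexp
    refine (((hgd t ht).mul h2).mul (h1.ofReal_comp.fun_inv (hgn t ht))).congr_deriv ?_
    have h3 := Complex.re_add_im (legendreLogDeriv n₁ n₂ γ₁ γ₂ t)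
    simp only [U, Pi.mul_apply]
    have h4 := hgn t ht
    push_cast
    rw [← h3]
    simp only [Complex.add_re, Complex.add_im, Complex.ofReal_re, Complex.ofReal_im,
      Complex.re_ofReal_mul, Complex.im_ofReal_mul, Complex.I_re, Complex.I_im]
    field_simp
    push_cast
    ring
  -- For the normalized speed |g| = |γ₁|^(2n₁) |γ₂|^(2n₂), so cancelling γ₁^n₁ γ₂^n₂ turns the phase
  -- condition into the equation for the determinant.
  have hU : ∀ t ∈ I, ∀ l : ℝ, U t = Complex.exp (Complex.I * l) ↔ legendreDet γ₁ γ₂ t =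
      Complex.exp (Complex.I * (l + m * t)) * conj (γ₁ t) ^ n₁ * conj (γ₂ t) ^ n₂ := by
    intro t ht l
    have h4 := hgn t ht
    have h5 := hp₁ t ht
    have h6 := hp₂ t ht
    have h7 : Complex.exp (Complex.I * (l + m * t)) =
        Complex.exp (Complex.I * l) * Complex.exp (Complex.I * (m * t)) := by
      rw [← Complex.exp_add]; ring_nf
    have h8 := Complex.exp_ne_zero (Complex.I * (m * t))
    have h9 : U t = g t * ((Complex.exp (Complex.I * (m * t)))⁻¹ * (‖g t‖ : ℂ)⁻¹) := by
      simp only [U, Complex.exp_neg, mul_assoc]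
    rw [h7, h9, ← mul_inv, ← div_eq_mul_inv, div_eq_iff (mul_ne_zero h8 h4), hgr t ht, hg,
      legendreAngleFun]
    constructor
    · intro h10
      apply mul_left_cancel₀ (mul_ne_zero h5 h6)
      linear_combination h10
    · intro h10
      linear_combination γ₁ t ^ n₁ * γ₂ t ^ n₂ * h10
  constructor
  · rintro ⟨l, hl⟩ t ht
    rw [h.solvesODE_iff hI] at hl
    have e : U =ᶠ[𝓝 t] fun _ => Complex.exp (Complex.I * l) := by
      filter_upwards [hI.eventually_mem ht] with s hs'
      exact (hU s hs' l).2 (hl s hs')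
    have e' := (hUd t ht).deriv.symm.trans e.deriv_eq
    rw [deriv_const] at e'
    have hU0 : U t ≠ 0 := by rw [e.eq_of_nhds]; exact Complex.exp_ne_zero _
    have := (mul_eq_zero.1 ((mul_eq_zero.1 e').resolve_left hU0)).resolve_left Complex.I_ne_zero
    have := Complex.ofReal_eq_zero.1 this
    linarith
  · intro him
    obtain ⟨t₀, ht₀⟩ := hne
    have hnorm : ‖U t₀‖ = 1 := by
      have e1 : -(Complex.I * (m * t₀)) = ((-(m * t₀) : ℝ) : ℂ) * Complex.I := by push_cast; ring
      have e2 := norm_ne_zero_iff.2 (hg0 t₀ ht₀)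
      simp only [U, norm_mul, norm_inv, e1, Complex.norm_exp_ofReal_mul_I, Complex.norm_real,
        norm_norm]
      field_simp
    -- The parameter l is the argument of the constant unit number U.
    refine ⟨Complex.arg (U t₀), (h.solvesODE_iff hI).2 fun t ht => (hU t ht _).1 ?_⟩
    have hc : U t = U t₀ := by
      refine hI.is_const_of_deriv_eq_zero hI'.isPreconnected
        (fun s hs' => (hUd s hs').differentiableAt.differentiableWithinAt) (fun s hs' => ?_) ht ht₀
      rw [(hUd s hs').deriv, him s hs']
      simp
    rw [hc]
    have := Complex.norm_mul_exp_arg_mul_I (U t₀)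
    rw [hnorm, Complex.ofReal_one, one_mul] at this
    rw [mul_comm, this]

/-- The condition for C-minimality says that `angleSpeed` is constant. -/
lemma forall_deriv_curvatureCoeff_iff (h : IsLegendreCurve I γ₁ γ₂) (hI : IsOpen I)
    (hI' : I.OrdConnected) (hn₁ : n₁ ≠ 0 → ∀ t ∈ I, γ₁ t ≠ 0)
    (hn₂ : n₂ ≠ 0 → ∀ t ∈ I, γ₂ t ≠ 0) :
    (∀ t ∈ I, deriv (curvatureCoeff n₁ n₂ γ₁ γ₂) t +
        curvatureCoeff n₁ n₂ γ₁ γ₂ t * (legendreLogDeriv n₁ n₂ γ₁ γ₂ t).re = 0) ↔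
      ∃ c, ∀ t ∈ I, angleSpeed n₁ n₂ γ₁ γ₂ t = c := by
  have hd : ∀ t ∈ I, _ := fun t ht => (h.legendreNear hI ht).hasDerivAt_angleSpeed
    (fun h0 => hn₁ h0 t ht) (fun h0 => hn₂ h0 t ht)
  constructor
  · intro h0
    refine hI.exists_is_const_of_deriv_eq_zero hI'.isPreconnected
      (fun t ht => (hd t ht).differentiableAt.differentiableWithinAt) fun t ht => ?_
    rw [(hd t ht).deriv, h0 t ht, mul_zero, Pi.zero_apply]
  · rintro ⟨c, hc⟩ t ht
    have e : angleSpeed n₁ n₂ γ₁ γ₂ =ᶠ[𝓝 t] fun _ => c := by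
      filter_upwards [hI.eventually_mem ht] with s hs using hc s hs
    have e' := (hd t ht).deriv.symm.trans e.deriv_eq
    rw [deriv_const] at e'
    exact (mul_eq_zero.1 e').resolve_left (norm_ne_zero_iff.2
      ((h.legendreNear hI ht).legendreAngleFun_ne_zero (fun h0 => hn₁ h0 t ht)
        (fun h0 => hn₂ h0 t ht)))

/-- The condition for C-minimality and the equation, for the parameter with speed
`|γ₁| ^ n₁ |γ₂| ^ n₂`. -/
lemma forall_deriv_curvatureCoeff_iff_exists_solvesODE (h : IsLegendreCurve I γ₁ γ₂)
    (hI : IsOpen I) (hI' : I.OrdConnected) (hne : I.Nonempty)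
    (hn₁ : n₁ ≠ 0 → ∀ t ∈ I, γ₁ t ≠ 0) (hn₂ : n₂ ≠ 0 → ∀ t ∈ I, γ₂ t ≠ 0)
    (hs : ∀ t ∈ I, ‖legendreDet γ₁ γ₂ t‖ = ‖γ₁ t‖ ^ n₁ * ‖γ₂ t‖ ^ n₂) :
    (∀ t ∈ I, deriv (curvatureCoeff n₁ n₂ γ₁ γ₂) t +
        curvatureCoeff n₁ n₂ γ₁ γ₂ t * (legendreLogDeriv n₁ n₂ γ₁ γ₂ t).re = 0) ↔
      ∃ l m : ℝ, SolvesODE n₁ n₂ l m I γ₁ γ₂ := by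
  -- The constant value of `angleSpeed` is the parameter m of the equation.
  rw [h.forall_deriv_curvatureCoeff_iff hI hI' hn₁ hn₂, exists_comm]
  refine exists_congr fun m => ?_
  rw [h.exists_solvesODE_iff hI hI' hne hn₁ hn₂ hs m]
  refine forall₂_congr fun t ht => ?_
  rw [(h.legendreNear hI ht).angleSpeed_eq (hs t ht)]

end IsLegendreCurve

end LegendreCurve

/-! ### Changes of parameter and the normalized parameter. -/

section Reparametrization

/-- The inverse of a smooth injective function with nonvanishing derivative is a change of
parameter. -/
lemma exists_isReparametrization_of_injOn {S : ℝ → ℝ} {I : Set ℝ} (hI : IsOpen I)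
    (hI' : I.OrdConnected) (hS : ContDiffOn ℝ ∞ S I) (hS' : ∀ t ∈ I, deriv S t ≠ 0)
    (hinj : Set.InjOn S I) :
    ∃ (J : Set ℝ) (h : ℝ → ℝ), IsReparametrization h J I ∧
      ∀ s ∈ J, HasDerivAt h (deriv S (h s))⁻¹ s := by
  have hc : ∀ t ∈ I, ContDiffAt ℝ ∞ S t := fun t ht => (hS t ht).contDiffAt (hI.mem_nhds ht)
  have hd : ∀ t ∈ I, HasDerivAt S (deriv S t) t := fun t ht =>
    ((hc t ht).differentiableAt (by simp)).hasDerivAt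
  -- A nonzero strict derivative makes S open, so S is a homeomorphism onto an open set, and
  -- smoothness of its inverse is local.
  have hmap : IsOpenMap (I.domRestrict S) := by
    rw [isOpenMap_iff_nhds_le]
    intro x
    have h1 : HasStrictDerivAt S (deriv S x) x := (hc x x.2).hasStrictDerivAt (by simp)
    have h2 : map (I.domRestrict S) (𝓝 x) = map S (map Subtype.val (𝓝 x)) := by
      rw [Filter.map_map]; rfl
    rw [h2, hI.isOpenEmbedding_subtypeVal.map_nhds_eq, h1.map_nhds_eq (hS' x x.2)]
    rfl
  let e : OpenPartialHomeomorph ℝ ℝ := OpenPartialHomeomorph.ofContinuousOpenRestrict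
    (hinj.toPartialEquiv S I) hS.continuousOn hmap hI
  have he : ∀ t, e t = S t := fun t => rfl
  have hsrc : e.source = I := rfl
  have hsymm : ∀ s ∈ e.target, e.symm s ∈ I := fun s hs => e.map_target hs
  have hder : ∀ s ∈ e.target, HasDerivAt e.symm (deriv S (e.symm s))⁻¹ s := fun s hs =>
    e.hasDerivAt_symm hs (hS' _ (hsymm s hs)) (hd _ (hsymm s hs))
  refine ⟨e.target, e.symm, ⟨e.open_target, ?_, ?_, ?_, ?_⟩, hder⟩
  · rw [← e.image_source_eq_target]
    exact (hI'.isPreconnected.image _ hS.continuousOn).ordConnected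
  · intro s hs
    exact (e.contDiffAt_symm_deriv (hS' _ (hsymm s hs)) hs (hd _ (hsymm s hs))
      (hc _ (hsymm s hs))).contDiffWithinAt
  · intro s hs
    rw [(hder s hs).deriv]
    exact inv_ne_zero (hS' _ (hsymm s hs))
  · exact e.symm.bijOn

/-- A change of parameter with prescribed positive smooth derivative of the inverse. -/
lemma exists_isReparametrization_of_pos {σ : ℝ → ℝ} {I : Set ℝ} (hI : IsOpen I)
    (hI' : I.OrdConnected) (hne : I.Nonempty) (hσ : ContDiffOn ℝ ∞ σ I) (hpos : ∀ t ∈ I, 0 < σ t) :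
    ∃ (J : Set ℝ) (h : ℝ → ℝ), IsReparametrization h J I ∧
      ∀ s ∈ J, HasDerivAt h (σ (h s))⁻¹ s := by
  obtain ⟨t₀, ht₀⟩ := hne
  let S : ℝ → ℝ := fun t => ∫ r in t₀..t, σ r
  have hd : ∀ t ∈ I, HasDerivAt S (σ t) t := by
    intro t ht
    refine intervalIntegral.integral_hasDerivAt_right ?_ ?_ ?_
    · exact (hσ.continuousOn.mono (hI'.uIcc_subset ht₀ ht)).intervalIntegrable
    · exact hσ.continuousOn.stronglyMeasurableAtFilter hI t ht
    · exact hσ.continuousOn.continuousAt (hI.mem_nhds ht)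
  have hdS : ∀ t ∈ I, deriv S t = σ t := fun t ht => (hd t ht).deriv
  have hS : ContDiffOn ℝ ∞ S I := by
    rw [contDiffOn_infty_iff_deriv_of_isOpen hI]
    exact ⟨fun t ht => (hd t ht).differentiableAt.differentiableWithinAt, hσ.congr hdS⟩
  have hmono : StrictMonoOn S I := by
    refine strictMonoOn_of_deriv_pos hI'.convex hS.continuousOn fun t ht => ?_
    rw [hI.interior_eq] at ht
    rw [hdS t ht]
    exact hpos t ht
  obtain ⟨J, h, hJ, hh⟩ := exists_isReparametrization_of_injOn hI hI' hS
    (fun t ht => by rw [hdS t ht]; exact (hpos t ht).ne') hmono.injOn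
  refine ⟨J, h, hJ, fun s hs => ?_⟩
  rw [← hdS _ (hJ.bijOn.mapsTo hs)]
  exact hh s hs

variable {I J : Set ℝ} {γ₁ γ₂ : ℝ → ℂ} {h : ℝ → ℝ} {n₁ n₂ : ℕ}

namespace IsReparametrization

lemma contDiffAt (hh : IsReparametrization h J I) {s : ℝ} (hs : s ∈ J) : ContDiffAt ℝ ∞ h s :=
  (hh.smooth s hs).contDiffAt (hh.isOpen.mem_nhds hs)

lemma hasDerivAt (hh : IsReparametrization h J I) {s : ℝ} (hs : s ∈ J) :
    HasDerivAt h (deriv h s) s :=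
  ((hh.contDiffAt hs).differentiableAt (by simp)).hasDerivAt

lemma mem (hh : IsReparametrization h J I) {s : ℝ} (hs : s ∈ J) : h s ∈ I := hh.bijOn.mapsTo hs

lemma hasDerivAt_comp (hh : IsReparametrization h J I) (hI : IsOpen I) {γ : ℝ → ℂ}
    (hγ : ContDiffOn ℝ ∞ γ I) {s : ℝ} (hs : s ∈ J) :
    HasDerivAt (γ ∘ h) ((deriv h s : ℝ) * deriv γ (h s)) s := by
  have h1 : HasDerivAt γ (deriv γ (h s)) (h s) :=
    (((hγ _ (hh.mem hs)).contDiffAt (hI.mem_nhds (hh.mem hs))).differentiableAt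
      (by simp)).hasDerivAt
  have h2 := h1.scomp s (hh.hasDerivAt hs)
  rwa [Complex.real_smul] at h2

lemma nonempty (hh : IsReparametrization h J I) (hne : I.Nonempty) : J.Nonempty := by
  obtain ⟨t, ht⟩ := hne
  obtain ⟨s, hs, -⟩ := hh.bijOn.surjOn ht
  exact ⟨s, hs⟩

lemma isLegendreCurve (hh : IsReparametrization h J I) (hI : IsOpen I)
    (hγ : IsLegendreCurve I γ₁ γ₂) : IsLegendreCurve J (γ₁ ∘ h) (γ₂ ∘ h) where
  smooth₁ := hγ.smooth₁.comp hh.smooth hh.bijOn.mapsTo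
  smooth₂ := hγ.smooth₂.comp hh.smooth hh.bijOn.mapsTo
  sphere s hs := hγ.sphere _ (hh.mem hs)
  regular s hs := by
    rw [(hh.hasDerivAt_comp hI hγ.smooth₁ hs).deriv, (hh.hasDerivAt_comp hI hγ.smooth₂ hs).deriv]
    have h1 : ((deriv h s : ℝ) : ℂ) ≠ 0 := by exact_mod_cast hh.deriv_ne_zero s hs
    exact (hγ.regular _ (hh.mem hs)).imp (mul_ne_zero h1) (mul_ne_zero h1)
  legendre s hs := by
    rw [(hh.hasDerivAt_comp hI hγ.smooth₁ hs).deriv, (hh.hasDerivAt_comp hI hγ.smooth₂ hs).deriv,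
      ← Complex.real_smul, ← Complex.real_smul, real_inner_smul_left, real_inner_smul_left,
      ← mul_add]
    exact mul_eq_zero_of_right _ (hγ.legendre _ (hh.mem hs))

lemma legendreDet_comp (hh : IsReparametrization h J I) (hI : IsOpen I)
    (hγ : IsLegendreCurve I γ₁ γ₂) {s : ℝ} (hs : s ∈ J) :
    legendreDet (γ₁ ∘ h) (γ₂ ∘ h) s = (deriv h s : ℝ) * legendreDet γ₁ γ₂ (h s) := by
  rw [legendreDet, legendreDet, (hh.hasDerivAt_comp hI hγ.smooth₁ hs).deriv,
    (hh.hasDerivAt_comp hI hγ.smooth₂ hs).deriv, Function.comp_apply, Function.comp_apply]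
  ring

lemma legendreAngleFun_comp (hh : IsReparametrization h J I) (hI : IsOpen I)
    (hγ : IsLegendreCurve I γ₁ γ₂) {s : ℝ} (hs : s ∈ J) :
    legendreAngleFun n₁ n₂ (γ₁ ∘ h) (γ₂ ∘ h) s =
      (deriv h s : ℝ) * legendreAngleFun n₁ n₂ γ₁ γ₂ (h s) := by
  rw [legendreAngleFun, legendreAngleFun, hh.legendreDet_comp hI hγ hs, Function.comp_apply,
    Function.comp_apply]
  ring

/-- The function g becomes h'·(g ∘ h), so ω becomes h''/h' + h'·(ω ∘ h), and the first term is real.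
-/
lemma legendreLogDeriv_im_comp (hh : IsReparametrization h J I) (hI : IsOpen I)
    (hγ : IsLegendreCurve I γ₁ γ₂) (hn₁ : n₁ ≠ 0 → ∀ t ∈ I, γ₁ t ≠ 0)
    (hn₂ : n₂ ≠ 0 → ∀ t ∈ I, γ₂ t ≠ 0) {s : ℝ} (hs : s ∈ J) :
    (legendreLogDeriv n₁ n₂ (γ₁ ∘ h) (γ₂ ∘ h) s).im =
      deriv h s * (legendreLogDeriv n₁ n₂ γ₁ γ₂ (h s)).im := by
  have hm := hh.mem hs
  have d1 := ((hh.isLegendreCurve hI hγ).legendreNear hh.isOpen hs).hasDerivAt_legendreAngleFun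
    (n₁ := n₁) (n₂ := n₂) (fun h0 => hn₁ h0 _ hm) (fun h0 => hn₂ h0 _ hm)
  have d2 := (hγ.legendreNear hI hm).hasDerivAt_legendreAngleFun
    (n₁ := n₁) (n₂ := n₂) (fun h0 => hn₁ h0 _ hm) (fun h0 => hn₂ h0 _ hm)
  have hg := (hγ.legendreNear hI hm).legendreAngleFun_ne_zero
    (n₁ := n₁) (n₂ := n₂) (fun h0 => hn₁ h0 _ hm) (fun h0 => hn₂ h0 _ hm)
  have d3 := d2.scomp s (hh.hasDerivAt hs)
  have d4 : HasDerivAt (deriv h) (deriv (deriv h) s) s :=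
    (((hh.contDiffAt hs).fderiv_right (m := ∞) le_rfl).clm_apply contDiffAt_const
      |>.differentiableAt (by simp)).hasDerivAt
  have d5 := d4.ofReal_comp.mul d3
  have e : legendreAngleFun n₁ n₂ (γ₁ ∘ h) (γ₂ ∘ h) =ᶠ[𝓝 s]
      (fun r => ((deriv h r : ℝ) : ℂ)) * (legendreAngleFun n₁ n₂ γ₁ γ₂ ∘ h) := by
    filter_upwards [hh.isOpen.eventually_mem hs] with r hr
    exact hh.legendreAngleFun_comp hI hγ hr
  have d6 := (d5.congr_of_eventuallyEq e).unique d1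
  rw [hh.legendreAngleFun_comp hI hγ hs, Complex.real_smul, Function.comp_apply] at d6
  have h0 := hh.deriv_ne_zero s hs
  have h1 : (legendreLogDeriv n₁ n₂ (γ₁ ∘ h) (γ₂ ∘ h) s) * (deriv h s : ℝ) =
      ((deriv (deriv h) s : ℝ) : ℂ) +
        ((deriv h s * deriv h s : ℝ) : ℂ) * legendreLogDeriv n₁ n₂ γ₁ γ₂ (h s) := by
    apply mul_right_cancel₀ hg
    push_cast
    linear_combination -d6
  have h2 := congrArg Complex.im h1
  rw [Complex.im_mul_ofReal, Complex.add_im, Complex.ofReal_im, Complex.im_ofReal_mul] at h2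
  apply mul_right_cancel₀ h0
  linear_combination h2

/-- Im ω scales by h', |γ'|² by h'² and |g| by |h'|, so only the sign of h' survives. -/
lemma angleSpeed_comp (hh : IsReparametrization h J I) (hI : IsOpen I)
    (hγ : IsLegendreCurve I γ₁ γ₂) (hn₁ : n₁ ≠ 0 → ∀ t ∈ I, γ₁ t ≠ 0)
    (hn₂ : n₂ ≠ 0 → ∀ t ∈ I, γ₂ t ≠ 0) {s : ℝ} (hs : s ∈ J) :
    angleSpeed n₁ n₂ (γ₁ ∘ h) (γ₂ ∘ h) s =
      deriv h s / |deriv h s| * angleSpeed n₁ n₂ γ₁ γ₂ (h s) := by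
  have h0 := abs_ne_zero.2 (hh.deriv_ne_zero s hs)
  have h1 := norm_ne_zero_iff.2 (hγ.legendreNear hI (hh.mem hs)).legendreDet_ne_zero
  rw [angleSpeed, angleSpeed, curvatureCoeff, curvatureCoeff,
    hh.legendreLogDeriv_im_comp hI hγ hn₁ hn₂ hs, hh.legendreAngleFun_comp hI hγ hs,
    ((hh.isLegendreCurve hI hγ).legendreNear hh.isOpen hs).speedSq_eq,
    (hγ.legendreNear hI (hh.mem hs)).speedSq_eq, hh.legendreDet_comp hI hγ hs, norm_mul, norm_mul,
    Complex.norm_real, Real.norm_eq_abs]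
  field_simp

lemma exists_angleSpeed_eq_iff (hh : IsReparametrization h J I) (hI : IsOpen I)
    (hγ : IsLegendreCurve I γ₁ γ₂) (hn₁ : n₁ ≠ 0 → ∀ t ∈ I, γ₁ t ≠ 0)
    (hn₂ : n₂ ≠ 0 → ∀ t ∈ I, γ₂ t ≠ 0) :
    (∃ c, ∀ s ∈ J, angleSpeed n₁ n₂ (γ₁ ∘ h) (γ₂ ∘ h) s = c) ↔
      ∃ c, ∀ t ∈ I, angleSpeed n₁ n₂ γ₁ γ₂ t = c := by
  -- By Darboux's theorem, h' has constant sign on the interval.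
  obtain ⟨ε, hε, hs⟩ : ∃ ε : ℝ, ε * ε = 1 ∧ ∀ s ∈ J, deriv h s / |deriv h s| = ε := by
    rcases hasDerivWithinAt_forall_lt_or_forall_gt_of_forall_ne hh.ordConnected.convex
      (fun s hs => (hh.hasDerivAt hs).hasDerivWithinAt) hh.deriv_ne_zero with h1 | h1
    · refine ⟨-1, by norm_num, fun s hs => ?_⟩
      rw [abs_of_neg (h1 s hs), div_neg, div_self (h1 s hs).ne]
    · refine ⟨1, by norm_num, fun s hs => ?_⟩
      rw [abs_of_pos (h1 s hs), div_self (h1 s hs).ne']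
  constructor
  · rintro ⟨c, hc⟩
    refine ⟨ε * c, fun t ht => ?_⟩
    obtain ⟨s, hsJ, rfl⟩ := hh.bijOn.surjOn ht
    rw [← hc s hsJ, hh.angleSpeed_comp hI hγ hn₁ hn₂ hsJ, hs s hsJ, ← mul_assoc, hε, one_mul]
  · rintro ⟨c, hc⟩
    refine ⟨ε * c, fun s hsJ => ?_⟩
    rw [hh.angleSpeed_comp hI hγ hn₁ hn₂ hsJ, hs s hsJ, hc _ (hh.mem hsJ)]

lemma forall_legendreLogDeriv_im_iff (hh : IsReparametrization h J I) (hI : IsOpen I)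
    (hγ : IsLegendreCurve I γ₁ γ₂) (hn₁ : n₁ ≠ 0 → ∀ t ∈ I, γ₁ t ≠ 0)
    (hn₂ : n₂ ≠ 0 → ∀ t ∈ I, γ₂ t ≠ 0) :
    (∀ s ∈ J, (legendreLogDeriv n₁ n₂ (γ₁ ∘ h) (γ₂ ∘ h) s).im = 0) ↔
      ∀ t ∈ I, (legendreLogDeriv n₁ n₂ γ₁ γ₂ t).im = 0 := by
  constructor
  · intro h0 t ht
    obtain ⟨s, hsJ, rfl⟩ := hh.bijOn.surjOn ht
    have := h0 s hsJ
    rw [hh.legendreLogDeriv_im_comp hI hγ hn₁ hn₂ hsJ] at this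
    exact (mul_eq_zero.1 this).resolve_left (hh.deriv_ne_zero s hsJ)
  · intro h0 s hsJ
    rw [hh.legendreLogDeriv_im_comp hI hγ hn₁ hn₂ hsJ, h0 _ (hh.mem hsJ), mul_zero]

end IsReparametrization

namespace IsLegendreCurve

/-- Every Legendre curve has a parameter with speed `|γ₁| ^ n₁ |γ₂| ^ n₂`. -/
lemma exists_isReparametrization (hγ : IsLegendreCurve I γ₁ γ₂) (hI : IsOpen I)
    (hI' : I.OrdConnected) (hne : I.Nonempty) (hn₁ : n₁ ≠ 0 → ∀ t ∈ I, γ₁ t ≠ 0)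
    (hn₂ : n₂ ≠ 0 → ∀ t ∈ I, γ₂ t ≠ 0) :
    ∃ (J : Set ℝ) (h : ℝ → ℝ), IsReparametrization h J I ∧ ∀ s ∈ J,
      ‖legendreDet (γ₁ ∘ h) (γ₂ ∘ h) s‖ = ‖(γ₁ ∘ h) s‖ ^ n₁ * ‖(γ₂ ∘ h) s‖ ^ n₂ := by
  have hpow : ∀ {n : ℕ} {γ : ℝ → ℂ}, ContDiffOn ℝ ∞ γ I → (n ≠ 0 → ∀ t ∈ I, γ t ≠ 0) →
      ContDiffOn ℝ ∞ (fun t => ‖γ t‖ ^ n) I ∧ ∀ t ∈ I, 0 < ‖γ t‖ ^ n := by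
    intro n γ hs hn
    rcases eq_or_ne n 0 with rfl | h0
    · simpa using contDiffOn_const
    · exact ⟨(hs.norm ℝ (hn h0)).pow n, fun t ht => pow_pos (norm_pos_iff.2 (hn h0 t ht)) n⟩
  obtain ⟨s₁, p₁⟩ := hpow hγ.smooth₁ hn₁
  obtain ⟨s₂, p₂⟩ := hpow hγ.smooth₂ hn₂
  have hd0 : ∀ t ∈ I, legendreDet γ₁ γ₂ t ≠ 0 := fun t ht =>
    (hγ.legendreNear hI ht).legendreDet_ne_zero
  have hds : ContDiffOn ℝ ∞ (legendreDet γ₁ γ₂) I := fun t ht =>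
    (((hγ.legendreNear hI ht).contDiffAt₁.mul (hγ.legendreNear hI ht).contDiffAt₂.deriv_real).sub
      ((hγ.legendreNear hI ht).contDiffAt₂.mul
        (hγ.legendreNear hI ht).contDiffAt₁.deriv_real)).contDiffWithinAt
  have hp : ∀ t ∈ I, 0 < ‖γ₁ t‖ ^ n₁ * ‖γ₂ t‖ ^ n₂ := fun t ht => mul_pos (p₁ t ht) (p₂ t ht)
  -- The new parameter has derivative σ = |γ'| / (|γ₁|^n₁ |γ₂|^n₂) in the old one, so the new speed
  -- is |γ'|/σ.
  obtain ⟨J, h, hJ, hh⟩ := exists_isReparametrization_of_pos hI hI' hne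
    (σ := fun t => ‖legendreDet γ₁ γ₂ t‖ / (‖γ₁ t‖ ^ n₁ * ‖γ₂ t‖ ^ n₂))
    ((hds.norm ℝ hd0).div (s₁.mul s₂) fun t ht => (hp t ht).ne')
    (fun t ht => div_pos (norm_pos_iff.2 (hd0 t ht)) (hp t ht))
  refine ⟨J, h, hJ, fun s hs => ?_⟩
  have h1 := hp _ (hJ.mem hs)
  have h2 := norm_pos_iff.2 (hd0 _ (hJ.mem hs))
  rw [hJ.legendreDet_comp hI hγ hs, norm_mul, (hh s hs).deriv, Complex.norm_real, Real.norm_eq_abs,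
    abs_of_pos (inv_pos.2 (div_pos h2 h1)), inv_div, div_mul_cancel₀ _ h2.ne']
  rfl

/-- The condition for C-minimality, up to a change of parameter. -/
theorem forall_deriv_curvatureCoeff_iff_exists_reparametrization (hγ : IsLegendreCurve I γ₁ γ₂)
    (hI : IsOpen I) (hI' : I.OrdConnected) (hne : I.Nonempty)
    (hn₁ : n₁ ≠ 0 → ∀ t ∈ I, γ₁ t ≠ 0) (hn₂ : n₂ ≠ 0 → ∀ t ∈ I, γ₂ t ≠ 0) :
    (∀ t ∈ I, deriv (curvatureCoeff n₁ n₂ γ₁ γ₂) t +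
        curvatureCoeff n₁ n₂ γ₁ γ₂ t * (legendreLogDeriv n₁ n₂ γ₁ γ₂ t).re = 0) ↔
      ∃ (J : Set ℝ) (h : ℝ → ℝ), IsReparametrization h J I ∧
        ∃ l m : ℝ, SolvesODE n₁ n₂ l m J (γ₁ ∘ h) (γ₂ ∘ h) := by
  -- The equivalence holds in every normalized parameter. Such a parameter exists for the forward
  -- direction, and the equation itself provides one for the converse.
  have key : ∀ {J : Set ℝ} {h : ℝ → ℝ}, IsReparametrization h J I →
      (∀ s ∈ J, ‖legendreDet (γ₁ ∘ h) (γ₂ ∘ h) s‖ =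
        ‖(γ₁ ∘ h) s‖ ^ n₁ * ‖(γ₂ ∘ h) s‖ ^ n₂) →
      ((∀ t ∈ I, deriv (curvatureCoeff n₁ n₂ γ₁ γ₂) t +
        curvatureCoeff n₁ n₂ γ₁ γ₂ t * (legendreLogDeriv n₁ n₂ γ₁ γ₂ t).re = 0) ↔
        ∃ l m : ℝ, SolvesODE n₁ n₂ l m J (γ₁ ∘ h) (γ₂ ∘ h)) := by
    intro J h hJ hs
    have hL := hJ.isLegendreCurve hI hγ
    have m₁ : n₁ ≠ 0 → ∀ s ∈ J, (γ₁ ∘ h) s ≠ 0 := fun h0 s hs => hn₁ h0 _ (hJ.mem hs)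
    have m₂ : n₂ ≠ 0 → ∀ s ∈ J, (γ₂ ∘ h) s ≠ 0 := fun h0 s hs => hn₂ h0 _ (hJ.mem hs)
    rw [← hL.forall_deriv_curvatureCoeff_iff_exists_solvesODE hJ.isOpen hJ.ordConnected
      (hJ.nonempty hne) m₁ m₂ hs, hγ.forall_deriv_curvatureCoeff_iff hI hI' hn₁ hn₂,
      hL.forall_deriv_curvatureCoeff_iff hJ.isOpen hJ.ordConnected m₁ m₂,
      hJ.exists_angleSpeed_eq_iff hI hγ hn₁ hn₂]
  constructor
  · intro h0
    obtain ⟨J, h, hJ, hs⟩ := hγ.exists_isReparametrization hI hI' hne hn₁ hn₂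
    exact ⟨J, h, hJ, (key hJ hs).1 h0⟩
  · rintro ⟨J, h, hJ, l, m, hlm⟩
    exact (key hJ fun s hs => (hJ.isLegendreCurve hI hγ).norm_legendreDet_of_solvesODE hJ.isOpen
      hlm hs).2 ⟨l, m, hlm⟩

/-- The condition for minimality, up to a change of parameter. -/
theorem forall_legendreLogDeriv_im_iff_exists_reparametrization (hγ : IsLegendreCurve I γ₁ γ₂)
    (hI : IsOpen I) (hI' : I.OrdConnected) (hne : I.Nonempty)
    (hn₁ : n₁ ≠ 0 → ∀ t ∈ I, γ₁ t ≠ 0) (hn₂ : n₂ ≠ 0 → ∀ t ∈ I, γ₂ t ≠ 0) :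
    (∀ t ∈ I, (legendreLogDeriv n₁ n₂ γ₁ γ₂ t).im = 0) ↔
      ∃ (J : Set ℝ) (h : ℝ → ℝ), IsReparametrization h J I ∧
        ∃ l : ℝ, SolvesODE n₁ n₂ l 0 J (γ₁ ∘ h) (γ₂ ∘ h) := by
  have key : ∀ {J : Set ℝ} {h : ℝ → ℝ}, IsReparametrization h J I →
      (∀ s ∈ J, ‖legendreDet (γ₁ ∘ h) (γ₂ ∘ h) s‖ =
        ‖(γ₁ ∘ h) s‖ ^ n₁ * ‖(γ₂ ∘ h) s‖ ^ n₂) →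
      ((∀ t ∈ I, (legendreLogDeriv n₁ n₂ γ₁ γ₂ t).im = 0) ↔
        ∃ l : ℝ, SolvesODE n₁ n₂ l 0 J (γ₁ ∘ h) (γ₂ ∘ h)) := by
    intro J h hJ hs
    have hL := hJ.isLegendreCurve hI hγ
    rw [hL.exists_solvesODE_iff hJ.isOpen hJ.ordConnected (hJ.nonempty hne)
      (fun h0 s hs => hn₁ h0 _ (hJ.mem hs)) (fun h0 s hs => hn₂ h0 _ (hJ.mem hs)) hs,
      hJ.forall_legendreLogDeriv_im_iff hI hγ hn₁ hn₂]
  constructor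
  · intro h0
    obtain ⟨J, h, hJ, hs⟩ := hγ.exists_isReparametrization hI hI' hne hn₁ hn₂
    exact ⟨J, h, hJ, (key hJ hs).1 h0⟩
  · rintro ⟨J, h, hJ, l, hl⟩
    exact (key hJ fun s hs => (hJ.isLegendreCurve hI hγ).norm_legendreDet_of_solvesODE hJ.isOpen
      hl hs).2 ⟨l, hl⟩

end IsLegendreCurve

end Reparametrization

/-! ### Passage between immersed manifolds and coordinates. -/

section Charts

attribute [local instance] InnerProductSpace.complexToReal

variable {E : Type*} [NormedAddCommGroup E] [NormedSpace ℝ E] {H : Type*} [TopologicalSpace H]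
  {I : ModelWithCorners ℝ E H} [I.Boundaryless]
variable {M : Type*} [TopologicalSpace M] [ChartedSpace H M]
variable {V : Type*} [NormedAddCommGroup V] [InnerProductSpace ℂ V]

/-- A Legendrian immersion is Legendrian in charts. -/
lemma IsLegendrianImmersion.legendrianNear [IsManifold I ∞ M] {ψ : M → V}
    (h : IsLegendrianImmersion I ψ) (p : M) :
    LegendrianNear (ψ ∘ (extChartAt I p).symm) (extChartAt I p p) := by
  have : IsManifold I 1 M := IsManifold.of_le (n := ∞) (by simp)
  filter_upwards [extChartAt_target_mem_nhds (I := I) p] with y hy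
  have hn := (isOpen_extChartAt_target (I := I) p).mem_nhds hy
  have hsymm : ContMDiffAt 𝓘(ℝ, E) I ∞ (extChartAt I p).symm y :=
    (contMDiffOn_extChartAt_symm p).contMDiffAt hn
  have hψ : ContMDiffAt I 𝓘(ℝ, V) ∞ ψ ((extChartAt I p).symm y) := h.smooth _
  have hd : ∀ v, fderiv ℝ (ψ ∘ (extChartAt I p).symm) y v =
      mfderiv I 𝓘(ℝ, V) ψ ((extChartAt I p).symm y)
        (mfderiv 𝓘(ℝ, E) I (extChartAt I p).symm y v) := by
    intro v
    rw [← mfderiv_eq_fderiv, mfderiv_comp y (hψ.mdifferentiableAt (by simp))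
      (hsymm.mdifferentiableAt (by simp))]
    rfl
  refine ⟨(hψ.comp y hsymm).contDiffAt, h.norm_eq_one _, fun v w hvw => ?_, fun v => ?_⟩
  · rw [hd, hd] at hvw
    -- The inverse chart has invertible differential at every point of its target, so injectivity
    -- holds near the base point and not only at it.
    have hi := isInvertible_mfderivWithin_extChartAt_symm (I := I) hy
    rw [I.range_eq_univ, mfderivWithin_univ] at hi
    exact hi.injective (h.injective _ hvw)
  · rw [hd]
    exact h.legendrian _ _

/-- A map that is Legendrian in charts is a Legendrian immersion. -/
lemma isLegendrianImmersion_of_legendrianNear {φ : M → V}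
    (h : ∀ p, LegendrianNear (φ ∘ (extChartAt I p).symm) (extChartAt I p p)) :
    IsLegendrianImmersion I φ := by
  have hs : ContMDiff I 𝓘(ℝ, V) ∞ φ := by
    intro p
    rw [contMDiffAt_iff]
    refine ⟨?_, by
      rw [extChartAt_model_space_eq_id]
      exact (h p).contDiffAt.contDiffWithinAt⟩
    have h1 : ContinuousAt ((φ ∘ (extChartAt I p).symm) ∘ extChartAt I p) p :=
      (h p).contDiffAt.continuousAt.comp (continuousAt_extChartAt p)
    refine h1.congr ?_
    filter_upwards [extChartAt_source_mem_nhds (I := I) p] with y hy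
    simp only [Function.comp_apply, (extChartAt I p).left_inv hy]
  have hd : ∀ p, mfderiv I 𝓘(ℝ, V) φ p =
      fderiv ℝ (φ ∘ (extChartAt I p).symm) (extChartAt I p p) := by
    intro p
    rw [((hs p).mdifferentiableAt (by simp)).mfderiv, I.range_eq_univ, fderivWithin_univ]
    rfl
  have hp : ∀ p, (φ ∘ (extChartAt I p).symm) (extChartAt I p p) = φ p := fun p => by
    simp
  refine ⟨hs, fun p => ?_, fun p => ?_, fun p v => ?_⟩
  · rw [← hp p]
    exact (h p).self_of_nhds.2.1
  · rw [hd]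
    exact (h p).injective
  · rw [hd, ← hp p]
    exact (h p).self_of_nhds.2.2.2 v

end Charts

/-! ### The product of manifolds, in the chart given by the product of charts. -/

section Main

attribute [local instance] InnerProductSpace.complexToReal

variable {V₁ V₂ : Type*} [NormedAddCommGroup V₁] [InnerProductSpace ℂ V₁]
  [NormedAddCommGroup V₂] [InnerProductSpace ℂ V₂]

/-- The inclusion of the first summand of a hermitian sum. -/
def sumInl : V₁ →ₗᵢ[ℂ] WithLp 2 (V₁ × V₂) where
  toFun x := WithLp.toLp 2 (x, 0)
  map_add' x y := by simp [← WithLp.toLp_add]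
  map_smul' c x := by simp [← WithLp.toLp_smul]
  norm_map' x := by simp

/-- The inclusion of the second summand of a hermitian sum. -/
def sumInr : V₂ →ₗᵢ[ℂ] WithLp 2 (V₁ × V₂) where
  toFun x := WithLp.toLp 2 (0, x)
  map_add' x y := by simp [← WithLp.toLp_add]
  map_smul' c x := by simp [← WithLp.toLp_smul]
  norm_map' x := by simp

lemma inner_sumInl_sumInr (x : V₁) (y : V₂) :
    inner ℂ (sumInl x : WithLp 2 (V₁ × V₂)) (sumInr y) = (0 : ℂ) := by
  rw [WithLp.prod_inner_apply]
  simp [sumInl, sumInr]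

lemma sumInl_add_sumInr (x : V₁) (y : V₂) :
    (sumInl x + sumInr y : WithLp 2 (V₁ × V₂)) = WithLp.toLp 2 (x, y) := by
  simp [sumInl, sumInr, ← WithLp.toLp_add]

variable {E₁ E₂ : Type*} [NormedAddCommGroup E₁] [NormedSpace ℝ E₁] [FiniteDimensional ℝ E₁]
  [NormedAddCommGroup E₂] [NormedSpace ℝ E₂] [FiniteDimensional ℝ E₂]
variable {H₁ H₂ : Type*} [TopologicalSpace H₁] [TopologicalSpace H₂]
  {I₁ : ModelWithCorners ℝ E₁ H₁} {I₂ : ModelWithCorners ℝ E₂ H₂}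
variable {N₁ N₂ : Type*} [TopologicalSpace N₁] [ChartedSpace H₁ N₁]
  [TopologicalSpace N₂] [ChartedSpace H₂ N₂]
variable {ψ₁ : N₁ → V₁} {ψ₂ : N₂ → V₂} {I : TopologicalSpace.Opens ℝ} {γ₁ γ₂ : ℝ → ℂ}

lemma extChartAt_opens_real_apply (t : I) : extChartAt 𝓘(ℝ, ℝ) t t = t := by
  simp [extChartAt, TopologicalSpace.Opens.chartAt_eq, OpenPartialHomeomorph.subtypeRestr_coe,
    chartAt_self_eq]

/-- The chart of the interval is the inclusion into ℝ, but its inverse is meaningful only on the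
interval, whence the local statement. -/
lemma coe_extChartAt_symm_opens_real (t : I) :
    ∀ᶠ s in 𝓝 (t : ℝ), (((extChartAt 𝓘(ℝ, ℝ) t).symm s : I) : ℝ) = s := by
  have h1 := extChartAt_target_mem_nhds (I := 𝓘(ℝ, ℝ)) t
  rw [extChartAt_opens_real_apply] at h1
  filter_upwards [h1] with s hs
  have h2 := (chartAt ℝ (t : ℝ)).subtypeRestr_symm_eqOn ⟨t⟩ (x := s)
    (by simpa [extChartAt, TopologicalSpace.Opens.chartAt_eq] using hs)
  simpa [extChartAt, TopologicalSpace.Opens.chartAt_eq, chartAt_self_eq] using h2.symm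

omit [FiniteDimensional ℝ E₁] [FiniteDimensional ℝ E₂] in
lemma extChartAt_product_apply (x : I × N₁ × N₂) :
    extChartAt (𝓘(ℝ, ℝ).prod (I₁.prod I₂)) x x =
      ((x.1 : ℝ), extChartAt I₁ x.2.1 x.2.1, extChartAt I₂ x.2.2 x.2.2) := by
  rw [extChartAt_prod, extChartAt_prod]
  exact Prod.ext (extChartAt_opens_real_apply _) rfl

omit [FiniteDimensional ℝ E₁] [FiniteDimensional ℝ E₂] in
/-- The product map in charts. -/
lemma legendrianProduct_comp_extChartAt_symm {φ : I × N₁ × N₂ → WithLp 2 (V₁ × V₂)}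
    (hφ : φ = legendrianProduct I γ₁ γ₂ ψ₁ ψ₂) (x : I × N₁ × N₂) :
    φ ∘ (extChartAt (𝓘(ℝ, ℝ).prod (I₁.prod I₂)) x).symm =ᶠ[
        𝓝 (extChartAt (𝓘(ℝ, ℝ).prod (I₁.prod I₂)) x x)]
      twistedSum sumInl sumInr γ₁ γ₂ (ψ₁ ∘ (extChartAt I₁ x.2.1).symm)
        (ψ₂ ∘ (extChartAt I₂ x.2.2).symm) := by
  rw [extChartAt_product_apply, extChartAt_prod, extChartAt_prod, hφ]
  have h1 : Tendsto (fun z : ℝ × E₁ × E₂ => z.1) (𝓝 ((x.1 : ℝ), extChartAt I₁ x.2.1 x.2.1,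
    extChartAt I₂ x.2.2 x.2.2)) (𝓝 (x.1 : ℝ)) := continuous_fst.continuousAt
  filter_upwards [h1.eventually (coe_extChartAt_symm_opens_real x.1)] with z hz
  simp only [legendrianProduct, twistedSum, Function.comp_apply, PartialEquiv.prod_symm,
    PartialEquiv.prod_coe, sumInl_add_sumInr, hz]

variable [I₁.Boundaryless] [I₂.Boundaryless] [IsManifold I₁ ∞ N₁] [IsManifold I₂ ∞ N₂]

omit [FiniteDimensional ℝ E₁] [FiniteDimensional ℝ E₂] in
lemma productData_of_isLegendrianImmersion (hψ₁ : IsLegendrianImmersion I₁ ψ₁)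
    (hψ₂ : IsLegendrianImmersion I₂ ψ₂) (hγ : IsLegendreCurve I γ₁ γ₂)
    (hn₁ : finrank ℝ E₁ ≠ 0 → ∀ t ∈ I, γ₁ t ≠ 0) (hn₂ : finrank ℝ E₂ ≠ 0 → ∀ t ∈ I, γ₂ t ≠ 0)
    (x : I × N₁ × N₂) :
    ProductData (sumInl : V₁ →ₗᵢ[ℂ] WithLp 2 (V₁ × V₂)) sumInr γ₁ γ₂
      (ψ₁ ∘ (extChartAt I₁ x.2.1).symm) (ψ₂ ∘ (extChartAt I₂ x.2.2).symm)
      ((x.1 : ℝ), extChartAt I₁ x.2.1 x.2.1, extChartAt I₂ x.2.2 x.2.2) where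
  orthogonal := inner_sumInl_sumInr
  curve := hγ.legendreNear I.isOpen x.1.2
  ne_zero₁ h0 := (I.isOpen.eventually_mem x.1.2).mono (hn₁ h0)
  ne_zero₂ h0 := (I.isOpen.eventually_mem x.1.2).mono (hn₂ h0)
  legendrian₁ := hψ₁.legendrianNear x.2.1
  legendrian₂ := hψ₂.legendrianNear x.2.2

theorem isLegendrianImmersion_legendrianProduct {φ : I × N₁ × N₂ → WithLp 2 (V₁ × V₂)}
    (hφ : φ = legendrianProduct I γ₁ γ₂ ψ₁ ψ₂) (hψ₁ : IsLegendrianImmersion I₁ ψ₁)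
    (hψ₂ : IsLegendrianImmersion I₂ ψ₂) (hγ : IsLegendreCurve I γ₁ γ₂)
    (hn₁ : finrank ℝ E₁ ≠ 0 → ∀ t ∈ I, γ₁ t ≠ 0) (hn₂ : finrank ℝ E₂ ≠ 0 → ∀ t ∈ I, γ₂ t ≠ 0) :
    IsLegendrianImmersion (𝓘(ℝ, ℝ).prod (I₁.prod I₂)) φ := by
  refine isLegendrianImmersion_of_legendrianNear fun x => ?_
  have h1 := (productData_of_isLegendrianImmersion hψ₁ hψ₂ hγ hn₁ hn₂ x).legendrianNear
  rw [← extChartAt_product_apply] at h1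
  filter_upwards [h1, (legendrianProduct_comp_extChartAt_symm (I₁ := I₁) (I₂ := I₂)
    hφ x).eventuallyEq_nhds] with y hy hy'
  rw [hy'.fderiv_eq, hy'.eq_of_nhds]
  exact ⟨hy.1.congr_of_eventuallyEq hy', hy.2⟩

/-- The pointwise condition separates into one on p, one on q and one on t; each is extracted by
choosing points in the other two factors. -/
theorem isMinimalImmersion_legendrianProduct_iff [Nonempty N₁] [Nonempty N₂]
    {φ : I × N₁ × N₂ → WithLp 2 (V₁ × V₂)}
    (hφ : φ = legendrianProduct I γ₁ γ₂ ψ₁ ψ₂)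
    (hI : (I : Set ℝ).Nonempty) (hψ₁ : IsLegendrianImmersion I₁ ψ₁)
    (hψ₂ : IsLegendrianImmersion I₂ ψ₂) (hγ : IsLegendreCurve I γ₁ γ₂)
    (hn₁ : finrank ℝ E₁ ≠ 0 → ∀ t ∈ I, γ₁ t ≠ 0) (hn₂ : finrank ℝ E₂ ≠ 0 → ∀ t ∈ I, γ₂ t ≠ 0) :
    IsMinimalImmersion (𝓘(ℝ, ℝ).prod (I₁.prod I₂)) φ ↔
      IsMinimalImmersion I₁ ψ₁ ∧ IsMinimalImmersion I₂ ψ₂ ∧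
        ∀ t ∈ (I : Set ℝ), (legendreLogDeriv (finrank ℝ E₁) (finrank ℝ E₂) γ₁ γ₂ t).im = 0 := by
  have key : ∀ x : I × N₁ × N₂, meanCurvature (𝓘(ℝ, ℝ).prod (I₁.prod I₂)) φ x = 0 ↔ meanCurvature I₁ ψ₁ x.2.1 = 0 ∧
        meanCurvature I₂ ψ₂ x.2.2 = 0 ∧
        (legendreLogDeriv (finrank ℝ E₁) (finrank ℝ E₂) γ₁ γ₂ x.1).im = 0 := by
    intro x
    unfold meanCurvature
    rw [meanCurvatureIn_congr
      (legendrianProduct_comp_extChartAt_symm (I₁ := I₁) (I₂ := I₂) hφ x), extChartAt_product_apply]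
    exact (productData_of_isLegendrianImmersion hψ₁ hψ₂ hγ hn₁ hn₂ x).meanCurvatureIn_eq_zero_iff
  obtain ⟨t₀, ht₀⟩ := hI
  obtain ⟨p₀⟩ := ‹Nonempty N₁›
  obtain ⟨q₀⟩ := ‹Nonempty N₂›
  simp only [IsMinimalImmersion, key]
  exact ⟨fun h => ⟨fun p => (h (⟨t₀, ht₀⟩, p, q₀)).1, fun q => (h (⟨t₀, ht₀⟩, p₀, q)).2.1,
    fun t ht => (h (⟨t, ht⟩, p₀, q₀)).2.2⟩,
    fun h x => ⟨h.1 x.2.1, h.2.1 x.2.2, h.2.2 x.1 x.1.2⟩⟩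

/-- C-minimality of the factors removes their terms from the divergence, and what remains depends on
t alone. -/
theorem isCMinimal_legendrianProduct_iff [Nonempty N₁] [Nonempty N₂]
    {φ : I × N₁ × N₂ → WithLp 2 (V₁ × V₂)}
    (hφ : φ = legendrianProduct I γ₁ γ₂ ψ₁ ψ₂)
    (hψ₁ : IsLegendrianImmersion I₁ ψ₁) (hψ₂ : IsLegendrianImmersion I₂ ψ₂)
    (hC₁ : IsCMinimal I₁ ψ₁) (hC₂ : IsCMinimal I₂ ψ₂) (hγ : IsLegendreCurve I γ₁ γ₂)
    (hn₁ : finrank ℝ E₁ ≠ 0 → ∀ t ∈ I, γ₁ t ≠ 0) (hn₂ : finrank ℝ E₂ ≠ 0 → ∀ t ∈ I, γ₂ t ≠ 0) :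
    IsCMinimal (𝓘(ℝ, ℝ).prod (I₁.prod I₂)) φ ↔
      ∀ t ∈ (I : Set ℝ), deriv (curvatureCoeff (finrank ℝ E₁) (finrank ℝ E₂) γ₁ γ₂) t +
        curvatureCoeff (finrank ℝ E₁) (finrank ℝ E₂) γ₁ γ₂ t *
          (legendreLogDeriv (finrank ℝ E₁) (finrank ℝ E₂) γ₁ γ₂ t).re = 0 := by
  have key : ∀ x : I × N₁ × N₂, divJH (𝓘(ℝ, ℝ).prod (I₁.prod I₂)) φ x = 0 ↔
      deriv (curvatureCoeff (finrank ℝ E₁) (finrank ℝ E₂) γ₁ γ₂) x.1 +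
        curvatureCoeff (finrank ℝ E₁) (finrank ℝ E₂) γ₁ γ₂ x.1 *
          (legendreLogDeriv (finrank ℝ E₁) (finrank ℝ E₂) γ₁ γ₂ x.1).re = 0 := by
    intro x
    have h1 :=
      (productData_of_isLegendrianImmersion hψ₁ hψ₂ hγ hn₁ hn₂ x).finrank_mul_divJHIn_eq
    have h2 : divJHIn (ψ₁ ∘ (extChartAt I₁ x.2.1).symm) (extChartAt I₁ x.2.1 x.2.1) = 0 :=
      hC₁ x.2.1
    have h3 : divJHIn (ψ₂ ∘ (extChartAt I₂ x.2.2).symm) (extChartAt I₂ x.2.2 x.2.2) = 0 :=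
      hC₂ x.2.2
    rw [h2, h3, mul_zero, mul_zero, add_zero, add_zero] at h1
    unfold divJH
    rw [divJHIn_congr
      (legendrianProduct_comp_extChartAt_symm (I₁ := I₁) (I₂ := I₂) hφ x), extChartAt_product_apply,
      ← mul_eq_zero_iff_left (finrank_product_ne_zero (E₁ := E₁) (E₂ := E₂)), h1, neg_eq_zero]
  obtain ⟨p₀⟩ := ‹Nonempty N₁›
  obtain ⟨q₀⟩ := ‹Nonempty N₂›
  simp only [IsCMinimal, key]
  exact ⟨fun h t ht => h (⟨t, ht⟩, p₀, q₀), fun h x => h x.1 x.1.2⟩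

end Main

end

theorem corollary1
    {n₁ n₂ : ℕ}
    {N₁ : Type*} [TopologicalSpace N₁] [ChartedSpace (EuclideanSpace ℝ (Fin n₁)) N₁]
    [IsManifold (𝓡 n₁) ∞ N₁] [Nonempty N₁]
    {N₂ : Type*} [TopologicalSpace N₂] [ChartedSpace (EuclideanSpace ℝ (Fin n₂)) N₂]
    [IsManifold (𝓡 n₂) ∞ N₂] [Nonempty N₂]
    (ψ₁ : N₁ → EuclideanSpace ℂ (Fin (n₁ + 1))) (ψ₂ : N₂ → EuclideanSpace ℂ (Fin (n₂ + 1)))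
    (hψ₁ : IsLegendrianImmersion (𝓡 n₁) ψ₁) (hψ₂ : IsLegendrianImmersion (𝓡 n₂) ψ₂)
    (hC₁ : IsCMinimal (𝓡 n₁) ψ₁) (hC₂ : IsCMinimal (𝓡 n₂) ψ₂)
    (I : TopologicalSpace.Opens ℝ) (hI : (I : Set ℝ).OrdConnected) (hI' : (I : Set ℝ).Nonempty)
    (γ₁ γ₂ : ℝ → ℂ) (hγ : IsLegendreCurve I γ₁ γ₂)
    (hreg₁ : n₁ ≠ 0 → ∀ t ∈ I, γ₁ t ≠ 0) (hreg₂ : n₂ ≠ 0 → ∀ t ∈ I, γ₂ t ≠ 0)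
    (φ : I × N₁ × N₂ →
      WithLp 2 (EuclideanSpace ℂ (Fin (n₁ + 1)) × EuclideanSpace ℂ (Fin (n₂ + 1))))
    (hφ : φ = legendrianProduct I γ₁ γ₂ ψ₁ ψ₂) :
    IsLegendrianImmersion (𝓘(ℝ, ℝ).prod ((𝓡 n₁).prod (𝓡 n₂))) φ ∧
    -- arbitrary parameter on the curve: the equation holds up to a change of parameter
    (IsCMinimal (𝓘(ℝ, ℝ).prod ((𝓡 n₁).prod (𝓡 n₂))) φ ↔
      ∃ (J : Set ℝ) (h : ℝ → ℝ), IsReparametrization h J I ∧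
        ∃ l m : ℝ, SolvesODE n₁ n₂ l m J (γ₁ ∘ h) (γ₂ ∘ h)) ∧
    (IsMinimalImmersion (𝓘(ℝ, ℝ).prod ((𝓡 n₁).prod (𝓡 n₂))) φ ↔
      IsMinimalImmersion (𝓡 n₁) ψ₁ ∧ IsMinimalImmersion (𝓡 n₂) ψ₂ ∧
      ∃ (J : Set ℝ) (h : ℝ → ℝ), IsReparametrization h J I ∧
        ∃ l : ℝ, SolvesODE n₁ n₂ l 0 J (γ₁ ∘ h) (γ₂ ∘ h)) ∧
    -- the parameter with `|γ'| = |γ₁| ^ n₁ |γ₂| ^ n₂`: the equation holds as it stands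
    ((∀ t ∈ I, ‖deriv γ₁ t‖ ^ 2 + ‖deriv γ₂ t‖ ^ 2 = (‖γ₁ t‖ ^ n₁ * ‖γ₂ t‖ ^ n₂) ^ 2) →
      (IsCMinimal (𝓘(ℝ, ℝ).prod ((𝓡 n₁).prod (𝓡 n₂))) φ ↔
        ∃ l m : ℝ, SolvesODE n₁ n₂ l m I γ₁ γ₂) ∧
      (IsMinimalImmersion (𝓘(ℝ, ℝ).prod ((𝓡 n₁).prod (𝓡 n₂))) φ ↔
        IsMinimalImmersion (𝓡 n₁) ψ₁ ∧ IsMinimalImmersion (𝓡 n₂) ψ₂ ∧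
        ∃ l : ℝ, SolvesODE n₁ n₂ l 0 I γ₁ γ₂)) := by
  have hf₁ : Module.finrank ℝ (EuclideanSpace ℝ (Fin n₁)) = n₁ := finrank_euclideanSpace_fin
  have hf₂ : Module.finrank ℝ (EuclideanSpace ℝ (Fin n₂)) = n₂ := finrank_euclideanSpace_fin
  have hn₁ : Module.finrank ℝ (EuclideanSpace ℝ (Fin n₁)) ≠ 0 → ∀ t ∈ I, γ₁ t ≠ 0 := by rwa [hf₁]
  have hn₂ : Module.finrank ℝ (EuclideanSpace ℝ (Fin n₂)) ≠ 0 → ∀ t ∈ I, γ₂ t ≠ 0 := by rwa [hf₂]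
  have hC := isCMinimal_legendrianProduct_iff hφ hψ₁ hψ₂ hC₁ hC₂ hγ hn₁ hn₂
  have hM := isMinimalImmersion_legendrianProduct_iff hφ hI' hψ₁ hψ₂ hγ hn₁ hn₂
  rw [hf₁, hf₂] at hC hM
  refine ⟨isLegendrianImmersion_legendrianProduct hφ hψ₁ hψ₂ hγ hn₁ hn₂, ?_, ?_, fun hs => ?_⟩
  · rw [hC]
    exact hγ.forall_deriv_curvatureCoeff_iff_exists_reparametrization I.isOpen hI hI' hreg₁ hreg₂
  · rw [hM, hγ.forall_legendreLogDeriv_im_iff_exists_reparametrization I.isOpen hI hI' hreg₁ hreg₂]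
  -- For a Legendre curve the modulus of the determinant is the speed.
  · have hs' : ∀ t ∈ (I : Set ℝ), ‖legendreDet γ₁ γ₂ t‖ = ‖γ₁ t‖ ^ n₁ * ‖γ₂ t‖ ^ n₂ := by
      intro t ht
      have h1 := hs t ht
      rw [← Complex.normSq_eq_norm_sq, ← Complex.normSq_eq_norm_sq] at h1
      have h2 := (hγ.legendreNear I.isOpen ht).speedSq_eq
      rw [← sq_eq_sq₀ (norm_nonneg _) (by positivity), ← h2]
      exact h1
    rw [hC, hM, hγ.exists_solvesODE_iff I.isOpen hI hI' hreg₁ hreg₂ hs']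
    exact ⟨hγ.forall_deriv_curvatureCoeff_iff_exists_solvesODE I.isOpen hI hI' hreg₁ hreg₂ hs',
      Iff.rfl⟩
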